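/- **Theorem (Exponential soundness).** A *circuit game* with input set $\mathcal I$ and output set $\mathcal O$ is a relation $\mathcal R\subseteq\mathcal I\times\mathcal O$ together with a probability distribution $\pi$ on $\mathcal I$; a circuit wins it with probability $p$ if, for $x\sim\pi$, its output $y$ satisfies $(x,y)\in\mathcal R$ with probability $p$. Let $\Sigma=\{0,1\}^8$. *Planting GHZ games.* Let $r,L,\kappa$ be integers with $1\le r\le N'$, $L\ge 3$, and put $M=\lfloor N'/\sqrt r\rfloor\ge 6L$. Fix $r$ disjoint squares of side $M$ in the $N'\times N'$ grid, and in each of them $T\ge 4$ disjoint boxes of side $2L+1$ with $M^2\le\kappa\,T(2L+1)^2$. For each ordered choice of four distinct boxes $b_0,b_1,b_2,b_3$ of a square fix $\lfloor L/3\rfloor$ stars. A star consists of three paths in the square that join $b_0$ to $b_1,b_2,b_3$ and otherwise avoid the four boxes; distinct stars for the same choice of boxes are vertex-disjoint, and a star has total length at most $\kappa M$. The paths are extended inside the boxes, in a fixed way, to pairwise vertex-disjoint simple grid paths $\Gamma_j$ from a vertex $g_j\in b_0$ to a prescribed input location $u_j\in b_j$ ($j=1,2,3$). An instance consists, independently for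 each of the $r$ squares, of four uniformly random distinct boxes, uniformly random $u_j\in b_j$, a uniformly random star among those fixed for these boxes, and a uniformly random query $(x_1,x_2,x_3)\in\{000,011,101,110\}$ of the GHZ game. It is encoded as an element of $\Sigma^{[N']^2}$: each vertex of a path $\Gamma_j$ is told the directions of its neighbors on the path, $g_j$ and $u_j$ are marked as such with their label $j$, $u_j$ is given the question $x_j$, and all other vertices are blank. An output $y\in\Sigma^{[N']^2}$ wins if, in each of the $r$ copies, $$\sum_{j=1}^3\bigl(a_j-\mathrm{cor}_{s_j}(x_j)\bigr)=b_x \pmod 2,$$ where $b_x=0$ if $x=000$ and $b_x=1$ otherwise, $a_j$ is the first bit of $y$ at $u_j$, $s_j\in\mathbb Z_2^2$ is the sum over the vertices $v\neq u_j$ of $\Gamma_j$ of the first two bits of $y$ at $v$, and $\mathrm{cor}_s(0)=s_2$, $\mathrm{cor}_s(1)=s_1+s_2$ (the commutation exponent of $X^{s_1}Z^{s_2}$ with the Pauli $X$, respectively $Y$). The resulting circuit game, with $\mathcal I=\mathcal O=\Sigma^{[N']^2}$, is called a planting of $r$ copies of the GHZ game with parameters $(N',r,L,\kappa)$. *Claim.*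 There are an absolute constant $\kappa$ and, for every integer $N\ge1$, a circuit game $G_N$ which is a planting of $r=r(N)$ copies of the GHZ game with parameters $(N',r,L,\kappa)$, for some $N'=O(N)$ and $L=L(N)$, such that the following hold. * (Completeness) There are absolute constants $a,K_0,R$ such that for every $N\ge 1$ there is a quantum circuit of depth at most $3$ on the $N'\times N'$ grid, with $8+a$ qubits per vertex, whose gates are arbitrary unitaries on at most $K_0$ qubits located at vertices pairwise within distance $R$, which wins $G_N$ with probability $1$. (The 8 input bits of each vertex are loaded into 8 of its qubits, the others start in $|0\rangle$; after the last layer the same 8 qubits are measured in the computational basis to give the output.) * (Soundness) For every fan-in bound $K$ and every $\eta<1/7$ there is a constant $c>0$, depending only on $K$ and $\eta$, such that every classical (deterministic or randomized) circuit over $\Sigma$ with arbitrary gates of fan-in at most $K$, arbitrary fan-out, and depth at most $c\log N$ wins $G_N$ with probability at most $\exp(-\Omega(N^\eta))$, where the constant implicit in $\Omega$ depends only on $K$ and $\eta$. -/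

import Mathlib

/-- The type of vertices of the `N × N` grid. -/
abbrev Grid (N : ℕ) : Type := Fin N × Fin N

namespace Grid

/-- Two grid vertices are within `L∞`-distance `R` (no wrap-around). -/
def Within {N : ℕ} (R : ℕ) (v w : Grid N) : Prop :=
  v.1.val ≤ w.1.val + R ∧ w.1.val ≤ v.1.val + R ∧ v.2.val ≤ w.2.val + R ∧ w.2.val ≤ v.2.val + R

/-- The edges of the grid graph: one coordinate agrees and the other differs by one. -/
def Adj {N : ℕ} (v w : Grid N) : Prop :=
  (v.2 = w.2 ∧ (v.1.val + 1 = w.1.val ∨ w.1.val + 1 = v.1.val)) ∨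
  (v.1 = w.1 ∧ (v.2.val + 1 = w.2.val ∨ w.2.val + 1 = v.2.val))

/-- A simple path in the grid graph, given as the list of its vertices. -/
def IsPath {N : ℕ} (l : List (Grid N)) : Prop := l.Nodup ∧ l.IsChain Adj

/-- The axis-parallel square block of side `s` with lowest corner `c`. -/
def block (N : ℕ) (c : ℕ × ℕ) (s : ℕ) : Set (Grid N) :=
  {v | (c.1 ≤ v.1.val ∧ v.1.val < c.1 + s) ∧ (c.2 ≤ v.2.val ∧ v.2.val < c.2 + s)}

end Grid

/-! ### Circuit games -/

/-- The constant-size alphabet of inputs and outputs: 8-bit strings. -/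
abbrev Letter : Type := Fin 8 → Bool

/-- A circuit game with input set `I` and output set `O`: a relation together with a
probability distribution on the inputs. -/
structure CircuitGame (I O : Type) where
  dist : PMF I
  rel : Set (I × O)

open scoped Classical in
/-- The winning probability of a device which on input `x` returns `y` with probability
`beh x y`, for an input drawn from the distribution of the game. -/
noncomputable def CircuitGame.winProb {I O : Type} [Fintype I] [Fintype O]
    (G : CircuitGame I O) (beh : I → O → ℝ) : ℝ :=
  ∑ x, (G.dist x).toReal * ∑ y, if (x, y) ∈ G.rel then beh x y else 0

/-! ### Classical circuits -/

/-- A classical circuit over the alphabet `A` with input wires `ι`, output wires `ο` and gates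
of fan-in at most `K` (and arbitrary fan-out). The gates are listed in topological order; each of
them computes an arbitrary function of the values of its predecessors. -/
structure ClassicalCircuit (A ι ο : Type) (K : ℕ) where
  size : ℕ
  arity : Fin size → ℕ
  arity_le : ∀ g, arity g ≤ K
  pred : (g : Fin size) → Fin (arity g) → ι ⊕ {h : Fin size // h < g}
  op : (g : Fin size) → (Fin (arity g) → A) → A
  out : ο → ι ⊕ Fin size

namespace ClassicalCircuit

variable {A ι ο : Type} {K : ℕ}

/-- The value computed by a gate. -/
def gateVal (C : ClassicalCircuit A ι ο K) (x : ι → A) (g : Fin C.size) : A :=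
  C.op g fun k =>
    match C.pred g k with
    | Sum.inl i => x i
    | Sum.inr h => gateVal C x h.1
termination_by g
decreasing_by exact h.2

/-- The output of the circuit. -/
def eval (C : ClassicalCircuit A ι ο K) (x : ι → A) (o : ο) : A :=
  match C.out o with
  | Sum.inl i => x i
  | Sum.inr g => C.gateVal x g

/-- The number of gates on the longest path that ends in the given gate. -/
def gateDepth (C : ClassicalCircuit A ι ο K) (g : Fin C.size) : ℕ :=
  (Finset.univ.sup fun k =>
    match C.pred g k with
    | Sum.inl _ => 0
    | Sum.inr h => gateDepth C h.1) + 1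
termination_by g
decreasing_by exact h.2

/-- The depth of the circuit: the number of gates on a longest path. -/
def depth (C : ClassicalCircuit A ι ο K) : ℕ := Finset.univ.sup C.gateDepth

end ClassicalCircuit

open scoped Classical in
/-- The input-output behavior of a (randomized) classical circuit on the grid: besides
the input letter of every vertex it has `a` further input wires that hold a random string drawn from
`ρ`, independently of the input. Deterministic circuits are the case `a = 0`. -/
noncomputable def classicalBehavior {N K a : ℕ} (ρ : PMF (Fin a → Letter))
    (C : ClassicalCircuit Letter (Grid N ⊕ Fin a) (Grid N) K)
    (x y : Grid N → Letter) : ℝ :=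
  ∑ s, if C.eval (Sum.elim x s) = y then (ρ s).toReal else 0

/-! ### Quantum circuits -/

/-- A quantum gate on a set `W` of qubits: a unitary on the qubits of its support. -/
structure QGate (W : Type) [DecidableEq W] where
  support : Finset W
  mat : Matrix (support → Bool) (support → Bool) ℂ
  isUnitary : mat.conjTranspose * mat = 1

/-- The action of a gate on a state vector, written in the computational basis. -/
noncomputable def QGate.apply {W : Type} [DecidableEq W] (g : QGate W) (ψ : (W → Bool) → ℂ) : (W → Bool) → ℂ :=
  fun z => ∑ t : g.support → Bool,
    g.mat (fun k => z k) t * ψ (fun k => if h : k ∈ g.support then t ⟨k, h⟩ else z k)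

/-- A layer of a quantum circuit: gates that act on pairwise disjoint sets of qubits. -/
structure QLayer (W : Type) [DecidableEq W] where
  gates : List (QGate W)
  disjoint : gates.Pairwise fun g h => Disjoint g.support h.support

/-- The action of a layer. The gates commute, so their order in the list is immaterial. -/
noncomputable def QLayer.apply {W : Type} [DecidableEq W] (l : QLayer W) (ψ : (W → Bool) → ℂ) :
    (W → Bool) → ℂ :=
  l.gates.foldr QGate.apply ψ

/-- The qubits of a quantum circuit on the grid: each vertex holds 8 qubits for its
input and output letter and `a` ancilla qubits. -/
abbrev QWire (N a : ℕ) : Type := Grid N × (Fin 8 ⊕ Fin a)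

/-- A layered quantum circuit on the grid; the head of the list is the first layer. -/
abbrev QCircuit (N a : ℕ) : Type := List (QLayer (QWire N a))

namespace QCircuit

variable {N a : ℕ}

/-- The number of layers. -/
def depth (Q : QCircuit N a) : ℕ := List.length Q

/-- Every gate acts on at most `K` qubits. -/
def FanIn (Q : QCircuit N a) (K : ℕ) : Prop :=
  ∀ l ∈ Q, ∀ g ∈ l.gates, g.support.card ≤ K

/-- Every gate acts on qubits at vertices that are pairwise within distance `R` in the grid. -/
def GeometricallyLocal (Q : QCircuit N a) (R : ℕ) : Prop :=
  ∀ l ∈ Q, ∀ g ∈ l.gates, ∀ p ∈ g.support, ∀ q ∈ g.support, Grid.Within R p.1 q.1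

open scoped Classical in
/-- The initial state: the computational basis state holding the input letters, with all ancilla
qubits equal to zero. -/
noncomputable def init (a : ℕ) (x : Grid N → Letter) : (QWire N a → Bool) → ℂ :=
  fun z => if z = (fun p => Sum.elim (x p.1) (fun _ => false) p.2) then 1 else 0

/-- The final state on input `x`. -/
noncomputable def finalState (Q : QCircuit N a) (x : Grid N → Letter) : (QWire N a → Bool) → ℂ :=
  List.foldl (fun ψ l => QLayer.apply l ψ) (init a x) Q

open scoped Classical in
/-- The Born rule: all qubits of the final state are measured in the computational basis and the
letter qubits of each vertex form its output letter. -/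
noncomputable def behavior (Q : QCircuit N a) (x y : Grid N → Letter) : ℝ :=
  ∑ z : QWire N a → Bool,
    if (fun v k => z (v, Sum.inl k)) = y then ‖Q.finalState x z‖ ^ 2 else 0

end QCircuit

/-! ### The GHZ game -/

/-- The queries of the GHZ game; a query is drawn uniformly from this set. -/
def ghzQueries : Finset (Fin 3 → ZMod 2) :=
  {![0, 0, 0], ![0, 1, 1], ![1, 0, 1], ![1, 1, 0]}

/-- The right-hand side of the win condition of the GHZ game: the sum of the
three answers has to be `0` on the query `000` and `1` on the other queries. -/
def ghzTarget (x : Fin 3 → ZMod 2) : ZMod 2 := if x = 0 then 0 else 1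

/-- The label `(s₀, s₁)` of the one-qubit Pauli `X ^ s₀ Z ^ s₁` that a question asks to measure
(up to phase): `X` for the question `0` and `Y` for the question `1`. -/
def pauliLabel (q : ZMod 2) : ZMod 2 × ZMod 2 := (1, q)

/-- The correction value: the exponent of `-1` in the group commutator
of the one-qubit Paulis labelled `q` and `s`. -/
def cor (s q : ZMod 2 × ZMod 2) : ZMod 2 := q.1 * s.2 + q.2 * s.1

/-- The win condition of the rotated GHZ game on query `x`, for answers `a` and
rotation strings `s`. -/
def ghzRotatedWin (x a : Fin 3 → ZMod 2) (s : Fin 3 → ZMod 2 × ZMod 2) : Prop :=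
  ∑ j, (a j - cor (s j) (pauliLabel (x j))) = ghzTarget x

/-! ### Local encoding of the paths of a star -/

/-- The four neighbor directions of a grid vertex. -/
inductive Dir
  | left
  | right
  | down
  | up

/-- Two-bit code of a direction. -/
def Dir.bits : Dir → Bool × Bool
  | left => (false, false)
  | right => (false, true)
  | down => (true, false)
  | up => (true, true)

/-- The direction from a vertex to one of its neighbors. -/
def Grid.dir {N : ℕ} (v w : Grid N) : Dir :=
  if w.1 < v.1 then Dir.left else if v.1 < w.1 then Dir.right
  else if w.2 < v.2 then Dir.down else Dir.up

/-- What the input tells a grid vertex: it is on no star (`blank`); or it is an inner vertex of a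
path, to be teleported through from direction `p` to direction `n` (`relay`); or it is the first
vertex of the `j`-th path, which continues in direction `n` (`hub`); or it is the `j`-th input location,
reached from direction `p`, with question `q` (`term`). -/
inductive VertexSymbol
  | blank
  | relay (p n : Dir)
  | hub (j : Fin 3) (n : Dir)
  | term (j : Fin 3) (p : Dir) (q : ZMod 2)

/-- The encoding of the information at a vertex in one letter. -/
def VertexSymbol.code : VertexSymbol → Letter
  | blank => ![false, false, false, false, false, false, false, false]
  | relay p n => ![false, true, false, false, p.bits.1, p.bits.2, n.bits.1, n.bits.2]
  | hub j n => ![true, false, decide (j = 1), decide (j = 2), false, false, n.bits.1, n.bits.2]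
  | term j p q =>
      ![true, true, decide (j = 1), decide (j = 2), p.bits.1, p.bits.2, decide (q = 1), false]

/-- The information at `v` that describes the `j`-th path `l` (from the center of a
star to the `j`-th input location) and the question `q` at its last vertex. -/
def pathSymbol {N : ℕ} (l : List (Grid N)) (j : Fin 3) (q : ZMod 2) (v : Grid N) : VertexSymbol :=
  if v ∈ l then
    if l.idxOf v = 0 then VertexSymbol.hub j (v.dir (l.getD 1 v))
    else if l.idxOf v + 1 = l.length then VertexSymbol.term j (v.dir (l.getD (l.idxOf v - 1) v)) q
    else VertexSymbol.relay (v.dir (l.getD (l.idxOf v - 1) v)) (v.dir (l.getD (l.idxOf v + 1) v))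
  else VertexSymbol.blank

/-! ### Planting `r` copies of the GHZ game in the grid -/

/-- The side length `⌊N / √r⌋` of the squares that hold the `r` copies. -/
def squareSide (N r : ℕ) : ℕ := Nat.sqrt (N ^ 2 / r)

/-- The fixed choices behind the random input patterns with `r` stars on the `N × N` grid: squares, boxes
of side `2L + 1` in each square, and for any four distinct boxes `b 0` (the central one), `b 1`, `b 2`,
`b 3` of a square a family of `⌊L / 3⌋` stars. The `j`-th path of a star is `arm`; it is
extended by `hub` inside the central box and by `tail` inside the box of the `j`-th player, up to
the input location at position `o` of that box. The constant `κ` bounds the density of the boxes and the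
lengths of the paths. -/
structure Planting (κ N r L : ℕ) where
  /-- the number of boxes in each square -/
  T : ℕ
  one_le_r : 1 ≤ r
  r_le : r ≤ N
  three_le_L : 3 ≤ L
  six_L_le : 6 * L ≤ squareSide N r
  four_le_T : 4 ≤ T
  /-- the lowest corner of each square -/
  corner : Fin r → ℕ × ℕ
  corner_le : ∀ i, (corner i).1 + squareSide N r ≤ N ∧ (corner i).2 + squareSide N r ≤ N
  squares_disjoint : Pairwise fun i i' => Disjoint
    (Grid.block N (corner i) (squareSide N r)) (Grid.block N (corner i') (squareSide N r))
  /-- the lowest corner of each box -/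
  anchor : Fin r → Fin T → ℕ × ℕ
  box_in_square : ∀ i t,
    ((corner i).1 ≤ (anchor i t).1 ∧
      (anchor i t).1 + (2 * L + 1) ≤ (corner i).1 + squareSide N r) ∧
    ((corner i).2 ≤ (anchor i t).2 ∧
      (anchor i t).2 + (2 * L + 1) ≤ (corner i).2 + squareSide N r)
  boxes_disjoint : ∀ i, Pairwise fun t t' => Disjoint
    (Grid.block N (anchor i t) (2 * L + 1)) (Grid.block N (anchor i t') (2 * L + 1))
  /-- the boxes cover a constant fraction of each square -/
  dense : squareSide N r ^ 2 ≤ κ * (T * (2 * L + 1) ^ 2)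
  arm : (i : Fin r) → (b : Fin 4 ↪ Fin T) → (s : Fin (L / 3)) → (j : Fin 3) → List (Grid N)
  hub : (i : Fin r) → (b : Fin 4 ↪ Fin T) → (s : Fin (L / 3)) → (j : Fin 3) → List (Grid N)
  tail : (i : Fin r) → (b : Fin 4 ↪ Fin T) → (s : Fin (L / 3)) → (j : Fin 3) →
    (o : Fin (2 * L + 1) × Fin (2 * L + 1)) → List (Grid N)
  /-- each arm joins the central box to the `j`-th box and otherwise stays in the square and
  outside the four boxes -/
  arm_spec : ∀ i b s j, ∃ v mid w, arm i b s j = v :: (mid ++ [w]) ∧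
    v ∈ Grid.block N (anchor i (b 0)) (2 * L + 1) ∧
    w ∈ Grid.block N (anchor i (b j.succ)) (2 * L + 1) ∧
    ∀ p ∈ mid, p ∈ Grid.block N (corner i) (squareSide N r) ∧
      ∀ t, p ∉ Grid.block N (anchor i (b t)) (2 * L + 1)
  /-- the paths of distinct stars of a family are vertex-disjoint -/
  stars_disjoint : ∀ i b s s' j j', s ≠ s' → (arm i b s j).Disjoint (arm i b s' j')
  /-- the total length of the paths of a star -/
  length_le : ∀ i b s, ∑ j, (arm i b s j).length ≤ κ * squareSide N r
  hub_in_box : ∀ i b s j, ∀ p ∈ hub i b s j, p ∈ Grid.block N (anchor i (b 0)) (2 * L + 1)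
  tail_in_box : ∀ i b s j o, ∀ p ∈ tail i b s j o,
    p ∈ Grid.block N (anchor i (b j.succ)) (2 * L + 1)
  /-- the extended paths are simple paths of the grid graph -/
  isPath : ∀ i b s j o, Grid.IsPath (hub i b s j ++ arm i b s j ++ tail i b s j o)
  /-- the extended `j`-th path ends in the input location at position `o` of the `j`-th box -/
  path_last : ∀ i b s j o, ∃ v ∈ (hub i b s j ++ arm i b s j ++ tail i b s j o).getLast?,
    v.1.val = (anchor i (b j.succ)).1 + o.1.val ∧ v.2.val = (anchor i (b j.succ)).2 + o.2.val
  /-- the extended paths of one star are vertex-disjoint -/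
  paths_disjoint : ∀ i b s j j' o o', j ≠ j' →
    (hub i b s j ++ arm i b s j ++ tail i b s j o).Disjoint
      (hub i b s j' ++ arm i b s j' ++ tail i b s j' o')

namespace Planting

variable {κ N r L : ℕ}

/-- The random choices for one copy of the GHZ game, all uniform and independent: four distinct boxes,
the positions of the three input locations in their boxes, a star of the family of these boxes, and a
query of the GHZ game. -/
abbrev Choice (P : Planting κ N r L) : Type :=
  (Fin 4 ↪ Fin P.T) × (Fin 3 → Fin (2 * L + 1) × Fin (2 * L + 1)) × Fin (L / 3) × ghzQueries

/-- The random choices for all `r` copies. -/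
abbrev Instance (P : Planting κ N r L) : Type := Fin r → P.Choice

theorem instance_nonempty (P : Planting κ N r L) : Nonempty P.Instance := by
  have h1 : Nonempty (Fin 4 ↪ Fin P.T) := ⟨Fin.castLEEmb P.four_le_T⟩
  have h2 : Nonempty (Fin (L / 3)) := ⟨⟨0, by have := P.three_le_L; omega⟩⟩
  have h3 : Nonempty ghzQueries := ⟨⟨![0, 0, 0], by simp [ghzQueries]⟩⟩
  exact inferInstance

/-- The `j`-th (extended) path of the star of the `i`-th copy, from the center of the star to the
input location of the `j`-th player. -/
def path (P : Planting κ N r L) (c : P.Instance) (i : Fin r) (j : Fin 3) : List (Grid N) :=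
  P.hub i (c i).1 (c i).2.2.1 j ++ P.arm i (c i).1 (c i).2.2.1 j ++
    P.tail i (c i).1 (c i).2.2.1 j ((c i).2.1 j)

/-- The query of the `i`-th copy. -/
def query (P : Planting κ N r L) (c : P.Instance) (i : Fin r) : Fin 3 → ZMod 2 :=
  (c i).2.2.2.1

open scoped Classical in
/-- The input string that describes an instance, vertex by vertex. The paths are pairwise disjoint, so
that the path through `v` is unique if there is one. -/
noncomputable def encode (P : Planting κ N r L) (c : P.Instance) (v : Grid N) : Letter :=
  if h : ∃ p : Fin r × Fin 3, v ∈ P.path c p.1 p.2 then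
    (pathSymbol (P.path c h.choose.1 h.choose.2) h.choose.2
      (P.query c h.choose.1 h.choose.2) v).code
  else VertexSymbol.blank.code

/-- A bit as an element of `ℤ/2`. -/
def bit (b : Bool) : ZMod 2 := if b then 1 else 0

/-- The rotation reported along a path: the sum of the two-bit teleportation outcomes `(y₀, y₁)`,
standing for `X ^ y₀ Z ^ y₁`, at all vertices of the path but the last. -/
def rotation (y : Grid N → Letter) (l : List (Grid N)) : ZMod 2 × ZMod 2 :=
  (l.dropLast.map fun v => (bit (y v 0), bit (y v 1))).sum

/-- The answer reported at the last vertex of a path. -/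
def answer (y : Grid N → Letter) (l : List (Grid N)) : ZMod 2 :=
  (l.getLast?.map fun v => bit (y v 0)).getD 0

/-- The output `y` wins all `r` planted copies of the GHZ game. -/
def Wins (P : Planting κ N r L) (c : P.Instance) (y : Grid N → Letter) : Prop :=
  ∀ i, ghzRotatedWin (P.query c i) (fun j => answer y (P.path c i j))
    (fun j => rotation y (P.path c i j))

/-- The circuit game obtained by planting `r` copies of the GHZ game in the grid. -/
noncomputable def game (P : Planting κ N r L) :
    CircuitGame (Grid N → Letter) (Grid N → Letter) where
  dist := haveI := P.instance_nonempty
    (PMF.uniformOfFintype P.Instance).map P.encode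
  rel := {xy | (∃ c, P.encode c = xy.1) ∧ ∀ c, P.encode c = xy.1 → P.Wins c xy.2}

end Planting

/-!
Soundness. In a circuit of depth `d` and fan-in `K` every output depends on at most `(K + 1) ^ d`
inputs, and `d ≤ c log N` keeps this below a small power of `N`. The paths of all copies together
therefore see few vertices compared with the size of a box, and since the input locations are
uniform in their boxes, a copy is isolated with high probability: the outputs along its own paths
and along those of the previous copies see no input location of this copy, except that a path may
see its own end. The players of an isolated copy follow a classical strategy for the GHZ game, up to
corrections computed locally, so that they lose with probability at least `1 / 4` even given the
outcomes of the previous copies. Integrating out the copies one by one bounds the probability of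
winning by `(7 / 8) ^ r` with `r` of order `√N`.

Completeness. Two layers suffice: the first one prepares Bell pairs on all edges of the grid and GHZ
states on all triples of vertically consecutive vertices, and in the second one each vertex measures
the qubits that its input letter points to. Bell measurements teleport a GHZ state along the paths
of a star to the input locations, up to Pauli corrections that `cor` accounts for. Rather than
following the state, the proof tracks the stabilizer that flips all measured qubits along the star:
the state before the measurement is an eigenvector of it, and this is the parity condition on the
outcomes.

Each square carries four boxes on its antidiagonal. The path of a star from one box to another
leaves the former in a row and enters the latter in a column that are reserved for it, so that
distinct paths do not meet.
-/

open scoped Finset BigOperators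

/-! ### Light cones of classical circuits -/

namespace ClassicalCircuit

variable {A ι ο : Type} {K : ℕ}

theorem gateDepth_lt_of_pred_eq (C : ClassicalCircuit A ι ο K) {g : Fin C.size}
    {k : Fin (C.arity g)} {h : {h : Fin C.size // h < g}} (hk : C.pred g k = Sum.inr h) :
    C.gateDepth h < C.gateDepth g := by
  conv_rhs => rw [gateDepth]
  refine Nat.lt_succ_of_le ((Eq.le ?_).trans (Finset.le_sup (Finset.mem_univ k)))
  rw [hk]

theorem exists_dependsOn_gateVal (C : ClassicalCircuit A ι ο K) (g : Fin C.size) :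
    ∃ S : Finset ι, #S ≤ (K + 1) ^ C.gateDepth g ∧ DependsOn (C.gateVal · g) (S : Set ι) := by
  classical
  induction g using WellFoundedLT.induction with
  | ind g ih =>
    obtain ⟨d, hd⟩ : ∃ d, C.gateDepth g = d + 1 := ⟨_, by rw [gateDepth]⟩
    have hpred (k : Fin (C.arity g)) : ∃ S : Finset ι, #S ≤ (K + 1) ^ d ∧
        DependsOn (fun x : ι → A => match C.pred g k with
          | Sum.inl i => x i
          | Sum.inr h => C.gateVal x h.1) (S : Set ι) := by
      cases hk : C.pred g k with
      | inl i =>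
        exact ⟨{i}, by simpa using Nat.one_le_pow _ _ (Nat.succ_pos K), fun x y h => h i (by simp)⟩
      | inr h =>
        obtain ⟨S, hS, hdep⟩ := ih h.1 h.2
        have hlt := C.gateDepth_lt_of_pred_eq hk
        exact ⟨S, hS.trans (Nat.pow_le_pow_right (Nat.succ_pos K) (by omega)), hdep⟩
    choose S hS hdep using hpred
    refine ⟨Finset.univ.biUnion S, ?_, fun x y h => ?_⟩
    · calc #(Finset.univ.biUnion S) ≤ Fintype.card (Fin (C.arity g)) * (K + 1) ^ d :=
            Finset.card_biUnion_le_card_mul _ _ _ fun k _ => hS k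
        _ ≤ (K + 1) * (K + 1) ^ d := by
            rw [Fintype.card_fin]
            exact Nat.mul_le_mul_right _ ((C.arity_le g).trans (Nat.le_succ K))
        _ = (K + 1) ^ C.gateDepth g := by rw [hd, pow_succ']
    · simp only
      rw [gateVal, gateVal]
      congr 1
      funext k
      exact hdep k fun i hi => h i (Finset.mem_biUnion.2 ⟨k, Finset.mem_univ k, hi⟩)

theorem exists_dependsOn_eval (C : ClassicalCircuit A ι ο K) (o : ο) :
    ∃ S : Finset ι, #S ≤ (K + 1) ^ C.depth ∧ DependsOn (C.eval · o) (S : Set ι) := by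
  unfold eval
  cases C.out o with
  | inl i =>
    exact ⟨{i}, by simpa using Nat.one_le_pow _ _ (Nat.succ_pos K), fun x y h => h i (by simp)⟩
  | inr g =>
    obtain ⟨S, hS, hdep⟩ := C.exists_dependsOn_gateVal g
    exact ⟨S, hS.trans (Nat.pow_le_pow_right (Nat.succ_pos K)
      (Finset.le_sup (Finset.mem_univ g))), hdep⟩

theorem exists_dependsOn_eval_elim {κ : Type} (C : ClassicalCircuit A (ι ⊕ κ) ο K) (s : κ → A) :
    ∃ S : ο → Finset ι, (∀ o, #(S o) ≤ (K + 1) ^ C.depth) ∧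
      ∀ o, DependsOn (fun x : ι → A => C.eval (Sum.elim x s) o) (S o : Set ι) := by
  choose S hS hdep using C.exists_dependsOn_eval
  refine ⟨fun o => (S o).toLeft, fun o => Finset.card_toLeft_le.trans (hS o),
    fun o x y h => hdep o ?_⟩
  rintro (i | k) hi
  · exact h i (Finset.mem_toLeft.2 hi)
  · rfl

end ClassicalCircuit

/-! ### Averaging coordinate by coordinate -/

section Averaging

variable {ι : Type*} [Fintype ι] {α : ι → Type*} [∀ i, Fintype (α i)]

theorem expect_expect_update [DecidableEq ι] {M : Type*} [AddCommMonoid M] [Module ℚ≥0 M] (m : ι)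
    [Nonempty (α m)] (f : (∀ i, α i) → M) :
    𝔼 p, 𝔼 y, f (Function.update p m y) = 𝔼 p, f p := by
  have swap_involutive : Function.Involutive
      fun z : (∀ i, α i) × α m => (Function.update z.1 m z.2, z.1 m) := fun z => by simp
  calc 𝔼 p, 𝔼 y, f (Function.update p m y)
      = 𝔼 z : (∀ i, α i) × α m, f (Function.update z.1 m z.2) := by
        rw [← Finset.univ_product_univ, Finset.expect_product]
    _ = 𝔼 z : (∀ i, α i) × α m, f z.1 :=
        Fintype.expect_bijective _ swap_involutive.bijective _ _ fun _ => rfl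
    _ = 𝔼 p, f p := by
        rw [← Finset.univ_product_univ, Finset.expect_product]
        simp only [Fintype.expect_const]

/-- The factors are integrated out from the last one to the first one: `w m` is the only factor
that depends on the coordinate of the last index `m` of `G`. -/
theorem expect_prod_le_pow_card [LinearOrder ι] [∀ i, Nonempty (α i)] {w : ι → (∀ i, α i) → ℝ}
    {τ : ℝ} (hw : ∀ k p, 0 ≤ w k p) (G : Finset ι)
    (hupdate : ∀ k ∈ G, ∀ m ∈ G, k < m → ∀ p y, w k (Function.update p m y) = w k p)
    (hτ : ∀ k ∈ G, ∀ p, 𝔼 y, w k (Function.update p k y) ≤ τ) :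
    𝔼 p, ∏ k ∈ G, w k p ≤ τ ^ #G := by
  induction G using Finset.induction_on_max with
  | empty => simp
  | insert m G hm ih =>
    have hmG : m ∉ G := fun h => lt_irrefl _ (hm m h)
    have hmem : m ∈ insert m G := Finset.mem_insert_self m G
    have hsub : G ⊆ insert m G := Finset.subset_insert m G
    have hτ₀ : 0 ≤ τ :=
      (Finset.expect_nonneg fun _ _ => hw m _).trans (hτ m hmem (Classical.arbitrary _))
    have hprod (p : ∀ i, α i) (y : α m) :
        ∏ k ∈ insert m G, w k (Function.update p m y) =
          (∏ k ∈ G, w k p) * w m (Function.update p m y) := by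
      rw [Finset.prod_insert hmG, mul_comm]
      congr 1
      exact Finset.prod_congr rfl fun k hk => hupdate k (hsub hk) m hmem (hm k hk) p y
    calc 𝔼 p, ∏ k ∈ insert m G, w k p
        = 𝔼 p, (∏ k ∈ G, w k p) * 𝔼 y, w m (Function.update p m y) := by
          rw [← expect_expect_update m]
          simp only [hprod, Finset.mul_expect]
      _ ≤ 𝔼 p, (∏ k ∈ G, w k p) * τ :=
          Finset.expect_le_expect fun p _ => mul_le_mul_of_nonneg_left (hτ m hmem p)
            (Finset.prod_nonneg fun k _ => hw k p)
      _ = (𝔼 p, ∏ k ∈ G, w k p) * τ := by rw [Finset.expect_mul]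
      _ ≤ τ ^ #G * τ := mul_le_mul_of_nonneg_right
          (ih (fun k hk l hl => hupdate k (hsub hk) l (hsub hl)) fun k hk => hτ k (hsub hk)) hτ₀
      _ = τ ^ #(insert m G) := by rw [Finset.card_insert_of_notMem hmG, pow_succ]

theorem expect_boole_exists_le_sum {Ω κ : Type*} [Fintype Ω] [Fintype κ] (A : κ → Ω → Prop)
    [∀ i ω, Decidable (A i ω)] [∀ ω, Decidable (∃ i, A i ω)] :
    𝔼 ω, (if ∃ i, A i ω then (1 : ℝ) else 0) ≤ ∑ i, 𝔼 ω, if A i ω then (1 : ℝ) else 0 := by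
  rw [← Finset.expect_sum_comm]
  refine Finset.expect_le_expect fun ω _ => ?_
  split_ifs with h
  · obtain ⟨i, hi⟩ := h
    calc (1 : ℝ) = if A i ω then 1 else 0 := (if_pos hi).symm
      _ ≤ ∑ i, if A i ω then 1 else 0 :=
        Finset.single_le_sum (f := fun i => if A i ω then (1 : ℝ) else 0)
          (fun _ _ => by positivity) (Finset.mem_univ i)
  · positivity

end Averaging

/-! ### The classical value of the GHZ game -/

theorem card_ghzQueries : Fintype.card ghzQueries = 4 := by
  rw [Fintype.card_coe]; decide

theorem exists_sum_ne_ghzTarget (f : Fin 3 → ZMod 2 → ZMod 2) :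
    ∃ x : ghzQueries, ∑ j, f j (x.1 j) ≠ ghzTarget x := by
  simp only [Subtype.exists, Fin.sum_univ_three]
  generalize f 0 = f₀, f 1 = f₁, f 2 = f₂
  revert f₀ f₁ f₂
  decide

theorem exists_sum_ne_ghzTarget_of_factorsThrough {g : ghzQueries → Fin 3 → ZMod 2}
    (hg : ∀ j, Function.FactorsThrough (g · j) (·.1 j)) :
    ∃ x : ghzQueries, ∑ j, g x j ≠ ghzTarget x := by
  obtain ⟨x, hx⟩ := exists_sum_ne_ghzTarget
    fun j => Function.extend (fun x : ghzQueries => x.1 j) (g · j) 0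
  refine ⟨x, ?_⟩
  simpa only [(hg _).extend_apply] using hx

/-! ### Soundness of planted games -/

theorem pathSymbol_congr {N : ℕ} {l : List (Grid N)} (j : Fin 3) {q q' : ZMod 2} {v : Grid N}
    (h : l.getLast? = some v → q = q') : pathSymbol l j q v = pathSymbol l j q' v := by
  unfold pathSymbol
  split_ifs with hv _ hlast
  · rfl
  · rw [h]
    rw [List.getLast?_eq_getElem?, ← hlast, Nat.add_sub_cancel,
      List.getElem?_eq_getElem (List.idxOf_lt_length_iff.2 hv), List.getElem_idxOf]
  · rfl
  · rfl

namespace Planting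

variable {κ N r L : ℕ}

/-- The random choices for one copy other than its query: the four boxes, the positions of the
input locations in their boxes, and the star. -/
abbrev Pos (P : Planting κ N r L) : Type :=
  (Fin 4 ↪ Fin P.T) × (Fin 3 → Fin (2 * L + 1) × Fin (2 * L + 1)) × Fin (L / 3)

theorem pos_nonempty (P : Planting κ N r L) : Nonempty P.Pos :=
  P.instance_nonempty.map fun c =>
    ⟨(c ⟨0, P.one_le_r⟩).1, (c ⟨0, P.one_le_r⟩).2.1, (c ⟨0, P.one_le_r⟩).2.2.1⟩

/-- An instance, split into the positions and the queries of the `r` copies. -/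
def instEquiv (P : Planting κ N r L) :
    (Fin r → P.Pos) × (Fin r → ghzQueries) ≃ P.Instance where
  toFun z i := ((z.1 i).1, (z.1 i).2.1, (z.1 i).2.2, z.2 i)
  invFun c := (fun i => ((c i).1, (c i).2.1, (c i).2.2.1), fun i => (c i).2.2.2)
  left_inv _ := rfl
  right_inv _ := rfl

/-- The `j`-th extended path of the `i`-th copy, as a function of the position of this copy. -/
def pathAt (P : Planting κ N r L) (i : Fin r) (y : P.Pos) (j : Fin 3) : List (Grid N) :=
  P.hub i y.1 y.2.2 j ++ P.arm i y.1 y.2.2 j ++ P.tail i y.1 y.2.2 j (y.2.1 j)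

/-- The input location of the `j`-th player of the `i`-th copy. -/
noncomputable def endpoint (P : Planting κ N r L) (i : Fin r) (y : P.Pos) (j : Fin 3) : Grid N :=
  (P.path_last i y.1 y.2.2 j (y.2.1 j)).choose

theorem getLast?_pathAt (P : Planting κ N r L) (i : Fin r) (y : P.Pos) (j : Fin 3) :
    (P.pathAt i y j).getLast? = some (P.endpoint i y j) :=
  (P.path_last i y.1 y.2.2 j (y.2.1 j)).choose_spec.1

theorem endpoint_val (P : Planting κ N r L) (i : Fin r) (y : P.Pos) (j : Fin 3) :
    (P.endpoint i y j).1.val = (P.anchor i (y.1 j.succ)).1 + (y.2.1 j).1.val ∧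
      (P.endpoint i y j).2.val = (P.anchor i (y.1 j.succ)).2 + (y.2.1 j).2.val :=
  (P.path_last i y.1 y.2.2 j (y.2.1 j)).choose_spec.2

theorem encode_instEquiv_congr (P : Planting κ N r L) (p : Fin r → P.Pos)
    {x x' : Fin r → ghzQueries} {v : Grid N}
    (h : ∀ i j, P.endpoint i (p i) j = v → (x i).1 j = (x' i).1 j) :
    P.encode (P.instEquiv (p, x)) v = P.encode (P.instEquiv (p, x')) v := by
  unfold encode
  change (if hv : ∃ z : Fin r × Fin 3, v ∈ P.pathAt z.1 (p z.1) z.2 then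
      (pathSymbol (P.pathAt _ (p hv.choose.1) _) _ ((x _).1 _) v).code else _) =
    if hv : ∃ z : Fin r × Fin 3, v ∈ P.pathAt z.1 (p z.1) z.2 then
      (pathSymbol (P.pathAt _ (p hv.choose.1) _) _ ((x' _).1 _) v).code else _
  split_ifs with hv
  · congr 1
    exact pathSymbol_congr _ fun hl =>
      h _ _ (Option.some_injective _ ((P.getLast?_pathAt _ _ _).symm.trans hl))
  · rfl

/-- The contribution of a player with question `q` to the win condition: the answer at the end of
the path `l`, corrected by the rotation along `l`. -/
def reply (y : Grid N → Letter) (l : List (Grid N)) (q : ZMod 2) : ZMod 2 :=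
  answer y l - cor (rotation y l) (pauliLabel q)

theorem reply_congr {y y' : Grid N → Letter} {l : List (Grid N)} (q : ZMod 2)
    (h : ∀ v ∈ l, y v = y' v) : reply y l q = reply y' l q := by
  have answer_eq : answer y l = answer y' l := by
    unfold answer
    cases hl : l.getLast? with
    | none => rfl
    | some v => simp [h v (List.mem_of_getLast? hl)]
  have rotation_eq : rotation y l = rotation y' l := by
    unfold rotation
    congr 1
    exact List.map_congr_left fun v hv => by rw [h v (List.mem_of_mem_dropLast hv)]
  rw [reply, reply, answer_eq, rotation_eq]

/-- The inputs that the outputs along the `j`-th path of the `i`-th copy depend on, when the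
output at `v` only depends on the inputs in `S v`. -/
def cone (P : Planting κ N r L) (S : Grid N → Finset (Grid N)) (i : Fin r) (y : P.Pos)
    (j : Fin 3) : Finset (Grid N) :=
  (P.pathAt i y j).toFinset.biUnion S

theorem mem_cone {P : Planting κ N r L} {S : Grid N → Finset (Grid N)} {i : Fin r} {y : P.Pos}
    {j : Fin 3} {u : Grid N} : u ∈ P.cone S i y j ↔ ∃ v ∈ P.pathAt i y j, u ∈ S v := by
  simp only [cone, Finset.mem_biUnion, List.mem_toFinset]

theorem card_cone_le (P : Planting κ N r L) {S : Grid N → Finset (Grid N)} {B Λ : ℕ}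
    (hS : ∀ o, #(S o) ≤ B) (hΛ : ∀ i y j, (P.pathAt i y j).length ≤ Λ) (i : Fin r)
    (y : P.Pos) (j : Fin 3) : #(P.cone S i y j) ≤ Λ * B :=
  (Finset.card_biUnion_le_card_mul _ _ _ fun v _ => hS v).trans
    (Nat.mul_le_mul_right _ ((List.toFinset_card_le _).trans (hΛ i y j)))

/-- No outputs along a path of a copy up to the `k`-th one depend on an input of the `k`-th copy,
except for those on the path that leads to this input. -/
def Isolated (P : Planting κ N r L) (S : Grid N → Finset (Grid N)) (p : Fin r → P.Pos)
    (k : Fin r) : Prop :=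
  ∀ j i j', i ≤ k → (i, j') ≠ (k, j) → P.endpoint k (p k) j ∉ P.cone S i (p i) j'

theorem isolated_congr (P : Planting κ N r L) (S : Grid N → Finset (Grid N))
    {p p' : Fin r → P.Pos} {k : Fin r} (h : ∀ i ≤ k, p i = p' i) :
    P.Isolated S p k ↔ P.Isolated S p' k := by
  unfold Isolated
  refine forall₄_congr fun j i j' hi => ?_
  rw [h k le_rfl, h i hi]

/-- The output of the map `F` on the instance with positions `p` and queries `x`. -/
noncomputable def out (P : Planting κ N r L) (F : (Grid N → Letter) → Grid N → Letter)
    (p : Fin r → P.Pos) (x : Fin r → ghzQueries) : Grid N → Letter :=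
  F (P.encode (P.instEquiv (p, x)))

/-- The map `F` wins the `k`-th copy on the instance with positions `p` and queries `x`. -/
def WinsCopy (P : Planting κ N r L) (F : (Grid N → Letter) → Grid N → Letter)
    (p : Fin r → P.Pos) (x : Fin r → ghzQueries) (k : Fin r) : Prop :=
  ∑ j, reply (P.out F p x) (P.pathAt k (p k) j) ((x k).1 j) = ghzTarget (x k).1

theorem wins_instEquiv_iff (P : Planting κ N r L) (F : (Grid N → Letter) → Grid N → Letter)
    (p : Fin r → P.Pos) (x : Fin r → ghzQueries) :
    P.Wins (P.instEquiv (p, x)) (F (P.encode (P.instEquiv (p, x)))) ↔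
      ∀ k, P.WinsCopy F p x k := Iff.rfl

section Local

variable (P : Planting κ N r L) {F : (Grid N → Letter) → Grid N → Letter}
  {S : Grid N → Finset (Grid N)}

theorem out_update (hF : ∀ o, DependsOn (F · o) (S o : Set (Grid N))) (p : Fin r → P.Pos)
    (x : Fin r → ghzQueries) {m : Fin r} {y : ghzQueries} {o : Grid N}
    (h : ∀ j, P.endpoint m (p m) j ∈ S o → (x m).1 j = y.1 j) :
    P.out F p (Function.update x m y) o = P.out F p x o := by
  refine hF o fun v hv => P.encode_instEquiv_congr p fun i j hij => ?_
  by_cases hi : i = m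
  · subst hi
    rw [Function.update_self, h j (hij ▸ hv)]
  · rw [Function.update_of_ne hi]

theorem winsCopy_update_of_lt (hF : ∀ o, DependsOn (F · o) (S o : Set (Grid N)))
    {p : Fin r → P.Pos} {m k : Fin r} (hm : P.Isolated S p m) (hk : k < m)
    (x : Fin r → ghzQueries) (y : ghzQueries) :
    P.WinsCopy F p (Function.update x m y) k ↔ P.WinsCopy F p x k := by
  have reply_eq (j : Fin 3) :
      reply (P.out F p (Function.update x m y)) (P.pathAt k (p k) j) ((x k).1 j) =
        reply (P.out F p x) (P.pathAt k (p k) j) ((x k).1 j) :=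
    reply_congr _ fun v hv => P.out_update hF p x fun l hl => absurd
      (mem_cone.2 ⟨v, hv, hl⟩) (hm l k j hk.le (by simp [hk.ne]))
  unfold WinsCopy
  simp only [Function.update_of_ne hk.ne, reply_eq]

theorem exists_not_winsCopy_update (hF : ∀ o, DependsOn (F · o) (S o : Set (Grid N)))
    {p : Fin r → P.Pos} {k : Fin r} (hk : P.Isolated S p k) (x : Fin r → ghzQueries) :
    ∃ y, ¬ P.WinsCopy F p (Function.update x k y) k := by
  obtain ⟨y, hy⟩ := exists_sum_ne_ghzTarget_of_factorsThrough
    (g := fun y j => reply (P.out F p (Function.update x k y)) (P.pathAt k (p k) j) (y.1 j))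
    fun j y y' (hj : y.1 j = y'.1 j) => by
      simp only [hj]
      refine reply_congr _ fun v hv => ?_
      have := P.out_update hF p (Function.update x k y') (m := k) (y := y) (o := v) fun l hl => by
        by_cases hlj : l = j
        · subst hlj; simp [hj]
        · exact absurd (mem_cone.2 ⟨v, hv, hl⟩)
            (hk l k j le_rfl (by simpa using fun h => hlj h.symm))
      rwa [Function.update_idem] at this
  exact ⟨y, by simpa only [WinsCopy, Function.update_self] using hy⟩

open scoped Classical in
theorem expect_winsCopy_update_le (hF : ∀ o, DependsOn (F · o) (S o : Set (Grid N)))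
    {p : Fin r → P.Pos} {k : Fin r} (hk : P.Isolated S p k) (x : Fin r → ghzQueries) :
    𝔼 y, (if P.WinsCopy F p (Function.update x k y) k then (1 : ℝ) else 0) ≤ 3 / 4 := by
  obtain ⟨y₀, hy₀⟩ := P.exists_not_winsCopy_update hF hk x
  have card_le : #{y | P.WinsCopy F p (Function.update x k y) k} ≤ 3 := by
    have := Finset.card_lt_univ_of_notMem (s := {y | P.WinsCopy F p (Function.update x k y) k})
      (x := y₀) (by simpa using hy₀)
    rw [card_ghzQueries] at this
    omega
  rw [Fintype.expect_eq_sum_div_card, Finset.sum_boole, card_ghzQueries]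
  have : (#{y | P.WinsCopy F p (Function.update x k y) k} : ℝ) ≤ 3 := by exact_mod_cast card_le
  push_cast
  linarith

open scoped Classical in
/-- The query of an isolated copy does not influence the previous copies, and each player of this
copy only sees its own question, so that the copy is lost with probability at least `1 / 4` given
the outcomes of the previous ones. -/
theorem expect_forall_winsCopy_le (hF : ∀ o, DependsOn (F · o) (S o : Set (Grid N)))
    (p : Fin r → P.Pos) :
    𝔼 x, (if ∀ k, P.WinsCopy F p x k then (1 : ℝ) else 0) ≤
      ∏ k, if P.Isolated S p k then (3 / 4 : ℝ) else 1 := by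
  have hne : Nonempty ghzQueries := ⟨⟨![0, 0, 0], by decide⟩⟩
  calc 𝔼 x, (if ∀ k, P.WinsCopy F p x k then (1 : ℝ) else 0)
      ≤ 𝔼 x, ∏ k with P.Isolated S p k, if P.WinsCopy F p x k then (1 : ℝ) else 0 := by
        refine Finset.expect_le_expect fun x _ => ?_
        split_ifs with h
        · simp [h]
        · exact Finset.prod_nonneg fun k _ => by positivity
    _ ≤ (3 / 4) ^ #{k | P.Isolated S p k} :=
        expect_prod_le_pow_card (fun k x => by positivity) _
          (fun k _ m hm hkm x y => by
            simp only [P.winsCopy_update_of_lt hF (Finset.mem_filter.1 hm).2 hkm x y])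
          fun k hk => P.expect_winsCopy_update_le hF (Finset.mem_filter.1 hk).2
    _ = ∏ k, if P.Isolated S p k then (3 / 4 : ℝ) else 1 := by
        rw [Finset.prod_ite, Finset.prod_const_one, mul_one, Finset.prod_const]

end Local

section Positions

variable (P : Planting κ N r L) {S : Grid N → Finset (Grid N)} {B Λ : ℕ}

theorem expect_eq_expect_boxes_star_locations (f : P.Pos → ℝ) :
    𝔼 y, f y = 𝔼 b, 𝔼 s, 𝔼 o, f (b, o, s) := by
  rw [← Finset.univ_product_univ, Finset.expect_product]
  refine Finset.expect_congr rfl fun b _ => ?_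
  rw [← Finset.univ_product_univ, Finset.expect_product, Finset.expect_comm]

open scoped Classical in
theorem expect_endpoint_mem_le (k : Fin r) (b : Fin 4 ↪ Fin P.T) (s : Fin (L / 3)) (j : Fin 3)
    {X : (Fin 3 → Fin (2 * L + 1) × Fin (2 * L + 1)) → Finset (Grid N)} {D : ℕ}
    (hX : ∀ o, #(X o) ≤ D) (hXj : ∀ o e, X (Function.update o j e) = X o) :
    𝔼 o, (if P.endpoint k (b, o, s) j ∈ X o then (1 : ℝ) else 0) ≤ D / (2 * L + 1) ^ 2 := by
  rw [← expect_expect_update j]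
  refine Finset.expect_le Finset.univ_nonempty fun o _ => ?_
  rw [Fintype.expect_eq_sum_div_card, Finset.sum_boole]
  have card_eq : (Fintype.card (Fin (2 * L + 1) × Fin (2 * L + 1)) : ℝ) = (2 * L + 1) ^ 2 := by
    simp [sq]
  rw [card_eq]
  gcongr
  refine le_trans ?_ (hX o)
  refine Finset.card_le_card_of_injOn (fun e => P.endpoint k (b, Function.update o j e, s) j)
    (fun e he => ?_) fun e _ e' _ hee => ?_
  · simpa only [hXj, Finset.mem_coe] using (Finset.mem_filter.1 he).2
  · have h1 := P.endpoint_val k (b, Function.update o j e, s) j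
    have h2 := P.endpoint_val k (b, Function.update o j e', s) j
    simp only [Function.update_self] at hee h1 h2
    rw [hee] at h1
    exact Prod.ext (Fin.ext (by omega)) (Fin.ext (by omega))

open scoped Classical in
theorem expect_endpoint_mem_cone_le (hS : ∀ o, #(S o) ≤ B)
    (hΛ : ∀ i y j, (P.pathAt i y j).length ≤ Λ) (p : Fin r → P.Pos) {k i : Fin r} {j j' : Fin 3}
    (hne : (i, j') ≠ (k, j)) :
    𝔼 y, (if P.endpoint k y j ∈ P.cone S i (Function.update p k y i) j' then (1 : ℝ) else 0) ≤
      (Λ * B : ℕ) / (2 * L + 1) ^ 2 := by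
  obtain ⟨b₀, -, s₀⟩ := P.pos_nonempty
  rw [expect_eq_expect_boxes_star_locations]
  refine Finset.expect_le ⟨b₀, Finset.mem_univ _⟩ fun b _ =>
    Finset.expect_le ⟨s₀, Finset.mem_univ _⟩ fun s _ => ?_
  refine P.expect_endpoint_mem_le k b s j
    (X := fun o => P.cone S i (Function.update p k (b, o, s) i) j')
    (fun o => P.card_cone_le hS hΛ _ _ _) fun o e => ?_
  rcases eq_or_ne i k with rfl | hi
  · have hj : j' ≠ j := fun h => hne (by rw [h])
    simp only [Function.update_self, cone, pathAt, Function.update_of_ne hj]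
  · simp only [Function.update_of_ne hi]

theorem exists_endpoint_mem_cone_of_not_isolated {p : Fin r → P.Pos} {k : Fin r} {y : P.Pos}
    (h : ¬ P.Isolated S (Function.update p k y) k) :
    ∃ z : {z : Fin 3 × Fin r × Fin 3 // z.2 ≠ (k, z.1)},
      P.endpoint k y z.1.1 ∈ P.cone S z.1.2.1 (Function.update p k y z.1.2.1) z.1.2.2 := by
  unfold Isolated at h
  push Not at h
  obtain ⟨j, i, j', _, hne, hmem⟩ := h
  rw [Function.update_self] at hmem
  exact ⟨⟨(j, i, j'), hne⟩, hmem⟩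

open scoped Classical in
/-- A union bound over the input locations of the `k`-th copy and the paths of all copies; the
input location is uniform in its box, independently of the inputs that the other paths see. -/
theorem expect_not_isolated_update_le (hS : ∀ o, #(S o) ≤ B)
    (hΛ : ∀ i y j, (P.pathAt i y j).length ≤ Λ)
    (hB : 18 * (r * (Λ * B)) ≤ (2 * L + 1) ^ 2) (p : Fin r → P.Pos) (k : Fin r) :
    𝔼 y, (if P.Isolated S (Function.update p k y) k then (0 : ℝ) else 1) ≤ 1 / 2 := by
  let Pair := {z : Fin 3 × Fin r × Fin 3 // z.2 ≠ (k, z.1)}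
  have card_pair_le : (Fintype.card Pair : ℝ) ≤ 9 * r := by
    refine (Nat.cast_le.2 (Fintype.card_subtype_le _)).trans_eq ?_
    simp only [Fintype.card_prod, Fintype.card_fin]
    push_cast; ring
  calc 𝔼 y, (if P.Isolated S (Function.update p k y) k then (0 : ℝ) else 1)
      ≤ 𝔼 y, if ∃ z : Pair, P.endpoint k y z.1.1 ∈
          P.cone S z.1.2.1 (Function.update p k y z.1.2.1) z.1.2.2 then (1 : ℝ) else 0 := by
        refine Finset.expect_le_expect fun y _ => ?_
        by_cases h : P.Isolated S (Function.update p k y) k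
        · rw [if_pos h]; positivity
        · rw [if_neg h, if_pos (P.exists_endpoint_mem_cone_of_not_isolated h)]
    _ ≤ ∑ z : Pair, 𝔼 y, if P.endpoint k y z.1.1 ∈
          P.cone S z.1.2.1 (Function.update p k y z.1.2.1) z.1.2.2 then (1 : ℝ) else 0 :=
        expect_boole_exists_le_sum fun (z : Pair) y => P.endpoint k y z.1.1 ∈
          P.cone S z.1.2.1 (Function.update p k y z.1.2.1) z.1.2.2
    _ ≤ ∑ _z : Pair, ((Λ * B : ℕ) : ℝ) / (2 * L + 1) ^ 2 :=
        Finset.sum_le_sum fun z _ => P.expect_endpoint_mem_cone_le hS hΛ p z.2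
    _ = Fintype.card Pair * (((Λ * B : ℕ) : ℝ) / (2 * L + 1) ^ 2) := by
        rw [Finset.sum_const, Finset.card_univ, nsmul_eq_mul]
    _ ≤ 9 * r * (((Λ * B : ℕ) : ℝ) / (2 * L + 1) ^ 2) := by gcongr
    _ ≤ 1 / 2 := by
        have : ((18 * (r * (Λ * B)) : ℕ) : ℝ) ≤ (((2 * L + 1) ^ 2 : ℕ) : ℝ) := by exact_mod_cast hB
        push_cast at this ⊢
        rw [← mul_div_assoc, div_le_div_iff₀ (by positivity) (by norm_num)]
        linarith

open scoped Classical in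
theorem expect_prod_isolated_le (hS : ∀ o, #(S o) ≤ B)
    (hΛ : ∀ i y j, (P.pathAt i y j).length ≤ Λ)
    (hB : 18 * (r * (Λ * B)) ≤ (2 * L + 1) ^ 2) :
    𝔼 p : Fin r → P.Pos, ∏ k, (if P.Isolated S p k then (3 / 4 : ℝ) else 1) ≤ (7 / 8) ^ r := by
  have := P.pos_nonempty
  have h := expect_prod_le_pow_card (τ := 7 / 8)
    (w := fun k (p : Fin r → P.Pos) => if P.Isolated S p k then (3 / 4 : ℝ) else 1)
    (fun k p => by positivity) Finset.univ
    (fun k _ m _ hkm p y => by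
      simp only [P.isolated_congr S (p := Function.update p m y) (p' := p) (k := k)
        fun _ hi => Function.update_of_ne (hi.trans_lt hkm).ne _ _])
    fun k _ p =>
      calc 𝔼 y, (if P.Isolated S (Function.update p k y) k then (3 / 4 : ℝ) else 1)
          = 𝔼 y, (3 / 4 + 1 / 4 *
              (if P.Isolated S (Function.update p k y) k then (0 : ℝ) else 1)) :=
            Finset.expect_congr rfl fun y _ => by split_ifs <;> norm_num
        _ = 3 / 4 + 1 / 4 *
              𝔼 y, (if P.Isolated S (Function.update p k y) k then (0 : ℝ) else 1) := by
            rw [Finset.expect_add_distrib, Fintype.expect_const, ← Finset.mul_expect]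
        _ ≤ 7 / 8 := by linarith [P.expect_not_isolated_update_le hS hΛ hB p k]
  simpa using h

open scoped Classical in
theorem expect_wins_le {F : (Grid N → Letter) → Grid N → Letter}
    (hF : ∀ o, DependsOn (F · o) (S o : Set (Grid N)))
    (hS : ∀ o, #(S o) ≤ B) (hΛ : ∀ i y j, (P.pathAt i y j).length ≤ Λ)
    (hB : 18 * (r * (Λ * B)) ≤ (2 * L + 1) ^ 2) :
    𝔼 c, (if P.Wins c (F (P.encode c)) then (1 : ℝ) else 0) ≤ (7 / 8) ^ r :=
  calc 𝔼 c, (if P.Wins c (F (P.encode c)) then (1 : ℝ) else 0)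
      = 𝔼 z, if ∀ k, P.WinsCopy F z.1 z.2 k then (1 : ℝ) else 0 :=
        (Fintype.expect_equiv P.instEquiv _ _ fun z => by
          simp only [← P.wins_instEquiv_iff F]).symm
    _ = 𝔼 p, 𝔼 x, if ∀ k, P.WinsCopy F p x k then (1 : ℝ) else 0 := by
        rw [← Finset.univ_product_univ, Finset.expect_product]
    _ ≤ 𝔼 p, ∏ k, if P.Isolated S p k then (3 / 4 : ℝ) else 1 :=
        Finset.expect_le_expect fun p _ => P.expect_forall_winsCopy_le hF p
    _ ≤ (7 / 8) ^ r := P.expect_prod_isolated_le hS hΛ hB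

end Positions

theorem game_dist_toReal [DecidableEq (Grid N → Letter)] (P : Planting κ N r L)
    (x : Grid N → Letter) :
    (P.game.dist x).toReal = 𝔼 c, if x = P.encode c then (1 : ℝ) else 0 := by
  have := P.instance_nonempty
  simp only [game, PMF.map_apply, PMF.uniformOfFintype_apply, tsum_fintype]
  rw [Fintype.expect_eq_sum_div_card, Finset.sum_div, ENNReal.toReal_sum fun c _ => by
    split_ifs
    · exact ENNReal.inv_ne_top.2 (Nat.cast_ne_zero.2 Fintype.card_ne_zero)
    · exact ENNReal.zero_ne_top]
  refine Finset.sum_congr rfl fun c _ => ?_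
  split_ifs
  · rw [ENNReal.toReal_inv, ENNReal.toReal_natCast, one_div]
  · simp

theorem sum_game_dist_mul (P : Planting κ N r L) (f : (Grid N → Letter) → ℝ) :
    ∑ x, (P.game.dist x).toReal * f x = 𝔼 c, f (P.encode c) := by
  classical
  simp only [P.game_dist_toReal, Finset.expect_mul]
  rw [← Finset.expect_sum_comm]
  simp only [ite_mul, one_mul, zero_mul, Finset.sum_ite_eq', Finset.mem_univ, if_true]

open scoped Classical in
theorem winProb_eq_expect (P : Planting κ N r L) (beh : (Grid N → Letter) → (Grid N → Letter) → ℝ) :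
    P.game.winProb beh =
      𝔼 c, ∑ y, if (P.encode c, y) ∈ P.game.rel then beh (P.encode c) y else 0 := by
  rw [CircuitGame.winProb, P.sum_game_dist_mul]

open scoped Classical in
theorem winProb_classicalBehavior_le_sum (P : Planting κ N r L) {K m : ℕ}
    (ρ : PMF (Fin m → Letter)) (D : ClassicalCircuit Letter (Grid N ⊕ Fin m) (Grid N) K) :
    P.game.winProb (classicalBehavior ρ D) ≤ ∑ s, (ρ s).toReal *
      𝔼 c, if P.Wins c (D.eval (Sum.elim (P.encode c) s)) then (1 : ℝ) else 0 := by
  simp only [P.winProb_eq_expect, Finset.mul_expect]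
  rw [← Finset.expect_sum_comm]
  refine Finset.expect_le_expect fun c _ => ?_
  calc (∑ y, if (P.encode c, y) ∈ P.game.rel then classicalBehavior ρ D (P.encode c) y else 0)
      ≤ ∑ y, ∑ s, if D.eval (Sum.elim (P.encode c) s) = y then (ρ s).toReal *
          (if P.Wins c (D.eval (Sum.elim (P.encode c) s)) then (1 : ℝ) else 0) else 0 := by
        refine Finset.sum_le_sum fun y _ => ?_
        split_ifs with hy
        · refine Finset.sum_le_sum fun s _ => ?_
          split_ifs with hs hwin
          · simp
          · exact absurd (hy.2 c rfl) (hs ▸ hwin)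
          · rfl
        · exact Finset.sum_nonneg fun s _ => by positivity
    _ = ∑ s, (ρ s).toReal *
          (if P.Wins c (D.eval (Sum.elim (P.encode c) s)) then (1 : ℝ) else 0) := by
        rw [Finset.sum_comm]
        simp

theorem winProb_classicalBehavior_le (P : Planting κ N r L) {Λ K m : ℕ}
    (ρ : PMF (Fin m → Letter)) (D : ClassicalCircuit Letter (Grid N ⊕ Fin m) (Grid N) K)
    (hΛ : ∀ i y j, (P.pathAt i y j).length ≤ Λ)
    (hB : 18 * (r * (Λ * (K + 1) ^ D.depth)) ≤ (2 * L + 1) ^ 2) :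
    P.game.winProb (classicalBehavior ρ D) ≤ (7 / 8) ^ r := by
  classical
  have sum_ρ : ∑ s, (ρ s).toReal = 1 := by
    rw [← ENNReal.toReal_sum fun s _ => ρ.apply_ne_top s, ← tsum_fintype (L := .unconditional _),
      ρ.tsum_coe, ENNReal.toReal_one]
  have expect_le (s : Fin m → Letter) :
      𝔼 c, (if P.Wins c (D.eval (Sum.elim (P.encode c) s)) then (1 : ℝ) else 0) ≤ (7 / 8) ^ r := by
    obtain ⟨S, hS, hF⟩ := D.exists_dependsOn_eval_elim s
    exact P.expect_wins_le (F := fun x => D.eval (Sum.elim x s)) hF hS hΛ hB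
  calc P.game.winProb (classicalBehavior ρ D)
      ≤ ∑ s, (ρ s).toReal *
          𝔼 c, if P.Wins c (D.eval (Sum.elim (P.encode c) s)) then (1 : ℝ) else 0 :=
        P.winProb_classicalBehavior_le_sum ρ D
    _ ≤ ∑ s, (ρ s).toReal * (7 / 8) ^ r := by gcongr with s; exact expect_le s
    _ = (7 / 8) ^ r := by rw [← Finset.sum_mul, sum_ρ, one_mul]

end Planting

/-! ### Unitarity of quantum circuits -/

theorem sum_norm_sq_mulVec {m n 𝕜 : Type*} [Fintype m] [Fintype n] [DecidableEq n] [RCLike 𝕜]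
    {A : Matrix m n 𝕜} (hA : A.conjTranspose * A = 1) (φ : n → 𝕜) :
    ∑ s, ‖A.mulVec φ s‖ ^ 2 = ∑ s, ‖φ s‖ ^ 2 := by
  have hdot : star (A.mulVec φ) ⬝ᵥ A.mulVec φ = star φ ⬝ᵥ φ := by
    rw [Matrix.star_mulVec, ← Matrix.dotProduct_mulVec, Matrix.mulVec_mulVec, hA,
      Matrix.one_mulVec]
  simp only [dotProduct, Pi.star_apply, RCLike.star_def, RCLike.conj_mul] at hdot
  exact_mod_cast hdot

namespace QGate

variable {W : Type} [DecidableEq W]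

theorem apply_piEquivPiSubtypeProd_symm (g : QGate W) (ψ : (W → Bool) → ℂ)
    (s : g.support → Bool) (u : {k // k ∉ g.support} → Bool) :
    g.apply ψ ((Equiv.piEquivPiSubtypeProd (· ∈ g.support) fun _ => Bool).symm (s, u)) =
      g.mat.mulVec (fun t =>
        ψ ((Equiv.piEquivPiSubtypeProd (· ∈ g.support) fun _ => Bool).symm (t, u))) s := by
  refine Finset.sum_congr rfl fun t _ => ?_
  congr 2
  · funext k
    simp [Equiv.piEquivPiSubtypeProd]
  · funext k
    simp only [Equiv.piEquivPiSubtypeProd, Equiv.coe_fn_symm_mk]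
    split_ifs <;> rfl

theorem sum_norm_sq_apply [Fintype W] (g : QGate W) (ψ : (W → Bool) → ℂ) :
    ∑ z, ‖g.apply ψ z‖ ^ 2 = ∑ z, ‖ψ z‖ ^ 2 := by
  let e := Equiv.piEquivPiSubtypeProd (· ∈ g.support) fun _ : W => Bool
  rw [← e.symm.sum_comp, ← e.symm.sum_comp, Fintype.sum_prod_type_right,
    Fintype.sum_prod_type_right]
  refine Finset.sum_congr rfl fun u _ => ?_
  simp only [e, apply_piEquivPiSubtypeProd_symm]
  exact sum_norm_sq_mulVec g.isUnitary _

end QGate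

theorem QLayer.sum_norm_sq_apply {W : Type} [DecidableEq W] [Fintype W] (l : QLayer W)
    (ψ : (W → Bool) → ℂ) : ∑ z, ‖l.apply ψ z‖ ^ 2 = ∑ z, ‖ψ z‖ ^ 2 := by
  unfold QLayer.apply
  induction l.gates with
  | nil => rfl
  | cons g gs ih => rw [List.foldr_cons, QGate.sum_norm_sq_apply, ih]

namespace QCircuit

variable {N a : ℕ}

theorem sum_norm_sq_foldl_apply (Q : QCircuit N a) (ψ : (QWire N a → Bool) → ℂ) :
    ∑ z, ‖List.foldl (fun ψ l => QLayer.apply l ψ) ψ Q z‖ ^ 2 = ∑ z, ‖ψ z‖ ^ 2 := by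
  induction Q generalizing ψ with
  | nil => rfl
  | cons l Q ih => exact (ih _).trans (l.sum_norm_sq_apply ψ)

theorem sum_norm_sq_finalState (Q : QCircuit N a) (x : Grid N → Letter) :
    ∑ z, ‖Q.finalState x z‖ ^ 2 = 1 := by
  rw [finalState, sum_norm_sq_foldl_apply]
  simp [init, apply_ite]

open scoped Classical in
theorem sum_behavior_eq_one (Q : QCircuit N a) (x : Grid N → Letter)
    (Y : Set (Grid N → Letter))
    (hY : ∀ z, Q.finalState x z ≠ 0 → (fun v k => z (v, Sum.inl k)) ∈ Y) :
    (∑ y, if y ∈ Y then Q.behavior x y else 0) = 1 := by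
  let out (z : QWire N a → Bool) : Grid N → Letter := fun v k => z (v, Sum.inl k)
  calc (∑ y, if y ∈ Y then Q.behavior x y else 0)
      = ∑ y, ∑ z, (if out z = y then (if y ∈ Y then ‖Q.finalState x z‖ ^ 2 else 0) else 0) := by
        refine Finset.sum_congr rfl fun y _ => ?_
        unfold behavior
        split_ifs <;> simp [out]
    _ = ∑ z, (if out z ∈ Y then ‖Q.finalState x z‖ ^ 2 else 0) := by
        rw [Finset.sum_comm]
        exact Finset.sum_congr rfl fun z _ => by rw [Finset.sum_ite_eq, if_pos (Finset.mem_univ _)]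
    _ = ∑ z, ‖Q.finalState x z‖ ^ 2 := by
        refine Finset.sum_congr rfl fun z _ => ite_eq_left_iff.2 fun hz => ?_
        rw [not_not.1 (mt (hY z) hz)]
        simp
    _ = 1 := Q.sum_norm_sq_finalState x

end QCircuit

theorem Planting.winProb_eq_one {κ N r L a : ℕ} (P : Planting κ N r L) (Q : QCircuit N a)
    (h : ∀ c z, Q.finalState (P.encode c) z ≠ 0 → P.Wins c fun v k => z (v, Sum.inl k)) :
    P.game.winProb Q.behavior = 1 := by
  classical
  have := P.instance_nonempty
  have hsum (c : P.Instance) :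
      (∑ y, if (P.encode c, y) ∈ P.game.rel then Q.behavior (P.encode c) y else 0) = 1 :=
    Q.sum_behavior_eq_one (P.encode c) {y | (P.encode c, y) ∈ P.game.rel} fun z hz =>
      ⟨⟨c, rfl⟩, fun c' hc' => h c' z (by rwa [hc'])⟩
  rw [P.winProb_eq_expect, ← Fintype.expect_const (ι := P.Instance) (1 : ℝ)]
  refine Finset.expect_congr rfl fun c _ => ?_
  convert hsum c

/-! ### Embedded gates and gates with one Hadamard factor -/

namespace QGate

variable {W ι : Type} [DecidableEq W] [Fintype ι] [DecidableEq ι]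

/-- The wires of an embedded register. -/
noncomputable def registerEquiv (f : ι ↪ W) : ι ≃ {w // w ∈ Finset.univ.map f} :=
  Equiv.ofBijective (fun i => ⟨f i, by simp⟩)
    ⟨fun i j h => f.injective (Subtype.ext_iff.1 h), fun w => by
      obtain ⟨i, -, hi⟩ := Finset.mem_map.1 w.2
      exact ⟨i, Subtype.ext hi⟩⟩

/-- The gate that acts by a given unitary on an embedded register. -/
noncomputable def ofEmbedding (f : ι ↪ W) (m : Matrix (ι → Bool) (ι → Bool) ℂ)
    (hm : m.conjTranspose * m = 1) : QGate W where
  support := Finset.univ.map f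
  mat := m.submatrix ((registerEquiv f).arrowCongr (Equiv.refl Bool)).symm
    ((registerEquiv f).arrowCongr (Equiv.refl Bool)).symm
  isUnitary := by
    rw [Matrix.conjTranspose_submatrix, Matrix.submatrix_mul_equiv, hm,
      Matrix.submatrix_one_equiv]

theorem apply_ofEmbedding (f : ι ↪ W) (m : Matrix (ι → Bool) (ι → Bool) ℂ)
    (hm : m.conjTranspose * m = 1) (ψ : (W → Bool) → ℂ) (z : W → Bool) :
    (ofEmbedding f m hm).apply ψ z =
      ∑ t : ι → Bool, m (z ∘ f) t * ψ (Function.extend f t z) := by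
  refine Fintype.sum_equiv ((registerEquiv f).arrowCongr (Equiv.refl Bool)).symm _ _ fun t => ?_
  congr 2
  funext k
  split_ifs with h
  · obtain ⟨i, -, rfl⟩ := Finset.mem_map.1 h
    rw [f.injective.extend_apply]
    rfl
  · rw [Function.extend_apply']
    rintro ⟨i, rfl⟩
    exact h (by simp [ofEmbedding])

end QGate

/-- The sign `(-1)^b` of a bit `b`, which carries all phases of the Hadamard and Pauli gates. -/
def bsgn (b : Bool) : ℂ := if b then -1 else 1

@[simp] theorem bsgn_false : bsgn false = 1 := rfl

@[simp] theorem bsgn_true : bsgn true = -1 := rfl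

theorem bsgn_mul_self (b : Bool) : bsgn b * bsgn b = 1 := by cases b <;> simp

section Hadamard

variable {ι : Type} [DecidableEq ι] [Fintype ι]

/-- The Hadamard gate on the wire `w`, as a matrix on the whole register. -/
noncomputable def hadamard (w : ι) : Matrix (ι → Bool) (ι → Bool) ℂ := fun z t =>
  if ∀ k ≠ w, z k = t k then (Real.sqrt 2 : ℂ)⁻¹ * bsgn (z w && t w) else 0

theorem star_hadamard (w : ι) (z t : ι → Bool) : star (hadamard w z t) = hadamard w z t := by
  unfold hadamard
  split_ifs
  · cases z w <;> cases t w <;> simp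
  · simp

theorem hadamard_update (w : ι) {t t' : ι → Bool} (h : ∀ k ≠ w, t k = t' k) (b : Bool) :
    hadamard w (Function.update t w b) t' = (Real.sqrt 2 : ℂ)⁻¹ * bsgn (b && t' w) := by
  rw [hadamard, if_pos fun k hk => by rw [Function.update_of_ne hk, h k hk],
    Function.update_self]

theorem hadamard_eq_zero_of_notMem_range (w : ι) {z t : ι → Bool}
    (hz : z ∉ Set.range (Function.update t w)) : hadamard w z t = 0 := by
  refine if_neg fun h => hz ⟨z w, ?_⟩
  rw [Function.update_eq_iff]
  exact ⟨rfl, fun k hk => (h k hk).symm⟩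

theorem sum_hadamard_mul_hadamard (w : ι) {t t' : ι → Bool} (h : ∀ k ≠ w, t k = t' k) :
    ∑ z, hadamard w z t * hadamard w z t' = if t w = t' w then 1 else 0 := by
  have hsqrt : (Real.sqrt 2 : ℂ)⁻¹ * (Real.sqrt 2 : ℂ)⁻¹ = 1 / 2 := by
    rw [← mul_inv, ← Complex.ofReal_mul, Real.mul_self_sqrt (by norm_num)]
    norm_num
  rw [← Fintype.sum_of_injective (Function.update t w) (Function.update_injective t w)
    (fun b => hadamard w (Function.update t w b) t * hadamard w (Function.update t w b) t') _
    (fun z hz => by rw [hadamard_eq_zero_of_notMem_range w hz, zero_mul]) fun _ => rfl]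
  simp only [hadamard_update w fun _ _ => rfl, hadamard_update w h, Fintype.sum_bool]
  cases t w <;> cases t' w <;> simp <;> linear_combination 2 * hsqrt

theorem conjTranspose_hadamard_mul_self (w : ι) :
    (hadamard w).conjTranspose * hadamard w = 1 := by
  ext t t'
  simp only [Matrix.mul_apply, Matrix.conjTranspose_apply, star_hadamard, Matrix.one_apply]
  by_cases h : ∀ k ≠ w, t k = t' k
  · have heq : t = t' ↔ t w = t' w := ⟨fun e => by rw [e], fun e => funext fun k => by
      by_cases hk : k = w
      · rw [hk, e]
      · exact h k hk⟩
    simp only [sum_hadamard_mul_hadamard w h, heq]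
  · rw [if_neg fun e => h fun k _ => by rw [e]]
    refine Finset.sum_eq_zero fun z _ => ?_
    unfold hadamard
    split_ifs with h1 h2
    · exact absurd (fun k hk => (h1 k hk).symm.trans (h2 k hk)) h
    all_goals simp

/-- A Hadamard gate between two monomial gates: first the phases `ph` and the relabelling `e` of
the basis states, then the Hadamard gate, then the inverse of the relabelling `f`. -/
noncomputable def oneHadamard (w : ι) (ph : (ι → Bool) → ℂ) (f e : (ι → Bool) ≃ (ι → Bool)) :
    Matrix (ι → Bool) (ι → Bool) ℂ :=
  (hadamard w).submatrix f e * Matrix.diagonal ph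

theorem oneHadamard_apply (w : ι) (ph : (ι → Bool) → ℂ) (f e : (ι → Bool) ≃ (ι → Bool))
    (z t : ι → Bool) : oneHadamard w ph f e z t = ph t * hadamard w (f z) (e t) := by
  rw [oneHadamard, Matrix.mul_diagonal, Matrix.submatrix_apply, mul_comm]

theorem oneHadamard_isUnitary (w : ι) {ph : (ι → Bool) → ℂ} (hph : ∀ t, star (ph t) * ph t = 1)
    (f e : (ι → Bool) ≃ (ι → Bool)) :
    (oneHadamard w ph f e).conjTranspose * oneHadamard w ph f e = 1 := by
  rw [oneHadamard, Matrix.conjTranspose_mul, Matrix.mul_assoc,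
    ← Matrix.mul_assoc (((hadamard w).submatrix f e).conjTranspose),
    Matrix.conjTranspose_submatrix, Matrix.submatrix_mul_equiv, conjTranspose_hadamard_mul_self,
    Matrix.submatrix_one_equiv, Matrix.one_mul, Matrix.diagonal_conjTranspose,
    Matrix.diagonal_mul_diagonal]
  exact (congrArg Matrix.diagonal (funext hph)).trans Matrix.diagonal_one

end Hadamard

/-! ### Preparation of GHZ states -/

section Fanout

variable {ι : Type} [DecidableEq ι]

/-- Controlled NOT gates from the wire `w` to all others, as a permutation of the basis states. -/
def fanout (w : ι) : (ι → Bool) ≃ (ι → Bool) :=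
  Function.Involutive.toPerm (fun z k => if k = w then z w else xor (z k) (z w)) fun z => by
    funext k
    by_cases hk : k = w <;> simp [hk]

theorem fanout_apply (w : ι) (z : ι → Bool) (k : ι) :
    fanout w z k = if k = w then z w else xor (z k) (z w) := rfl

theorem fanout_eq_false_iff (w : ι) (z : ι → Bool) :
    (∀ k ≠ w, fanout w z k = false) ↔ ∀ i j, z i = z j := by
  have hfan (k) (hk : k ≠ w) : fanout w z k = false ↔ z k = z w := by simp [fanout_apply, hk]
  refine ⟨fun h => ?_, fun h k hk => (hfan k hk).2 (h k w)⟩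
  have hw (k) : z k = z w := by
    by_cases hk : k = w
    · rw [hk]
    · exact (hfan k hk).1 (h k hk)
  exact fun i j => (hw i).trans (hw j).symm

variable [Fintype ι]

/-- The unitary that prepares a GHZ state from the all-zero state: a Hadamard gate on the wire `w`
followed by controlled NOT gates from it. -/
noncomputable def ghzPrep (w : ι) : Matrix (ι → Bool) (ι → Bool) ℂ :=
  oneHadamard w (fun _ => 1) (fanout w) (Equiv.refl _)

theorem ghzPrep_isUnitary (w : ι) : (ghzPrep w).conjTranspose * ghzPrep w = 1 :=
  oneHadamard_isUnitary w (fun _ => by simp) _ _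

open scoped Classical in
theorem ghzPrep_apply_zero (w : ι) (z : ι → Bool) :
    ghzPrep w z (fun _ => false) =
      if ∀ i j, z i = z j then (Real.sqrt 2 : ℂ)⁻¹ else 0 := by
  simp only [ghzPrep, oneHadamard_apply, hadamard, Equiv.refl_apply, Bool.and_false, bsgn_false,
    mul_one, one_mul, fanout_eq_false_iff]

end Fanout

section Entangle

variable {W : Type} [DecidableEq W]

open scoped Classical in
/-- The gate prepares a GHZ state on its support from the all-zero state. -/
def QGate.PreparesGHZ (g : QGate W) : Prop :=
  ∀ z, g.mat z (fun _ => false) = if ∀ a b, z a = z b then (Real.sqrt 2 : ℂ)⁻¹ else 0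

theorem QGate.preparesGHZ_ofEmbedding {ι : Type} [Fintype ι] [DecidableEq ι] (f : ι ↪ W)
    (w : ι) : (QGate.ofEmbedding f (ghzPrep w) (ghzPrep_isUnitary w)).PreparesGHZ := by
  classical
  intro z
  refine (ghzPrep_apply_zero w _).trans ?_
  congr 1
  refine propext ⟨fun h a b => ?_, fun h i j => h _ _⟩
  obtain ⟨i, rfl⟩ := (registerEquiv f).surjective a
  obtain ⟨j, rfl⟩ := (registerEquiv f).surjective b
  exact h i j

/-- The basis state `t` is constant on the support of every gate and agrees with `z₀` elsewhere:
these are the basis states of nonzero amplitude after GHZ states have been prepared from `z₀`. -/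
def ConstantOn (gs : List (QGate W)) (z₀ t : W → Bool) : Prop :=
  (∀ g ∈ gs, ∀ a ∈ g.support, ∀ b ∈ g.support, t a = t b) ∧
    ∀ w, (∀ g ∈ gs, w ∉ g.support) → t w = z₀ w

theorem constantOn_xor {gs : List (QGate W)} {z₀ α : W → Bool}
    (hα : ConstantOn gs (fun _ => false) α) (z : W → Bool) :
    ConstantOn gs z₀ (fun w => xor (z w) (α w)) ↔ ConstantOn gs z₀ z := by
  unfold ConstantOn
  refine and_congr (forall₂_congr fun g hg => forall₂_congr fun a ha => forall₂_congr
    fun b hb => ?_) (forall_congr' fun w => forall_congr' fun hw => ?_)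
  · dsimp only
    rw [hα.1 g hg a ha b hb, Bool.xor_left_inj]
  · dsimp only
    rw [hα.2 w hw, Bool.xor_false]

theorem constantOn_nil_iff (z₀ t : W → Bool) : ConstantOn [] z₀ t ↔ t = z₀ := by
  simp [ConstantOn, funext_iff]

theorem constantOn_cons_iff {g : QGate W} {gs : List (QGate W)}
    (hd : ∀ g' ∈ gs, Disjoint g.support g'.support) {z₀ : W → Bool}
    (hz₀ : ∀ a ∈ g.support, z₀ a = false) (t : W → Bool) :
    ConstantOn (g :: gs) z₀ t ↔ (∀ a b : g.support, t a = t b) ∧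
      ConstantOn gs z₀ fun k => if k ∈ g.support then false else t k := by
  have hin : ∀ g' ∈ gs, ∀ a ∈ g'.support, a ∉ g.support := fun g' hg' a ha =>
    Finset.disjoint_right.1 (hd g' hg') ha
  unfold ConstantOn
  rw [List.forall_mem_cons]
  constructor
  · rintro ⟨⟨hg, hgs⟩, hout⟩
    refine ⟨fun a b => hg a a.2 b b.2, fun g' hg' a ha b hb => ?_, fun w hw => ?_⟩
    · beta_reduce
      rw [if_neg (hin g' hg' a ha), if_neg (hin g' hg' b hb), hgs g' hg' a ha b hb]
    · beta_reduce
      split_ifs with hwg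
      · exact (hz₀ w hwg).symm
      · exact hout w (List.forall_mem_cons.2 ⟨hwg, hw⟩)
  · rintro ⟨hg, hgs, hout⟩
    refine ⟨⟨fun a ha b hb => hg ⟨a, ha⟩ ⟨b, hb⟩, fun g' hg' a ha b hb => ?_⟩, fun w hw => ?_⟩
    · simpa only [if_neg (hin g' hg' a ha), if_neg (hin g' hg' b hb)] using hgs g' hg' a ha b hb
    · rw [List.forall_mem_cons] at hw
      simpa only [if_neg hw.1] using hout w hw.2

theorem QGate.PreparesGHZ.apply_of_forall_ne_zero {g : QGate W} (hg : g.PreparesGHZ)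
    {ψ : (W → Bool) → ℂ} (hψ : ∀ z, ψ z ≠ 0 → ∀ a ∈ g.support, z a = false) (t : W → Bool)
    [Decidable (∀ a b : g.support, t a = t b)] :
    g.apply ψ t = if ∀ a b : g.support, t a = t b then
      (Real.sqrt 2 : ℂ)⁻¹ * ψ (fun k => if k ∈ g.support then false else t k) else 0 := by
  rw [QGate.apply, Finset.sum_eq_single fun _ => false]
  · rw [hg]
    simp only [dite_eq_ite, ite_mul, zero_mul]
  · intro s _ hs
    refine mul_eq_zero_of_right _ (not_not.1 fun hne => hs (funext fun a => ?_))
    simpa using hψ _ hne a a.2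
  · simp

open scoped Classical in
theorem foldr_preparesGHZ (gs : List (QGate W)) (hg : ∀ g ∈ gs, g.PreparesGHZ)
    (hd : gs.Pairwise fun g h => Disjoint g.support h.support) (z₀ : W → Bool)
    (hz₀ : ∀ g ∈ gs, ∀ a ∈ g.support, z₀ a = false) (t : W → Bool) :
    gs.foldr QGate.apply (fun z => if z = z₀ then 1 else 0) t =
      if ConstantOn gs z₀ t then (Real.sqrt 2 : ℂ)⁻¹ ^ gs.length else 0 := by
  induction gs generalizing t with
  | nil => simp [constantOn_nil_iff]
  | cons g gs ih =>
    rw [List.pairwise_cons] at hd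
    rw [List.forall_mem_cons] at hg hz₀
    replace ih := ih hg.2 hd.2 hz₀.2
    have hzero (z : W → Bool)
        (hz : gs.foldr QGate.apply (fun z => if z = z₀ then 1 else 0) z ≠ 0) :
        ∀ a ∈ g.support, z a = false := fun a ha => by
      rw [ih, ite_ne_right_iff] at hz
      rw [hz.1.2 a fun g' hg' => Finset.disjoint_left.1 (hd.1 g' hg') ha, hz₀.1 a ha]
    rw [List.foldr_cons, hg.1.apply_of_forall_ne_zero hzero, ih, constantOn_cons_iff hd.1 hz₀.1,
      List.length_cons, pow_succ']
    split_ifs <;> first | rfl | tauto | rw [mul_zero]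

end Entangle

/-! ### A layer with the same gate at all vertices -/

section VertexLayer

variable {N a : ℕ}

/-- The qubits at a vertex. -/
def vertexWires (v : Grid N) : (Fin 8 ⊕ Fin a) ↪ QWire N a :=
  ⟨fun k => (v, k), fun _ _ h => (Prod.ext_iff.1 h).2⟩

/-- The basis state `z` with the qubits at the vertex `v` reset to `t`. -/
def setVertex (v : Grid N) (t : Fin 8 ⊕ Fin a → Bool) (z : QWire N a → Bool) :
    QWire N a → Bool :=
  fun w => if w.1 = v then t w.2 else z w

theorem extend_vertexWires (v : Grid N) (t : Fin 8 ⊕ Fin a → Bool) (z : QWire N a → Bool) :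
    Function.extend (vertexWires v) t z = setVertex v t z := by
  funext ⟨u, k⟩
  by_cases h : u = v
  · subst h
    exact ((vertexWires u).injective.extend_apply t z k).trans (if_pos rfl).symm
  · rw [setVertex, if_neg h, Function.extend_apply']
    rintro ⟨i, hi⟩
    exact h (Prod.ext_iff.1 hi).1.symm

theorem prod_setVertex {M : Type*} [CommMonoid M] (c : Grid N → (Fin 8 ⊕ Fin a → Bool) → M)
    (v : Grid N) (t : Fin 8 ⊕ Fin a → Bool) (z : QWire N a → Bool) :
    ∏ u, c u (fun k => setVertex v t z (u, k)) =
      c v t * ∏ u ∈ Finset.univ.erase v, c u fun k => z (u, k) := by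
  rw [← Finset.mul_prod_erase _ _ (Finset.mem_univ v)]
  simp only [setVertex, if_true]
  exact congrArg _ (Finset.prod_congr rfl fun u hu => by simp only [Finset.ne_of_mem_erase hu,
    if_false])

variable {m : Matrix (Fin 8 ⊕ Fin a → Bool) (Fin 8 ⊕ Fin a → Bool) ℂ}
  (hm : m.conjTranspose * m = 1)

/-- The gate `m` at the vertex `v`. -/
noncomputable def vertexGate (v : Grid N) : QGate (QWire N a) :=
  QGate.ofEmbedding (vertexWires v) m hm

theorem apply_vertexGate (v : Grid N) (φ : (QWire N a → Bool) → ℂ) (z : QWire N a → Bool) :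
    (vertexGate hm v).apply φ z = ∑ t, m (fun k => z (v, k)) t * φ (setVertex v t z) := by
  simp only [← extend_vertexWires]
  exact QGate.apply_ofEmbedding (vertexWires v) m hm φ z

theorem foldr_vertexGate_ne_zero {x : Grid N → Letter} {ψ : (QWire N a → Bool) → ℂ}
    (hx : ∀ z, ψ z ≠ 0 → ∀ v k, z (v, Sum.inl k) = x v k) (D : List (Grid N))
    {z : QWire N a → Bool} (hz : (D.map (vertexGate hm)).foldr QGate.apply ψ z ≠ 0)
    {u : Grid N} (hu : u ∉ D) (k : Fin 8) : z (u, Sum.inl k) = x u k := by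
  induction D generalizing z with
  | nil => exact hx z hz u k
  | cons v D ih =>
    rw [List.mem_cons, not_or] at hu
    rw [List.map_cons, List.foldr_cons, apply_vertexGate] at hz
    obtain ⟨t, -, ht⟩ := Finset.exists_ne_zero_of_sum_ne_zero hz
    simpa [setVertex, hu.1] using ih (right_ne_zero_of_mul ht) hu.2

/-- The local rule `hloc` pulls the bit flips at `v` through the gate. -/
theorem apply_vertexGate_xor {v : Grid N} {x : Letter} {β : Grid N → Fin 8 ⊕ Fin a → Bool}
    {d : Grid N → (Fin 8 ⊕ Fin a → Bool) → ℂ} {c' : (Fin 8 ⊕ Fin a → Bool) → ℂ}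
    (hloc : ∀ z t, (∀ k, t (Sum.inl k) = x k) →
      m z (fun k => xor (t k) (β v k)) * d v t = c' z * m z t)
    {φ : (QWire N a → Bool) → ℂ} (hx : ∀ z, φ z ≠ 0 → ∀ k, z (v, Sum.inl k) = x k)
    (hφ : ∀ z, φ (fun w => xor (z w) (β w.1 w.2)) = (∏ u, d u fun k => z (u, k)) * φ z)
    (z : QWire N a → Bool) :
    (vertexGate hm v).apply φ (fun w => xor (z w) (if w.1 = v then false else β w.1 w.2)) =
      (∏ u, (if u = v then c' else d u) fun k => z (u, k)) * (vertexGate hm v).apply φ z := by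
  have hinv : Function.Involutive fun (t : Fin 8 ⊕ Fin a → Bool) k => xor (t k) (β v k) :=
    fun t => by funext k; simp
  have hflip (t : Fin 8 ⊕ Fin a → Bool) : setVertex v (fun k => xor (t k) (β v k))
      (fun w => xor (z w) (if w.1 = v then false else β w.1 w.2)) =
      fun w => xor (setVertex v t z w) (β w.1 w.2) := by
    funext w
    by_cases h : w.1 = v <;> simp [setVertex, h]
  have hprod : (∏ u, (if u = v then c' else d u) fun k => z (u, k)) =
      c' (fun k => z (v, k)) * ∏ u ∈ Finset.univ.erase v, d u fun k => z (u, k) := by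
    rw [← Finset.mul_prod_erase _ _ (Finset.mem_univ v), if_pos rfl]
    exact congrArg _ (Finset.prod_congr rfl fun u hu => by rw [if_neg (Finset.ne_of_mem_erase hu)])
  rw [apply_vertexGate, apply_vertexGate, ← Equiv.sum_comp (hinv.toPerm _), Finset.mul_sum]
  refine Finset.sum_congr rfl fun t _ => ?_
  simp only [Function.Involutive.coe_toPerm, hflip, hφ, if_true, Bool.xor_false]
  by_cases h0 : φ (setVertex v t z) = 0
  · simp only [h0, mul_zero]
  · have ht (k : Fin 8) : t (Sum.inl k) = x k := by simpa [setVertex] using hx _ h0 k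
    rw [prod_setVertex, hprod]
    linear_combination (∏ u ∈ Finset.univ.erase v, d u fun k => z (u, k)) *
      φ (setVertex v t z) * hloc (fun k => z (v, k)) t ht

theorem foldr_vertexGate_xor {x : Grid N → Letter} {α : Grid N → Fin 8 ⊕ Fin a → Bool}
    {c c' : Grid N → (Fin 8 ⊕ Fin a → Bool) → ℂ}
    (hloc : ∀ v z t, (∀ k, t (Sum.inl k) = x v k) →
      m z (fun k => xor (t k) (α v k)) * c v t = c' v z * m z t)
    {ψ : (QWire N a → Bool) → ℂ} (hx : ∀ z, ψ z ≠ 0 → ∀ v k, z (v, Sum.inl k) = x v k)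
    (hψ : ∀ z, ψ (fun w => xor (z w) (α w.1 w.2)) = (∏ v, c v fun k => z (v, k)) * ψ z)
    {D : List (Grid N)} (hD : D.Nodup) (z : QWire N a → Bool) :
    (D.map (vertexGate hm)).foldr QGate.apply ψ
        (fun w => xor (z w) (if w.1 ∈ D then false else α w.1 w.2)) =
      (∏ v, (if v ∈ D then c' v else c v) fun k => z (v, k)) *
        (D.map (vertexGate hm)).foldr QGate.apply ψ z := by
  induction D generalizing z with
  | nil => simpa using hψ z
  | cons v D ih =>
    obtain ⟨hv, hD⟩ := List.nodup_cons.1 hD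
    have hmem {M : Type} (u : Grid N) (b b' : M) : (if u ∈ v :: D then b else b') =
        if u = v then b else if u ∈ D then b else b' := by
      simp only [List.mem_cons, ite_or]
    have hc' (u : Grid N) (b : ℂ) (s : Fin 8 ⊕ Fin a → Bool) :
        (if u = v then c' u s else b) = if u = v then c' v s else b := by
      split_ifs with h
      · rw [h]
      · rfl
    have hstep := apply_vertexGate_xor hm (v := v) (x := x v) (c' := c' v)
      (β := fun u => if u ∈ D then fun _ => false else α u)
      (d := fun u => if u ∈ D then c' u else c u)
      (φ := (D.map (vertexGate hm)).foldr QGate.apply ψ)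
      (by simpa only [if_neg hv] using hloc v)
      (fun z hz => foldr_vertexGate_ne_zero hm hx D hz hv)
      (fun z => by simpa only [ite_apply] using ih hD z) z
    simpa only [List.map_cons, List.foldr_cons, hmem, ite_apply, hc'] using hstep

/-- The layer with the gate `m` at every vertex. -/
noncomputable def vertexLayer (N : ℕ) : QLayer (QWire N a) where
  gates := (Finset.univ : Finset (Grid N)).toList.map (vertexGate hm)
  disjoint := by
    rw [List.pairwise_map]
    refine (Finset.nodup_toList _).imp fun {u v} huv => ?_
    rw [Finset.disjoint_left]
    intro w hw hw'
    obtain ⟨i, -, hi⟩ := Finset.mem_map.1 hw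
    obtain ⟨j, -, hj⟩ := Finset.mem_map.1 hw'
    exact huv (Prod.ext_iff.1 (hi.trans hj.symm)).1

/-- After the layer the state is an eigenvector of a diagonal operator with eigenvalue one, so
every outcome of nonzero amplitude satisfies the corresponding parity check. -/
theorem prod_eq_one_of_vertexLayer_apply_ne_zero {x : Grid N → Letter}
    {α : Grid N → Fin 8 ⊕ Fin a → Bool} {c c' : Grid N → (Fin 8 ⊕ Fin a → Bool) → ℂ}
    (hloc : ∀ v z t, (∀ k, t (Sum.inl k) = x v k) →
      m z (fun k => xor (t k) (α v k)) * c v t = c' v z * m z t)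
    {ψ : (QWire N a → Bool) → ℂ} (hx : ∀ z, ψ z ≠ 0 → ∀ v k, z (v, Sum.inl k) = x v k)
    (hψ : ∀ z, ψ (fun w => xor (z w) (α w.1 w.2)) = (∏ v, c v fun k => z (v, k)) * ψ z)
    {z : QWire N a → Bool} (hz : (vertexLayer hm N).apply ψ z ≠ 0) :
    ∏ v, c' v (fun k => z (v, k)) = 1 := by
  have h := foldr_vertexGate_xor hm hloc hx hψ (Finset.nodup_toList Finset.univ) z
  simp only [Finset.mem_toList, Finset.mem_univ, if_true, Bool.xor_false] at h
  exact (mul_right_cancel₀ hz ((one_mul _).trans h)).symm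

end VertexLayer

/-! ### The gate that measures at a vertex -/

/-- The direction with a given two-bit code. -/
def Dir.ofBits : Bool → Bool → Dir
  | false, false => left
  | false, true => right
  | true, false => down
  | true, true => up

theorem Dir.ofBits_bits (d : Dir) : Dir.ofBits d.bits.1 d.bits.2 = d := by cases d <;> rfl

/-- The ancilla that is entangled with the neighbor in a given direction. -/
def Dir.port : Dir → Fin 7
  | left => 0
  | right => 1
  | down => 2
  | up => 3

theorem Dir.port_injective : Function.Injective Dir.port := by
  intro d d' h
  cases d <;> cases d' <;> first | rfl | exact absurd h (by decide)

/-- The ancilla holding the share of a GHZ state, for the path leaving in a given direction. -/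
def Dir.ghzPort : Dir → Fin 7
  | left => 5
  | right => 5
  | down => 4
  | up => 6

theorem Dir.port_val_lt (d : Dir) : d.port.val < 4 := by cases d <;> decide

theorem Dir.le_ghzPort_val (d : Dir) : 4 ≤ d.ghzPort.val := by cases d <;> decide

theorem Dir.ghzPort_ne_port (d d' : Dir) : d.ghzPort ≠ d'.port := fun h => by
  have h1 := d.le_ghzPort_val
  have h2 := d'.port_val_lt
  rw [h] at h1
  omega

namespace VertexGate

/-- The first ancilla that is measured at a vertex with a given input letter. -/
def portA (l : Letter) : Fin 7 :=
  if l 0 && !l 1 then (Dir.ofBits (l 6) (l 7)).ghzPort else (Dir.ofBits (l 4) (l 5)).port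

/-- The second ancilla that is measured at a vertex with a given input letter. -/
def portB (l : Letter) : Fin 7 := (Dir.ofBits (l 6) (l 7)).port

/-- The input letter marks an input location. -/
def isTerm (l : Letter) : Bool := l 0 && l 1

/-- A permutation that moves the measured ancillas to the front. -/
def toFront (l : Letter) : Equiv.Perm (Fin 7) :=
  if isTerm l then Equiv.swap 0 (portA l)
  else Equiv.swap 0 (portA l) * Equiv.swap 1 (Equiv.swap 0 (portA l) (portB l))

theorem toFront_zero_of_isTerm {l : Letter} (h : isTerm l = true) :
    toFront l 0 = portA l := by
  simp [toFront, h]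

theorem toFront_of_not_isTerm {l : Letter} (h : isTerm l = false) (hAB : portA l ≠ portB l) :
    toFront l 0 = portA l ∧ toFront l 1 = portB l := by
  simp only [toFront, h, Bool.false_eq_true, if_false, Equiv.Perm.coe_mul, Function.comp_apply]
  generalize portA l = a at *
  generalize portB l = b at *
  revert a b
  decide

/-- A controlled NOT gate. -/
def cnot : (Fin 7 → Bool) ≃ (Fin 7 → Bool) :=
  Function.Involutive.toPerm (fun u => Function.update u 1 (xor (u 0) (u 1))) fun u => by
    simp

theorem cnot_apply (u : Fin 7 → Bool) (k : Fin 7) :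
    cnot u k = if k = 1 then xor (u 0) (u 1) else u k := by
  change Function.update u 1 (xor (u 0) (u 1)) k = _
  rw [Function.update_apply]

/-- The action on the ancillas before the Hadamard gate. -/
def before (l : Letter) : (Fin 7 → Bool) ≃ (Fin 7 → Bool) :=
  ((toFront l).symm.arrowCongr (Equiv.refl Bool)).trans
    (if isTerm l then Equiv.refl _ else cnot)

theorem before_of_isTerm {l : Letter} (h : isTerm l = true) (t : Fin 7 → Bool) (k : Fin 7) :
    before l t k = t (toFront l k) := by
  simp [before, h]

theorem before_of_not_isTerm {l : Letter} (h : isTerm l = false) (t : Fin 7 → Bool)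
    (k : Fin 7) :
    before l t k = if k = 1 then xor (t (toFront l 0)) (t (toFront l 1))
      else t (toFront l k) := by
  simp [before, h, cnot_apply]

/-- The inverse of the action on the ancillas after the Hadamard gate. -/
def after (l : Letter) : (Fin 7 → Bool) ≃ (Fin 7 → Bool) :=
  if isTerm l then Equiv.refl _ else (Equiv.swap 0 1).arrowCongr (Equiv.refl Bool)

/-- A reversible operation on the ancillas that is controlled by the letter. -/
def controlled (g : Letter → (Fin 7 → Bool) ≃ (Fin 7 → Bool)) :
    (Fin 8 ⊕ Fin 7 → Bool) ≃ (Fin 8 ⊕ Fin 7 → Bool) where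
  toFun t := Sum.elim (t ∘ Sum.inl) (g (t ∘ Sum.inl) (t ∘ Sum.inr))
  invFun t := Sum.elim (t ∘ Sum.inl) ((g (t ∘ Sum.inl)).symm (t ∘ Sum.inr))
  left_inv t := by
    funext k
    rcases k with k | k <;> simp
  right_inv t := by
    funext k
    rcases k with k | k <;> simp

/-- The exchange of the two measurement outcomes with the first two bits of the letter. -/
def exchange : (Fin 8 ⊕ Fin 7 → Bool) ≃ (Fin 8 ⊕ Fin 7 → Bool) :=
  Equiv.arrowCongr (Equiv.swap (Sum.inl 0) (Sum.inr 0) * Equiv.swap (Sum.inl 1) (Sum.inr 1) :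
    Equiv.Perm (Fin 8 ⊕ Fin 7)) (Equiv.refl Bool)

/-- The phase gate at input locations with question `1`. -/
noncomputable def phase (t : Fin 8 ⊕ Fin 7 → Bool) : ℂ :=
  if isTerm (t ∘ Sum.inl) && t (Sum.inl 6) && t (Sum.inr (portA (t ∘ Sum.inl))) then
    Complex.I else 1

/-- The unitary of the gate: Bell measurements at the vertices of a path except its
last one, and measurements of Pauli observables at input locations. -/
noncomputable def mat : Matrix (Fin 8 ⊕ Fin 7 → Bool) (Fin 8 ⊕ Fin 7 → Bool) ℂ :=
  oneHadamard (Sum.inr 0) phase (exchange.trans (controlled after)) (controlled before)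

theorem star_phase_mul_self (t : Fin 8 ⊕ Fin 7 → Bool) : star (phase t) * phase t = 1 := by
  unfold phase
  split_ifs <;> simp

theorem mat_isUnitary : mat.conjTranspose * mat = 1 :=
  oneHadamard_isUnitary _ star_phase_mul_self _ _

end VertexGate

theorem hadamard_flip {ι : Type} [Fintype ι] [DecidableEq ι] (w : ι) (z t : ι → Bool) :
    hadamard w z (fun k => xor (t k) (decide (k = w))) = bsgn (z w) * hadamard w z t := by
  have h : (∀ k ≠ w, z k = xor (t k) (decide (k = w))) ↔ ∀ k ≠ w, z k = t k :=
    forall₂_congr fun k hk => by simp [hk]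
  unfold hadamard
  simp only [h]
  split_ifs
  · cases z w <;> cases t w <;> simp
  · simp

namespace VertexGate

theorem controlled_eq (g : Letter → (Fin 7 → Bool) ≃ (Fin 7 → Bool)) {l : Letter}
    {t : Fin 8 ⊕ Fin 7 → Bool} (ht : t ∘ Sum.inl = l) :
    controlled g t = Sum.elim l (g l (t ∘ Sum.inr)) := by
  subst ht
  rfl

theorem before_xor_of_not_isTerm {l : Letter} (hl : isTerm l = false)
    (hAB : portA l ≠ portB l) (u : Fin 7 → Bool) (k : Fin 7) :
    before l (fun i => xor (u i) (decide (i = portA l ∨ i = portB l))) k =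
      xor (before l u k) (decide (k = 0)) := by
  obtain ⟨h0, h1⟩ := toFront_of_not_isTerm hl hAB
  simp only [before_of_not_isTerm hl, h0, h1]
  by_cases hk1 : k = 1
  · simp [hk1]
  · have hA : toFront l k = portA l ↔ k = 0 := by rw [← h0, (toFront l).injective.eq_iff]
    have hB : toFront l k ≠ portB l := by rwa [← h1, (toFront l).injective.ne_iff]
    simp [hk1, hA, hB]

theorem before_xor_of_isTerm {l : Letter} (hl : isTerm l = true) (u : Fin 7 → Bool) (k : Fin 7) :
    before l (fun i => xor (u i) (decide (i = portA l))) k =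
      xor (before l u k) (decide (k = 0)) := by
  simp only [before_of_isTerm hl, ← toFront_zero_of_isTerm hl, (toFront l).injective.eq_iff]

theorem mat_xor {l : Letter} {S : Fin 7 → Bool}
    (hS : ∀ u k, before l (fun i => xor (u i) (S i)) k = xor (before l u k) (decide (k = 0)))
    {t : Fin 8 ⊕ Fin 7 → Bool} (ht : t ∘ Sum.inl = l) (z : Fin 8 ⊕ Fin 7 → Bool) :
    mat z (fun k => xor (t k) (Sum.elim (fun _ => false) S k)) * phase t =
      phase (fun k => xor (t k) (Sum.elim (fun _ => false) S k)) *
        bsgn (controlled after (exchange z) (Sum.inr 0)) * mat z t := by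
  have hlet : (fun k => xor (t k) (Sum.elim (fun _ => false) S k)) ∘ Sum.inl = l := by
    funext k
    simp [← ht]
  have hflip : controlled before (fun k => xor (t k) (Sum.elim (fun _ => false) S k)) =
      fun k => xor (controlled before t k) (decide (k = Sum.inr 0)) := by
    rw [controlled_eq _ hlet, controlled_eq _ ht]
    funext k
    rcases k with k | k
    · simp
    · simp only [Sum.elim_inr, Sum.inr.injEq]
      exact hS (t ∘ Sum.inr) k
  simp only [mat, oneHadamard_apply, hflip, hadamard_flip, Equiv.trans_apply]
  ring

theorem controlled_after_eq_of_mat_ne_zero {z t : Fin 8 ⊕ Fin 7 → Bool} (h : mat z t ≠ 0)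
    {k : Fin 8 ⊕ Fin 7} (hk : k ≠ Sum.inr 0) :
    controlled after (exchange z) k = controlled before t k := by
  rw [mat, oneHadamard_apply, hadamard, mul_ite, mul_zero, ite_ne_right_iff] at h
  exact h.1 k hk

theorem exchange_comp_inl_of_mat_ne_zero {z t : Fin 8 ⊕ Fin 7 → Bool} (h : mat z t ≠ 0) :
    exchange z ∘ Sum.inl = t ∘ Sum.inl :=
  funext fun k => controlled_after_eq_of_mat_ne_zero h (k := Sum.inl k) Sum.inl_ne_inr

theorem controlled_after_of_not_isTerm {l : Letter} (hl : isTerm l = false)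
    {z : Fin 8 ⊕ Fin 7 → Bool} (hz : exchange z ∘ Sum.inl = l) :
    controlled after (exchange z) (Sum.inr 0) = z (Sum.inl 1) ∧
      controlled after (exchange z) (Sum.inr 1) = z (Sum.inl 0) := by
  rw [controlled_eq _ hz, after, hl]
  exact ⟨rfl, rfl⟩

theorem controlled_after_of_isTerm {l : Letter} (hl : isTerm l = true)
    {z : Fin 8 ⊕ Fin 7 → Bool} (hz : exchange z ∘ Sum.inl = l) :
    controlled after (exchange z) (Sum.inr 0) = z (Sum.inl 0) := by
  rw [controlled_eq _ hz, after, hl]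
  rfl

/-- The stabilizers `X ⊗ X` (for `q = 0`) and `Y ⊗ Y` (for `q = 1`) of the Bell measurement. -/
theorem mat_bell {l : Letter} (hl : isTerm l = false) (hAB : portA l ≠ portB l) (q : Bool)
    (z : Fin 8 ⊕ Fin 7 → Bool) {t : Fin 8 ⊕ Fin 7 → Bool} (ht : t ∘ Sum.inl = l) :
    mat z (fun k => xor (t k) (Sum.elim (fun _ => false)
        (fun i => decide (i = portA l ∨ i = portB l)) k)) *
        (bsgn (q && t (Sum.inr (portA l))) * bsgn (q && t (Sum.inr (portB l)))) =
      bsgn (z (Sum.inl 1)) * bsgn (q && z (Sum.inl 0)) * mat z t := by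
  have hphase {s : Fin 8 ⊕ Fin 7 → Bool} (hs : s ∘ Sum.inl = l) : phase s = 1 := by
    simp [phase, hs, hl]
  have hflip := mat_xor (before_xor_of_not_isTerm hl hAB) ht z
  rw [hphase ht, hphase (by funext k; simp [← ht]), one_mul, mul_one] at hflip
  rw [hflip]
  by_cases h : mat z t = 0
  · simp [h]
  · obtain ⟨h0, h1⟩ := toFront_of_not_isTerm hl hAB
    obtain ⟨hz1, hz0⟩ :=
      controlled_after_of_not_isTerm hl ((exchange_comp_inl_of_mat_ne_zero h).trans ht)
    have hxor : z (Sum.inl 0) = xor (t (Sum.inr (portA l))) (t (Sum.inr (portB l))) := by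
      rw [← hz0, controlled_after_eq_of_mat_ne_zero h (by simp), controlled_eq _ ht]
      simp [before_of_not_isTerm hl, h0, h1]
    rw [hz1, hxor]
    cases q <;> cases t (Sum.inr (portA l)) <;> cases t (Sum.inr (portB l)) <;> simp

theorem mat_pauli {l : Letter} (hl : isTerm l = true) (z : Fin 8 ⊕ Fin 7 → Bool)
    {t : Fin 8 ⊕ Fin 7 → Bool} (ht : t ∘ Sum.inl = l) :
    mat z (fun k => xor (t k) (Sum.elim (fun _ => false)
        (fun i => decide (i = portA l)) k)) * bsgn (l 6 && t (Sum.inr (portA l))) =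
      bsgn (z (Sum.inl 0)) * (if l 6 then Complex.I else 1) * mat z t := by
  have hphase {s : Fin 8 ⊕ Fin 7 → Bool} (hs : s ∘ Sum.inl = l) :
      phase s = if l 6 && s (Sum.inr (portA l)) then Complex.I else 1 := by
    rw [phase, hs, hl, Bool.true_and, ← hs, Function.comp_apply]
  have hflip := mat_xor (before_xor_of_isTerm hl) ht z
  have hsign : mat z t ≠ 0 → controlled after (exchange z) (Sum.inr 0) = z (Sum.inl 0) :=
    fun h => controlled_after_of_isTerm hl ((exchange_comp_inl_of_mat_ne_zero h).trans ht)
  rw [hphase ht, hphase (by funext k; simp [← ht])] at hflip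
  simp only [Sum.elim_inr, decide_true, Bool.xor_true] at hflip
  by_cases h : mat z t = 0
  · have hphase_ne : (if l 6 && t (Sum.inr (portA l)) then Complex.I else 1) ≠ 0 := by
      split_ifs <;> simp
    rw [h, mul_zero, mul_eq_zero_iff_right hphase_ne] at hflip
    rw [h, hflip, zero_mul, mul_zero]
  · rw [hsign h] at hflip
    revert hflip
    cases l 6 <;> cases t (Sum.inr (portA l)) <;> intro hflip
    · simpa using hflip
    · simpa using hflip
    · simp only [Bool.and_false, Bool.false_eq_true, if_false, mul_one, Bool.not_false,
        Bool.and_self, if_true, bsgn_false] at hflip ⊢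
      linear_combination hflip
    · simp only [Bool.and_self, if_true, Bool.not_true, Bool.and_false, Bool.false_eq_true,
        if_false, one_mul, bsgn_true, mul_neg, mul_one] at hflip ⊢
      linear_combination Complex.I * hflip - mat z _ * Complex.I_mul_I

end VertexGate

/-! ### Symmetries of the measurement at a vertex -/

namespace VertexSymbol

/-- The ancillas that are measured. -/
def ports : VertexSymbol → Finset (Fin 7)
  | blank => ∅
  | relay p n => {p.port, n.port}
  | hub _ n => {n.ghzPort, n.port}
  | term _ p _ => {p.port}

/-- Flips of the measured ancillas. -/
def flips (s : VertexSymbol) : Fin 8 ⊕ Fin 7 → Bool :=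
  Sum.elim (fun _ => false) fun k => decide (k ∈ s.ports)

/-- The signs of the measured ancillas on question `q`. -/
def signs (s : VertexSymbol) (q : ZMod 2) (t : Fin 8 ⊕ Fin 7 → Bool) : ℂ :=
  ∏ k ∈ s.ports, bsgn (decide (q = 1) && t (Sum.inr k))

/-- The sign of the outcome on question `q`. -/
noncomputable def outcome (s : VertexSymbol) (q : ZMod 2) (z : Fin 8 ⊕ Fin 7 → Bool) : ℂ :=
  match s with
  | blank => 1
  | relay _ _ => bsgn (z (Sum.inl 1)) * bsgn (decide (q = 1) && z (Sum.inl 0))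
  | hub _ _ => bsgn (z (Sum.inl 1)) * bsgn (decide (q = 1) && z (Sum.inl 0))
  | term _ _ _ => bsgn (z (Sum.inl 0)) * (if q = 1 then Complex.I else 1)

/-- The symbol can occur on a simple path to an input location with question `q`. -/
def Admissible (q : ZMod 2) : VertexSymbol → Prop
  | relay p n => p ≠ n
  | term _ _ q' => q' = q
  | _ => True

theorem portA_code_relay (p n : Dir) : VertexGate.portA (relay p n).code = p.port := by
  simp [VertexGate.portA, code, Dir.ofBits_bits]

theorem portB_code_relay (p n : Dir) : VertexGate.portB (relay p n).code = n.port := by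
  simp [VertexGate.portB, code, Dir.ofBits_bits]

theorem portA_code_hub (j : Fin 3) (n : Dir) :
    VertexGate.portA (hub j n).code = n.ghzPort := by
  simp [VertexGate.portA, code, Dir.ofBits_bits]

theorem portB_code_hub (j : Fin 3) (n : Dir) : VertexGate.portB (hub j n).code = n.port := by
  simp [VertexGate.portB, code, Dir.ofBits_bits]

theorem portA_code_term (j : Fin 3) (p : Dir) (q : ZMod 2) :
    VertexGate.portA (term j p q).code = p.port := by
  simp [VertexGate.portA, code, Dir.ofBits_bits]

theorem mat_flips {s : VertexSymbol} {q : ZMod 2} (hs : s.Admissible q)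
    (z : Fin 8 ⊕ Fin 7 → Bool) {t : Fin 8 ⊕ Fin 7 → Bool}
    (hcode : s = blank ∨ t ∘ Sum.inl = s.code) :
    VertexGate.mat z (fun k => xor (t k) (s.flips k)) * s.signs q t =
      s.outcome q z * VertexGate.mat z t := by
  cases s with
  | blank =>
    have hflips (k) : blank.flips k = false := by rcases k with k | k <;> simp [flips, ports]
    simp [hflips, signs, ports, outcome]
  | relay p n =>
    have hne : p.port ≠ n.port := Dir.port_injective.ne hs
    have hbell := VertexGate.mat_bell rfl (by rwa [portA_code_relay, portB_code_relay])
      (decide (q = 1)) z (hcode.resolve_left nofun)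
    rw [portA_code_relay, portB_code_relay] at hbell
    simpa [flips, signs, outcome, ports, Finset.prod_pair hne] using hbell
  | hub j n =>
    have hne : n.ghzPort ≠ n.port := Dir.ghzPort_ne_port n n
    have hbell := VertexGate.mat_bell rfl (by rwa [portA_code_hub, portB_code_hub])
      (decide (q = 1)) z (hcode.resolve_left nofun)
    rw [portA_code_hub, portB_code_hub] at hbell
    simpa [flips, signs, outcome, ports, Finset.prod_pair hne] using hbell
  | term j p q' =>
    obtain rfl : q' = q := hs
    have hpauli := VertexGate.mat_pauli rfl z (hcode.resolve_left nofun)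
    rw [portA_code_term, show (term j p q').code 6 = decide (q' = 1) from rfl] at hpauli
    simpa [flips, signs, outcome, ports] using hpauli

end VertexSymbol

/-! ### Neighbors in the grid -/

/-- The opposite direction. -/
def Dir.opp : Dir → Dir
  | left => right
  | right => left
  | down => up
  | up => down

theorem Dir.opp_opp (d : Dir) : d.opp.opp = d := by cases d <;> rfl

namespace Grid

variable {N : ℕ}

/-- The vertex `w` is the neighbor of `v` in direction `d`. -/
def Next (d : Dir) (v w : Grid N) : Prop :=
  match d with
  | Dir.left => v.2 = w.2 ∧ w.1.val + 1 = v.1.val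
  | Dir.right => v.2 = w.2 ∧ v.1.val + 1 = w.1.val
  | Dir.down => v.1 = w.1 ∧ w.2.val + 1 = v.2.val
  | Dir.up => v.1 = w.1 ∧ v.2.val + 1 = w.2.val

theorem Next.dir_eq {d : Dir} {v w : Grid N} (h : Next d v w) : v.dir w = d := by
  unfold Grid.dir
  simp only [Fin.lt_def]
  cases d <;> obtain ⟨h1, h2⟩ := h <;> rw [Fin.ext_iff] at h1
  · rw [if_pos (by omega)]
  · rw [if_neg (by omega), if_pos (by omega)]
  · rw [if_neg (by omega), if_neg (by omega), if_pos (by omega)]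
  · rw [if_neg (by omega), if_neg (by omega), if_neg (by omega)]

theorem Next.symm {d : Dir} {v w : Grid N} (h : Next d v w) : Next d.opp w v := by
  cases d <;> exact ⟨h.1.symm, h.2⟩

theorem Adj.next {v w : Grid N} (h : Adj v w) : Next (v.dir w) v w := by
  obtain ⟨d, hd⟩ : ∃ d, Next d v w := by
    rcases h with ⟨h1, h2 | h2⟩ | ⟨h1, h2 | h2⟩
    · exact ⟨Dir.right, h1, h2⟩
    · exact ⟨Dir.left, h1, h2⟩
    · exact ⟨Dir.up, h1, h2⟩
    · exact ⟨Dir.down, h1, h2⟩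
  rwa [hd.dir_eq]

theorem Next.unique {d : Dir} {v w w' : Grid N} (h : Next d v w) (h' : Next d v w') :
    w = w' := by
  cases d <;> obtain ⟨h1, h2⟩ := h <;> obtain ⟨h3, h4⟩ := h' <;> rw [Fin.ext_iff] at h1 h3 <;>
    exact Prod.ext (Fin.ext (by omega)) (Fin.ext (by omega))

theorem Next.ne {d : Dir} {v w : Grid N} (h : Next d v w) : v ≠ w := by
  rintro rfl
  cases d <;> have := h.2 <;> omega

end Grid

/-! ### The symbols along a path -/

section PathSymbol

variable {N : ℕ} {l : List (Grid N)}

theorem Grid.IsPath.next (hl : Grid.IsPath l) {n : ℕ} (hn : n + 1 < l.length) :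
    Grid.Next (l[n].dir l[n + 1]) l[n] l[n + 1] :=
  (List.isChain_iff_getElem.1 hl.2 n hn).next

theorem pathSymbol_zero (hl : Grid.IsPath l) (h1 : 1 < l.length) (j : Fin 3) (q : ZMod 2) :
    pathSymbol l j q l[0] = VertexSymbol.hub j (l[0].dir l[1]) := by
  unfold pathSymbol
  rw [if_pos (List.getElem_mem _), hl.1.idxOf_getElem, if_pos rfl, List.getD_eq_getElem _ _ h1]

theorem pathSymbol_last (hl : Grid.IsPath l) {n : ℕ} (hn : n + 2 = l.length) (j : Fin 3)
    (q : ZMod 2) :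
    pathSymbol l j q l[n + 1] = VertexSymbol.term j (l[n + 1].dir l[n]) q := by
  unfold pathSymbol
  rw [if_pos (List.getElem_mem _), hl.1.idxOf_getElem, if_neg (by omega), if_pos (by omega),
    Nat.add_sub_cancel, List.getD_eq_getElem _ _ (by omega)]

theorem pathSymbol_mid (hl : Grid.IsPath l) {n : ℕ} (hn : n + 2 < l.length) (j : Fin 3)
    (q : ZMod 2) :
    pathSymbol l j q l[n + 1] =
      VertexSymbol.relay (l[n + 1].dir l[n]) (l[n + 1].dir l[n + 2]) := by
  unfold pathSymbol
  rw [if_pos (List.getElem_mem _), hl.1.idxOf_getElem, if_neg (by omega), if_neg (by omega),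
    Nat.add_sub_cancel, List.getD_eq_getElem _ _ (by omega), List.getD_eq_getElem _ _ hn]

theorem Grid.IsPath.dir_ne (hl : Grid.IsPath l) {n : ℕ} (hn : n + 2 < l.length) :
    l[n + 1].dir l[n] ≠ l[n + 1].dir l[n + 2] := by
  intro h
  have h1 := (hl.next (n := n) (by omega)).symm
  have h2 := hl.next (n := n + 1) (by omega)
  rw [← h1.dir_eq, h] at h1
  have := (List.Nodup.getElem_inj_iff hl.1).1 (h1.unique h2)
  omega

theorem Grid.IsPath.dir_opp (hl : Grid.IsPath l) {n : ℕ} (hn : n + 1 < l.length) :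
    l[n + 1].dir l[n] = (l[n].dir l[n + 1]).opp := (hl.next hn).symm.dir_eq

theorem Grid.exists_index (h1 : 1 < l.length) {v : Grid N} (hv : v ∈ l) :
    v = l[0] ∨ (∃ n, ∃ hn : n + 2 < l.length, v = l[n + 1]) ∨
      ∃ n, ∃ hn : n + 2 = l.length, v = l[n + 1] := by
  obtain ⟨n, hn, rfl⟩ := List.getElem_of_mem hv
  rcases n with _ | n
  · exact Or.inl rfl
  · rcases Nat.lt_or_ge (n + 2) l.length with h | h
    · exact Or.inr (Or.inl ⟨n, h, rfl⟩)
    · exact Or.inr (Or.inr ⟨n, by omega, rfl⟩)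

theorem pathSymbol_admissible (hl : Grid.IsPath l) (h1 : 1 < l.length) (j : Fin 3) (q : ZMod 2)
    {v : Grid N} (hv : v ∈ l) : (pathSymbol l j q v).Admissible q := by
  rcases Grid.exists_index h1 hv with rfl | ⟨n, hn, rfl⟩ | ⟨n, hn, rfl⟩
  · rw [pathSymbol_zero hl h1]; trivial
  · rw [pathSymbol_mid hl hn]; exact hl.dir_ne hn
  · rw [pathSymbol_last hl hn]; exact rfl

theorem port_mem_ports_iff (hl : Grid.IsPath l) (h1 : 1 < l.length) (j : Fin 3) (q : ZMod 2)
    {v : Grid N} (hv : v ∈ l) (d : Dir) :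
    d.port ∈ (pathSymbol l j q v).ports ↔
      ∃ n, ∃ hn : n + 1 < l.length,
        (v = l[n] ∧ d = l[n].dir l[n + 1]) ∨ (v = l[n + 1] ∧ d = l[n + 1].dir l[n]) := by
  have hinj : ∀ {i k : ℕ} {hi : i < l.length} {hk : k < l.length}, l[i] = l[k] → i = k :=
    hl.1.getElem_inj_iff.1
  rcases Grid.exists_index h1 hv with rfl | ⟨n, hn, rfl⟩ | ⟨n, hn, rfl⟩
  · rw [pathSymbol_zero hl h1]
    simp only [VertexSymbol.ports, Finset.mem_insert, Finset.mem_singleton,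
      (Dir.ghzPort_ne_port _ _).symm, false_or, Dir.port_injective.eq_iff]
    constructor
    · exact fun h => ⟨0, h1, Or.inl ⟨rfl, h⟩⟩
    · rintro ⟨n, hn, ⟨h, h'⟩ | ⟨h, -⟩⟩
      · obtain rfl : 0 = n := hinj h
        exact h'
      · exact absurd (hinj h) (by omega)
  · rw [pathSymbol_mid hl hn]
    simp only [VertexSymbol.ports, Finset.mem_insert, Finset.mem_singleton,
      Dir.port_injective.eq_iff]
    constructor
    · rintro (h | h)
      · exact ⟨n, by omega, Or.inr ⟨rfl, h⟩⟩
      · exact ⟨n + 1, hn, Or.inl ⟨rfl, h⟩⟩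
    · rintro ⟨m, hm, ⟨h, h'⟩ | ⟨h, h'⟩⟩
      · obtain rfl : n + 1 = m := hinj h
        exact Or.inr h'
      · obtain rfl : n = m := by have := hinj h; omega
        exact Or.inl h'
  · rw [pathSymbol_last hl hn]
    simp only [VertexSymbol.ports, Finset.mem_singleton, Dir.port_injective.eq_iff]
    constructor
    · exact fun h => ⟨n, by omega, Or.inr ⟨rfl, h⟩⟩
    · rintro ⟨m, hm, ⟨h, -⟩ | ⟨h, h'⟩⟩
      · have := hinj h
        omega
      · obtain rfl : n = m := by have := hinj h; omega
        exact h'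

theorem mem_ports_iff_of_four_le (hl : Grid.IsPath l) (h1 : 1 < l.length) (j : Fin 3)
    (q : ZMod 2) {v : Grid N} (hv : v ∈ l) {k : Fin 7} (hk : 4 ≤ k.val) :
    k ∈ (pathSymbol l j q v).ports ↔ v = l[0] ∧ k = (l[0].dir l[1]).ghzPort := by
  have hne : ∀ d : Dir, k ≠ d.port := fun d h => by
    have := d.port_val_lt
    rw [← h] at this
    omega
  have hinj : ∀ {i k : ℕ} {hi : i < l.length} {hk : k < l.length}, l[i] = l[k] → i = k :=
    hl.1.getElem_inj_iff.1
  rcases Grid.exists_index h1 hv with rfl | ⟨n, hn, rfl⟩ | ⟨n, hn, rfl⟩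
  · rw [pathSymbol_zero hl h1]
    simp [VertexSymbol.ports, hne]
  · rw [pathSymbol_mid hl hn]
    have : l[n + 1] ≠ l[0] := fun h => by have := hinj h; omega
    simp [VertexSymbol.ports, hne, this]
  · rw [pathSymbol_last hl hn]
    have : l[n + 1] ≠ l[0] := fun h => by have := hinj h; omega
    simp [VertexSymbol.ports, hne, this]

theorem prod_range_of_telescoping {M : Type*} [CommMonoid M] {A E : ℕ → M} {G : M}
    (hE : ∀ n, E n * E n = 1) (h0 : A 0 = G * E 0) {m : ℕ}
    (hA : ∀ n < m, A (n + 1) = E n * E (n + 1)) (hm : A (m + 1) = E m) :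
    ∏ n ∈ Finset.range (m + 2), A n = G := by
  have hpartial : ∀ k ≤ m, ∏ n ∈ Finset.range (k + 1), A n = G * E k := by
    intro k
    induction k with
    | zero => intro _; simpa using h0
    | succ k ih =>
      intro hk
      rw [Finset.prod_range_succ, ih (by omega), hA k (by omega), mul_assoc, ← mul_assoc (E k),
        hE, one_mul]
  rw [Finset.prod_range_succ, hpartial m le_rfl, hm, mul_assoc, hE, mul_one]

theorem prod_map_eq_prod_range_getD {α M : Type*} [CommMonoid M] (l : List α) (d : α)
    (F : α → M) : (l.map F).prod = ∏ n ∈ Finset.range l.length, F (l.getD n d) := by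
  simp [Finset.prod_range, ← Fin.prod_univ_fun_getElem]

/-- The two ancillas of an edge carry the same bit, so the signs along a path telescope. -/
theorem prod_signs (hl : Grid.IsPath l) (h1 : 1 < l.length) (j : Fin 3) (q : ZMod 2)
    (t : QWire N 7 → Bool)
    (ht : ∀ d v w, Grid.Next d v w → t (v, Sum.inr d.port) = t (w, Sum.inr d.opp.port)) :
    (l.map fun v => (pathSymbol l j q v).signs q fun k => t (v, k)).prod =
      bsgn (decide (q = 1) && t (l[0], Sum.inr (l[0].dir l[1]).ghzPort)) := by
  obtain ⟨m, hm⟩ : ∃ m, m + 2 = l.length := ⟨l.length - 2, by omega⟩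
  have hD : ∀ n (hn : n < l.length), l.getD n l[0] = l[n] :=
    fun n hn => List.getD_eq_getElem _ _ hn
  set E : ℕ → ℂ := fun n => bsgn (decide (q = 1) &&
    t (l.getD n l[0], Sum.inr ((l.getD n l[0]).dir (l.getD (n + 1) l[0])).port)) with hEdef
  have hback : ∀ n (hn : n + 1 < l.length),
      bsgn (decide (q = 1) && t (l[n + 1], Sum.inr (l[n + 1].dir l[n]).port)) = E n := by
    intro n hn
    rw [hl.dir_opp hn, ← ht _ _ _ (hl.next hn)]
    simp only [hEdef]
    rw [hD n (by omega), hD (n + 1) hn]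
  rw [prod_map_eq_prod_range_getD l l[0],
    show Finset.range l.length = Finset.range (m + 2) by rw [hm]]
  refine prod_range_of_telescoping (E := E) (fun n => bsgn_mul_self _) ?_ (fun n hn => ?_) ?_
  · simp only [hEdef]
    rw [hD 0 (by omega), hD (0 + 1) (by omega), pathSymbol_zero hl h1, VertexSymbol.signs,
      VertexSymbol.ports, Finset.prod_pair (Dir.ghzPort_ne_port _ _)]
  · rw [← hback n (by omega)]
    simp only [hEdef]
    rw [hD (n + 1) (by omega), hD (n + 1 + 1) (by omega), pathSymbol_mid hl (by omega),
      VertexSymbol.signs, VertexSymbol.ports,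
      Finset.prod_pair fun h => hl.dir_ne (by omega) (Dir.port_injective h)]
  · rw [← hback m (by omega), hD (m + 1) (by omega), pathSymbol_last hl hm, VertexSymbol.signs,
      VertexSymbol.ports, Finset.prod_singleton]

end PathSymbol

/-! ### The outcomes along a path -/

/-- The sign of a parity. -/
def zsgn (a : ZMod 2) : ℂ := if a = 1 then -1 else 1

theorem zmod_two_cases (a : ZMod 2) : a = 0 ∨ a = 1 := by
  revert a
  decide

@[simp] theorem zsgn_zero : zsgn 0 = 1 := rfl

@[simp] theorem zsgn_one : zsgn 1 = -1 := rfl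

theorem zsgn_add (a b : ZMod 2) : zsgn (a + b) = zsgn a * zsgn b := by
  rcases zmod_two_cases a with rfl | rfl <;> rcases zmod_two_cases b with rfl | rfl <;>
    simp [show (1 + 1 : ZMod 2) = 0 from rfl]

theorem zsgn_eq_one_iff (a : ZMod 2) : zsgn a = 1 ↔ a = 0 := by
  rcases zmod_two_cases a with rfl | rfl
  · simp
  · norm_num

theorem bsgn_eq_zsgn (b : Bool) : bsgn b = zsgn (Planting.bit b) := by
  cases b <;> simp [Planting.bit]

theorem bsgn_and_eq_zsgn (q : ZMod 2) (b : Bool) :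
    bsgn (decide (q = 1) && b) = zsgn (q * Planting.bit b) := by
  rcases zmod_two_cases q with rfl | rfl <;> cases b <;> simp [Planting.bit]

theorem outcome_of_mem_dropLast {N : ℕ} {l : List (Grid N)} (hl : Grid.IsPath l)
    (h1 : 1 < l.length) (j : Fin 3) (q : ZMod 2) (z : Fin 8 ⊕ Fin 7 → Bool) {v : Grid N}
    (hv : v ∈ l.dropLast) :
    (pathSymbol l j q v).outcome q z =
      zsgn (Planting.bit (z (Sum.inl 1)) + q * Planting.bit (z (Sum.inl 0))) := by
  rw [zsgn_add, ← bsgn_eq_zsgn, ← bsgn_and_eq_zsgn]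
  rcases Grid.exists_index h1 (List.mem_of_mem_dropLast hv) with rfl | ⟨n, hn, rfl⟩ | ⟨n, hn, rfl⟩
  · rw [pathSymbol_zero hl h1]; rfl
  · rw [pathSymbol_mid hl hn]; rfl
  · exfalso
    obtain ⟨k, hk, hkv⟩ := List.getElem_of_mem hv
    rw [List.length_dropLast] at hk
    rw [List.getElem_dropLast] at hkv
    have := hl.1.getElem_inj_iff.1 hkv
    omega

theorem prod_zsgn_eq_zsgn_cor_sum {α : Type*} (q : ZMod 2) (s₁ s₂ : α → ZMod 2) (L : List α) :
    (L.map fun v => zsgn (s₂ v + q * s₁ v)).prod =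
      zsgn (cor (L.map fun v => (s₁ v, s₂ v)).sum (pauliLabel q)) := by
  induction L with
  | nil => simp [zsgn, cor]
  | cons v L ih =>
    rw [List.map_cons, List.prod_cons, ih, ← zsgn_add]
    congr 1
    simp only [cor, pauliLabel, List.map_cons, List.sum_cons, Prod.fst_add, Prod.snd_add]
    ring

theorem prod_outcomes {N : ℕ} {l : List (Grid N)} (hl : Grid.IsPath l) (h1 : 1 < l.length)
    (j : Fin 3) (q : ZMod 2) (z : QWire N 7 → Bool) :
    (l.map fun v => (pathSymbol l j q v).outcome q fun k => z (v, k)).prod =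
      zsgn (Planting.answer (fun v k => z (v, Sum.inl k)) l -
        cor (Planting.rotation (fun v k => z (v, Sum.inl k)) l) (pauliLabel q)) *
        (if q = 1 then Complex.I else 1) := by
  obtain ⟨m, hm⟩ : ∃ m, m + 2 = l.length := ⟨l.length - 2, by omega⟩
  have hne : l ≠ [] := List.ne_nil_of_length_pos (by omega)
  have hlast : l.getLast hne = l[m + 1] := by
    rw [List.getLast_eq_getElem]
    congr 1
    omega
  have hanswer : Planting.answer (fun v k => z (v, Sum.inl k)) l =
      Planting.bit (z (l[m + 1], Sum.inl 0)) := by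
    rw [Planting.answer, List.getLast?_eq_some_getLast hne, hlast]
    rfl
  have hsplit (F : Grid N → ℂ) : (l.map F).prod = (l.dropLast.map F).prod * F l[m + 1] := by
    conv_lhs => rw [← List.dropLast_append_getLast hne]
    simp [hlast]
  rw [hsplit, List.map_congr_left fun v hv => outcome_of_mem_dropLast hl h1 j q _ hv,
    prod_zsgn_eq_zsgn_cor_sum, pathSymbol_last hl hm, hanswer, sub_eq_add_neg,
    ZMod.neg_eq_self_mod_two, zsgn_add, ← bsgn_eq_zsgn]
  simp only [VertexSymbol.outcome, Planting.rotation]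
  ring

/-! ### The entangling layer -/

instance {N : ℕ} (d : Dir) (v w : Grid N) : Decidable (Grid.Next d v w) := by
  cases d <;> unfold Grid.Next <;> infer_instance

section EntanglingLayer

variable {N : ℕ}

/-- The edges of the grid in a given direction. -/
abbrev EdgeIndex (N : ℕ) (d : Dir) : Type :=
  {p : Grid N × Grid N // Grid.Next d p.1 p.2}

/-- Three vertically consecutive vertices of the grid. -/
abbrev TripleIndex (N : ℕ) : Type :=
  {p : Fin 3 → Grid N // Grid.Next Dir.up (p 0) (p 1) ∧ Grid.Next Dir.up (p 1) (p 2)}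

/-- The two ancillas of an edge. -/
def edgeWires {d : Dir} (p : EdgeIndex N d) : Bool ↪ QWire N 7 :=
  ⟨fun b => if b then (p.1.1, Sum.inr d.port) else (p.1.2, Sum.inr d.opp.port), fun b b' h => by
    have hne := p.2.ne
    cases b <;> cases b' <;> simp_all⟩

/-- The ancilla with the share of a GHZ state at each vertex of a triple. -/
def ghzIndex : Fin 3 → Fin 7 := ![4, 5, 6]

theorem ghzIndex_injective : Function.Injective ghzIndex := by decide

/-- The three ancillas of a triple. -/
def tripleWires (p : TripleIndex N) : Fin 3 ↪ QWire N 7 :=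
  ⟨fun i => (p.1 i, Sum.inr (ghzIndex i)), fun _ _ h =>
    ghzIndex_injective (Sum.inr_injective (Prod.ext_iff.1 h).2)⟩

/-- The entangled states that are prepared: one for each edge and for each triple. -/
abbrev EntangledIndex (N : ℕ) : Type :=
  (EdgeIndex N Dir.right ⊕ EdgeIndex N Dir.up) ⊕ TripleIndex N

/-- The gate that prepares one entangled state. -/
noncomputable def entangledGate : EntangledIndex N → QGate (QWire N 7)
  | Sum.inl (Sum.inl p) => QGate.ofEmbedding (edgeWires p) (ghzPrep true) (ghzPrep_isUnitary _)
  | Sum.inl (Sum.inr p) => QGate.ofEmbedding (edgeWires p) (ghzPrep true) (ghzPrep_isUnitary _)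
  | Sum.inr p => QGate.ofEmbedding (tripleWires p) (ghzPrep 0) (ghzPrep_isUnitary _)

theorem preparesGHZ_entangledGate (i : EntangledIndex N) : (entangledGate i).PreparesGHZ := by
  rcases i with (p | p) | p <;> exact QGate.preparesGHZ_ofEmbedding _ _

theorem mem_map_edgeWires {d : Dir} (p : EdgeIndex N d) (w : QWire N 7) :
    w ∈ Finset.univ.map (edgeWires p) ↔
      w = (p.1.1, Sum.inr d.port) ∨ w = (p.1.2, Sum.inr d.opp.port) := by
  simp only [Finset.mem_map, Finset.mem_univ, true_and, Bool.exists_bool,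
    eq_comm (b := w)]
  exact or_comm

theorem mem_map_tripleWires (p : TripleIndex N) (w : QWire N 7) :
    w ∈ Finset.univ.map (tripleWires p) ↔ ∃ i, w = (p.1 i, Sum.inr (ghzIndex i)) := by
  simp only [Finset.mem_map, Finset.mem_univ, true_and, eq_comm (b := w)]
  exact Iff.rfl

theorem edgeIndex_unique {d : Dir} {p p' : EdgeIndex N d} {w : QWire N 7}
    (h : w ∈ Finset.univ.map (edgeWires p)) (h' : w ∈ Finset.univ.map (edgeWires p')) :
    p = p' := by
  obtain ⟨⟨v, u⟩, hp⟩ := p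
  obtain ⟨⟨v', u'⟩, hp'⟩ := p'
  have hport : d.port ≠ d.opp.port := by cases d <;> decide
  rw [mem_map_edgeWires] at h h'
  simp only at hp hp' h h'
  rcases h with rfl | rfl <;> rcases h' with h' | h' <;>
    obtain ⟨h1, h2⟩ := Prod.ext_iff.1 h' <;> simp only [Sum.inr.injEq] at h1 h2
  · subst h1
    obtain rfl := hp.unique hp'
    rfl
  · exact absurd h2 hport
  · exact absurd h2.symm hport
  · subst h1
    obtain rfl := hp.symm.unique hp'.symm
    rfl

theorem tripleIndex_eq_of_apply_eq {p p' : TripleIndex N} {i : Fin 3} (h : p.1 i = p'.1 i) :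
    p = p' := by
  obtain ⟨p, hp⟩ := p
  obtain ⟨p', hp'⟩ := p'
  have h1 : p 1 = p' 1 := by
    fin_cases i
    · exact hp.1.unique (by rw [show p 0 = p' 0 from h]; exact hp'.1)
    · exact h
    · exact hp.2.symm.unique (by rw [show p 2 = p' 2 from h]; exact hp'.2.symm)
  have h0 : p 0 = p' 0 := hp.1.symm.unique (by rw [h1]; exact hp'.1.symm)
  have h2 : p 2 = p' 2 := hp.2.unique (by rw [h1]; exact hp'.2)
  refine Subtype.ext (funext fun k => ?_)
  fin_cases k <;> assumption

theorem tripleIndex_unique {p p' : TripleIndex N} {w : QWire N 7}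
    (h : w ∈ Finset.univ.map (tripleWires p)) (h' : w ∈ Finset.univ.map (tripleWires p')) :
    p = p' := by
  obtain ⟨k, rfl⟩ := (mem_map_tripleWires p w).1 h
  obtain ⟨k', hk'⟩ := (mem_map_tripleWires p' _).1 h'
  obtain ⟨hv, hk⟩ := Prod.ext_iff.1 hk'
  obtain rfl := ghzIndex_injective (Sum.inr_injective hk)
  exact tripleIndex_eq_of_apply_eq hv

/-- The ancillas that take part in the entangled states of each of the three kinds. -/
def entangledPorts : EntangledIndex N → Finset (Fin 7)
  | Sum.inl (Sum.inl _) => {0, 1}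
  | Sum.inl (Sum.inr _) => {2, 3}
  | Sum.inr _ => {4, 5, 6}

theorem exists_port_of_mem_support {i : EntangledIndex N} {w : QWire N 7}
    (h : w ∈ (entangledGate i).support) : ∃ k ∈ entangledPorts i, w.2 = Sum.inr k := by
  rcases i with (p | p) | p
  · rcases (mem_map_edgeWires p w).1 h with rfl | rfl
    · exact ⟨1, by simp [entangledPorts], rfl⟩
    · exact ⟨0, by simp [entangledPorts], rfl⟩
  · rcases (mem_map_edgeWires p w).1 h with rfl | rfl
    · exact ⟨3, by simp [entangledPorts], rfl⟩
    · exact ⟨2, by simp [entangledPorts], rfl⟩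
  · obtain ⟨k, rfl⟩ := (mem_map_tripleWires p w).1 h
    exact ⟨ghzIndex k, by fin_cases k <;> simp [entangledPorts, ghzIndex], rfl⟩

theorem inl_notMem_support (v : Grid N) (k : Fin 8) (i : EntangledIndex N) :
    ((v, Sum.inl k) : QWire N 7) ∉ (entangledGate i).support := fun h => by
  obtain ⟨k', -, h'⟩ := exists_port_of_mem_support h
  exact Sum.inl_ne_inr h'

theorem entangledIndex_unique {i i' : EntangledIndex N} {w : QWire N 7}
    (h : w ∈ (entangledGate i).support) (h' : w ∈ (entangledGate i').support) : i = i' := by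
  obtain ⟨k, hk, hwk⟩ := exists_port_of_mem_support h
  obtain ⟨k', hk', hwk'⟩ := exists_port_of_mem_support h'
  obtain rfl : k = k' := Sum.inr_injective (hwk.symm.trans hwk')
  rcases i with (p | p) | p <;> rcases i' with (p' | p') | p' <;>
    first
    | rw [edgeIndex_unique h h']
    | rw [tripleIndex_unique h h']
    | (exfalso
       simp only [entangledPorts, Finset.mem_insert, Finset.mem_singleton] at hk hk'
       omega)

/-- The layer that prepares all entangled states. -/
noncomputable def entanglingLayer (N : ℕ) : QLayer (QWire N 7) where
  gates := (Finset.univ : Finset (EntangledIndex N)).toList.map entangledGate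
  disjoint := by
    rw [List.pairwise_map]
    refine (Finset.nodup_toList _).imp fun {i i'} hi => ?_
    exact Finset.disjoint_left.2 fun w hw hw' => hi (entangledIndex_unique hw hw')

theorem forall_mem_edgeWires_eq_iff {d : Dir} (p : EdgeIndex N d) (t : QWire N 7 → Bool) :
    (∀ a ∈ Finset.univ.map (edgeWires p), ∀ b ∈ Finset.univ.map (edgeWires p), t a = t b) ↔
      t (p.1.1, Sum.inr d.port) = t (p.1.2, Sum.inr d.opp.port) := by
  constructor
  · exact fun h => h _ ((mem_map_edgeWires p _).2 (Or.inl rfl)) _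
      ((mem_map_edgeWires p _).2 (Or.inr rfl))
  · intro h a ha b hb
    rcases (mem_map_edgeWires p a).1 ha with rfl | rfl <;>
      rcases (mem_map_edgeWires p b).1 hb with rfl | rfl
    exacts [rfl, h, h.symm, rfl]

theorem forall_mem_tripleWires_eq_iff (p : TripleIndex N) (t : QWire N 7 → Bool) :
    (∀ a ∈ Finset.univ.map (tripleWires p), ∀ b ∈ Finset.univ.map (tripleWires p), t a = t b) ↔
      ∀ i i', t (p.1 i, Sum.inr (ghzIndex i)) = t (p.1 i', Sum.inr (ghzIndex i')) := by
  constructor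
  · exact fun h i i' => h _ ((mem_map_tripleWires p _).2 ⟨i, rfl⟩) _
      ((mem_map_tripleWires p _).2 ⟨i', rfl⟩)
  · intro h a ha b hb
    obtain ⟨k, rfl⟩ := (mem_map_tripleWires p a).1 ha
    obtain ⟨k', rfl⟩ := (mem_map_tripleWires p b).1 hb
    exact h k k'

theorem forall_edgeIndex_eq_iff (t : QWire N 7 → Bool) :
    ((∀ p : EdgeIndex N Dir.right,
        t (p.1.1, Sum.inr Dir.right.port) = t (p.1.2, Sum.inr Dir.right.opp.port)) ∧
      ∀ p : EdgeIndex N Dir.up,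
        t (p.1.1, Sum.inr Dir.up.port) = t (p.1.2, Sum.inr Dir.up.opp.port)) ↔
      ∀ d v w, Grid.Next d v w → t (v, Sum.inr d.port) = t (w, Sum.inr d.opp.port) := by
  refine ⟨fun ⟨hright, hup⟩ d v w hvw => ?_,
    fun h => ⟨fun p => h _ _ _ p.2, fun p => h _ _ _ p.2⟩⟩
  cases d
  · exact (hright ⟨(w, v), hvw.symm⟩).symm
  · exact hright ⟨(v, w), hvw⟩
  · exact (hup ⟨(w, v), hvw.symm⟩).symm
  · exact hup ⟨(v, w), hvw⟩

theorem constantOn_entanglingLayer_iff (z₀ t : QWire N 7 → Bool) :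
    ConstantOn (entanglingLayer N).gates z₀ t ↔
      ((∀ d v w, Grid.Next d v w → t (v, Sum.inr d.port) = t (w, Sum.inr d.opp.port)) ∧
        ∀ p : TripleIndex N, ∀ i i', t (p.1 i, Sum.inr (ghzIndex i)) =
          t (p.1 i', Sum.inr (ghzIndex i'))) ∧
      ∀ w, (∀ i, w ∉ (entangledGate i).support) → t w = z₀ w := by
  unfold ConstantOn entanglingLayer
  simp only [List.mem_map, Finset.mem_toList, Finset.mem_univ, true_and, forall_exists_index,
    forall_apply_eq_imp_iff]
  refine and_congr_left' (Sum.forall.trans (and_congr ?_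
    (forall_congr' fun p => forall_mem_tripleWires_eq_iff p t)))
  rw [← forall_edgeIndex_eq_iff]
  exact Sum.forall.trans (and_congr (forall_congr' fun p => forall_mem_edgeWires_eq_iff p t)
    (forall_congr' fun p => forall_mem_edgeWires_eq_iff p t))

/-- The quantum circuit: entanglement is prepared everywhere, and then every vertex measures its
ancillas as told by its input letter. -/
noncomputable def teleportCircuit (N : ℕ) : QCircuit N 7 :=
  [entanglingLayer N, vertexLayer VertexGate.mat_isUnitary N]

open scoped Classical in
theorem entanglingLayer_apply_init (x : Grid N → Letter) (t : QWire N 7 → Bool) :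
    (entanglingLayer N).apply (QCircuit.init 7 x) t =
      if ConstantOn (entanglingLayer N).gates
        (fun p => Sum.elim (x p.1) (fun _ => false) p.2) t then
        (Real.sqrt 2 : ℂ)⁻¹ ^ (entanglingLayer N).gates.length else 0 := by
  rw [← foldr_preparesGHZ (entanglingLayer N).gates ?_ (entanglingLayer N).disjoint]
  · unfold QLayer.apply QCircuit.init
    congr! 3
  · intro g hg a ha
    obtain ⟨i, -, rfl⟩ := List.mem_map.1 hg
    obtain ⟨v, k | k⟩ := a
    · exact absurd ha (inl_notMem_support v k i)
    · rfl
  · intro g hg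
    obtain ⟨i, -, rfl⟩ := List.mem_map.1 hg
    exact preparesGHZ_entangledGate i

theorem entanglingLayer_apply_init_inl {x : Grid N → Letter} (t : QWire N 7 → Bool)
    (ht : (entanglingLayer N).apply (QCircuit.init 7 x) t ≠ 0) (v : Grid N) (k : Fin 8) :
    t (v, Sum.inl k) = x v k := by
  classical
  rw [entanglingLayer_apply_init, ite_ne_right_iff] at ht
  exact ht.1.2 _ fun g hg => by
    obtain ⟨i, -, rfl⟩ := List.mem_map.1 hg
    exact inl_notMem_support v k i

theorem depth_teleportCircuit : (teleportCircuit N).depth ≤ 3 := by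
  simp [teleportCircuit, QCircuit.depth]

theorem fanIn_teleportCircuit : (teleportCircuit N).FanIn 15 := by
  intro l hl g hg
  simp only [teleportCircuit, List.mem_cons, List.not_mem_nil, or_false] at hl
  rcases hl with rfl | rfl
  · obtain ⟨i, -, rfl⟩ := List.mem_map.1 hg
    rcases i with (p | p) | p <;>
      exact (Finset.card_map _).trans_le (by decide)
  · obtain ⟨v, -, rfl⟩ := List.mem_map.1 hg
    exact (Finset.card_map _).trans_le (by decide)

theorem Grid.Within.mono {R S : ℕ} (hRS : R ≤ S) {v w : Grid N} (h : Grid.Within R v w) :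
    Grid.Within S v w := by
  obtain ⟨h1, h2, h3, h4⟩ := h
  refine ⟨?_, ?_, ?_, ?_⟩ <;> omega

theorem within_of_mem_edgeWires {d : Dir} (p : EdgeIndex N d) {a b : QWire N 7}
    (ha : a ∈ Finset.univ.map (edgeWires p)) (hb : b ∈ Finset.univ.map (edgeWires p)) :
    Grid.Within 1 a.1 b.1 := by
  have hp := p.2
  rcases (mem_map_edgeWires p a).1 ha with rfl | rfl <;>
    rcases (mem_map_edgeWires p b).1 hb with rfl | rfl <;>
    cases d <;> obtain ⟨h1, h2⟩ := hp <;> rw [Fin.ext_iff] at h1 <;>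
    refine ⟨?_, ?_, ?_, ?_⟩ <;> dsimp only <;> omega

theorem within_of_mem_tripleWires (p : TripleIndex N) {a b : QWire N 7}
    (ha : a ∈ Finset.univ.map (tripleWires p)) (hb : b ∈ Finset.univ.map (tripleWires p)) :
    Grid.Within 2 a.1 b.1 := by
  have hcolumn (k : Fin 3) : (p.1 k).1.val = (p.1 0).1.val ∧
      (p.1 k).2.val = (p.1 0).2.val + k.val := by
    obtain ⟨⟨h1, h2⟩, h3, h4⟩ := p.2
    rw [Fin.ext_iff] at h1 h3
    fin_cases k
    · exact ⟨rfl, rfl⟩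
    · exact ⟨h1.symm, h2.symm⟩
    · exact ⟨h3.symm.trans h1.symm, by simp only [Fin.reduceFinMk]; omega⟩
  obtain ⟨k, rfl⟩ := (mem_map_tripleWires p a).1 ha
  obtain ⟨k', rfl⟩ := (mem_map_tripleWires p b).1 hb
  have hk := hcolumn k
  have hk' := hcolumn k'
  refine ⟨?_, ?_, ?_, ?_⟩ <;> dsimp only <;> omega

theorem geometricallyLocal_teleportCircuit : (teleportCircuit N).GeometricallyLocal 2 := by
  intro l hl g hg a ha b hb
  simp only [teleportCircuit, List.mem_cons, List.not_mem_nil, or_false] at hl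
  rcases hl with rfl | rfl
  · obtain ⟨i, -, rfl⟩ := List.mem_map.1 hg
    rcases i with (p | p) | p
    · exact (within_of_mem_edgeWires p ha hb).mono one_le_two
    · exact (within_of_mem_edgeWires p ha hb).mono one_le_two
    · exact within_of_mem_tripleWires p ha hb
  · obtain ⟨v, -, rfl⟩ := List.mem_map.1 hg
    obtain ⟨k, -, rfl⟩ := Finset.mem_map.1 ha
    obtain ⟨k', -, rfl⟩ := Finset.mem_map.1 hb
    exact ⟨Nat.le_add_right _ _, Nat.le_add_right _ _, Nat.le_add_right _ _,
      Nat.le_add_right _ _⟩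

end EntanglingLayer

/-! ### Teleportation along a star -/

section Star

variable {N : ℕ}

/-- The paths `l` start at the three vertices of the triple `u`, in the order given by `σ`, and
their first directions single out the ancillas of the GHZ state of `u`. -/
def IsHubTriple (l : Fin 3 → List (Grid N)) (hl : ∀ j, 1 < (l j).length) (u : TripleIndex N)
    (σ : Equiv.Perm (Fin 3)) : Prop :=
  ∀ j, (l j)[0]'(zero_lt_one.trans (hl j)) = u.1 (σ j) ∧
    (((l j)[0]'(zero_lt_one.trans (hl j))).dir ((l j)[1]'(hl j))).ghzPort = ghzIndex (σ j)

/-- Three disjoint paths that start at vertically consecutive vertices, so that every one of them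
can recognize its share of the GHZ state from its first direction. -/
structure Grid.IsStar (l : Fin 3 → List (Grid N)) : Prop where
  isPath : ∀ j, Grid.IsPath (l j)
  one_lt : ∀ j, 1 < (l j).length
  disjoint : ∀ j j', j ≠ j' → (l j).Disjoint (l j')
  hubs : ∃ u σ, IsHubTriple l one_lt u σ

open scoped Classical in
/-- The symbol at a vertex, with respect to one star. -/
noncomputable def starSymbol (l : Fin 3 → List (Grid N)) (q : Fin 3 → ZMod 2) (v : Grid N) :
    VertexSymbol :=
  if h : ∃ j, v ∈ l j then pathSymbol (l h.choose) h.choose (q h.choose) v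
  else VertexSymbol.blank

open scoped Classical in
/-- The question belonging to a vertex, with respect to one star. -/
noncomputable def starQuery (l : Fin 3 → List (Grid N)) (q : Fin 3 → ZMod 2) (v : Grid N) :
    ZMod 2 :=
  if h : ∃ j, v ∈ l j then q h.choose else 0

variable {l : Fin 3 → List (Grid N)}

theorem Grid.IsStar.index_unique (hl : Grid.IsStar l) {j j' : Fin 3} {v : Grid N}
    (h : v ∈ l j) (h' : v ∈ l j') : j = j' := by
  by_contra hne
  exact hl.disjoint j j' hne h h'

theorem Grid.IsStar.starSymbol_eq_and_starQuery_eq (hl : Grid.IsStar l)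
    (q : Fin 3 → ZMod 2) {j : Fin 3} {v : Grid N} (hv : v ∈ l j) :
    starSymbol l q v = pathSymbol (l j) j (q j) v ∧ starQuery l q v = q j := by
  have h : ∃ j, v ∈ l j := ⟨j, hv⟩
  have hj : h.choose = j := hl.index_unique h.choose_spec hv
  unfold starSymbol starQuery
  rw [dif_pos h, dif_pos h, hj]
  exact ⟨rfl, rfl⟩

theorem starSymbol_eq_blank (q : Fin 3 → ZMod 2) {v : Grid N} (hv : ¬ ∃ j, v ∈ l j) :
    starSymbol l q v = VertexSymbol.blank := by
  unfold starSymbol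
  rw [dif_neg hv]

theorem Grid.IsStar.starSymbol_admissible (hl : Grid.IsStar l) (q : Fin 3 → ZMod 2)
    (v : Grid N) : (starSymbol l q v).Admissible (starQuery l q v) := by
  by_cases hv : ∃ j, v ∈ l j
  · obtain ⟨j, hj⟩ := hv
    rw [(hl.starSymbol_eq_and_starQuery_eq q hj).1, (hl.starSymbol_eq_and_starQuery_eq q hj).2]
    exact pathSymbol_admissible (hl.isPath j) (hl.one_lt j) j (q j) hj
  · rw [starSymbol_eq_blank q hv]
    trivial

theorem Grid.IsStar.starSymbol_eq_blank_or (hl : Grid.IsStar l) {q : Fin 3 → ZMod 2}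
    {x : Grid N → Letter} (hx : ∀ j, ∀ v ∈ l j, x v = (pathSymbol (l j) j (q j) v).code)
    (v : Grid N) :
    starSymbol l q v = VertexSymbol.blank ∨ x v = (starSymbol l q v).code := by
  by_cases hv : ∃ j, v ∈ l j
  · obtain ⟨j, hj⟩ := hv
    exact Or.inr (by rw [hx j v hj, (hl.starSymbol_eq_and_starQuery_eq q hj).1])
  · exact Or.inl (starSymbol_eq_blank q hv)

theorem Grid.IsStar.prod_starSymbol {M : Type*} [CommMonoid M] (hl : Grid.IsStar l)
    (q : Fin 3 → ZMod 2) (Φ : VertexSymbol → ZMod 2 → Grid N → M)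
    (hΦ : ∀ q v, Φ VertexSymbol.blank q v = 1) :
    ∏ v, Φ (starSymbol l q v) (starQuery l q v) v =
      ∏ j, ((l j).map fun v => Φ (pathSymbol (l j) j (q j) v) (q j) v).prod := by
  have h1 : ∏ v, Φ (starSymbol l q v) (starQuery l q v) v =
      ∏ v ∈ Finset.univ.biUnion fun j => (l j).toFinset,
        Φ (starSymbol l q v) (starQuery l q v) v := by
    refine (Finset.prod_subset (Finset.subset_univ _) fun v _ hv => ?_).symm
    rw [starSymbol_eq_blank q fun ⟨j, hj⟩ => hv
      (Finset.mem_biUnion.2 ⟨j, Finset.mem_univ j, List.mem_toFinset.2 hj⟩), hΦ]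
  rw [h1, Finset.prod_biUnion]
  · refine Finset.prod_congr rfl fun j _ => ?_
    rw [List.prod_toFinset _ (hl.isPath j).1]
    congr 1
    refine List.map_congr_left fun v hv => ?_
    rw [(hl.starSymbol_eq_and_starQuery_eq q hv).1, (hl.starSymbol_eq_and_starQuery_eq q hv).2]
  · intro j _ j' _ hne
    exact Finset.disjoint_left.2 fun v hv hv' =>
      hl.disjoint j j' hne (List.mem_toFinset.1 hv) (List.mem_toFinset.1 hv')

theorem Grid.IsStar.mem_ports_iff (hl : Grid.IsStar l) (q : Fin 3 → ZMod 2) (v : Grid N)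
    (k : Fin 7) : k ∈ (starSymbol l q v).ports ↔
      ∃ j, v ∈ l j ∧ k ∈ (pathSymbol (l j) j (q j) v).ports := by
  constructor
  · intro h
    by_cases hv : ∃ j, v ∈ l j
    · obtain ⟨j, hj⟩ := hv
      exact ⟨j, hj, (hl.starSymbol_eq_and_starQuery_eq q hj).1 ▸ h⟩
    · rw [starSymbol_eq_blank q hv] at h
      exact absurd h (Finset.notMem_empty k)
  · rintro ⟨j, hj, h⟩
    rwa [(hl.starSymbol_eq_and_starQuery_eq q hj).1]

theorem Grid.IsStar.exists_next_of_mem_ports (hl : Grid.IsStar l) {q : Fin 3 → ZMod 2}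
    {v : Grid N} {d : Dir} (h : d.port ∈ (starSymbol l q v).ports) :
    ∃ w, Grid.Next d v w ∧ d.opp.port ∈ (starSymbol l q w).ports := by
  obtain ⟨j, hv, hk⟩ := (hl.mem_ports_iff q v _).1 h
  obtain ⟨n, hn, ⟨rfl, rfl⟩ | ⟨rfl, rfl⟩⟩ :=
    (port_mem_ports_iff (hl.isPath j) (hl.one_lt j) j (q j) hv d).1 hk
  · refine ⟨(l j)[n + 1], (hl.isPath j).next hn, (hl.mem_ports_iff q _ _).2
      ⟨j, List.getElem_mem _, ?_⟩⟩
    rw [port_mem_ports_iff (hl.isPath j) (hl.one_lt j) j (q j) (List.getElem_mem _)]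
    exact ⟨n, hn, Or.inr ⟨rfl, ((hl.isPath j).dir_opp hn).symm⟩⟩
  · refine ⟨(l j)[n], ?_, (hl.mem_ports_iff q _ _).2 ⟨j, List.getElem_mem _, ?_⟩⟩
    · rw [(hl.isPath j).dir_opp hn]
      exact ((hl.isPath j).next hn).symm
    · rw [port_mem_ports_iff (hl.isPath j) (hl.one_lt j) j (q j) (List.getElem_mem _)]
      exact ⟨n, hn, Or.inl ⟨rfl, by rw [(hl.isPath j).dir_opp hn, Dir.opp_opp]⟩⟩

theorem Grid.IsStar.port_mem_ports_iff_opp (hl : Grid.IsStar l) (q : Fin 3 → ZMod 2)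
    {d : Dir} {v w : Grid N} (hvw : Grid.Next d v w) :
    d.port ∈ (starSymbol l q v).ports ↔ d.opp.port ∈ (starSymbol l q w).ports := by
  constructor
  · intro h
    obtain ⟨w', hw', h'⟩ := hl.exists_next_of_mem_ports h
    rwa [hvw.unique hw']
  · intro h
    obtain ⟨v', hv', h'⟩ := hl.exists_next_of_mem_ports h
    rwa [Dir.opp_opp, ← hvw.symm.unique hv'] at h'

theorem four_le_ghzIndex (i : Fin 3) : 4 ≤ (ghzIndex i).val := by
  revert i
  decide

theorem port_or_ghzIndex (k : Fin 7) :
    (∃ d : Dir, k = d.port) ∨ ∃ i, k = ghzIndex i := by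
  fin_cases k
  · exact Or.inl ⟨Dir.left, rfl⟩
  · exact Or.inl ⟨Dir.right, rfl⟩
  · exact Or.inl ⟨Dir.down, rfl⟩
  · exact Or.inl ⟨Dir.up, rfl⟩
  · exact Or.inr ⟨0, rfl⟩
  · exact Or.inr ⟨1, rfl⟩
  · exact Or.inr ⟨2, rfl⟩

theorem Grid.IsStar.ghzIndex_mem_ports_iff (hl : Grid.IsStar l) (q : Fin 3 → ZMod 2)
    {u : TripleIndex N} {σ : Equiv.Perm (Fin 3)} (hu : IsHubTriple l hl.one_lt u σ) (v : Grid N)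
    (i : Fin 3) : ghzIndex i ∈ (starSymbol l q v).ports ↔ v = u.1 i := by
  have hports (j : Fin 3) {v : Grid N} (hv : v ∈ l j) (i : Fin 3) :=
    mem_ports_iff_of_four_le (hl.isPath j) (hl.one_lt j) j (q j) hv (four_le_ghzIndex i)
  rw [hl.mem_ports_iff]
  constructor
  · rintro ⟨j, hv, hk⟩
    rw [hports j hv] at hk
    rw [hk.1, (hu j).1, ghzIndex_injective (hk.2.trans (hu j).2)]
  · rintro rfl
    obtain ⟨j, rfl⟩ := σ.surjective i
    have hj : u.1 (σ j) ∈ l j := by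
      rw [← (hu j).1]
      exact List.getElem_mem _
    exact ⟨j, hj, (hports j hj _).2 ⟨(hu j).1.symm, (hu j).2.symm⟩⟩

theorem exists_mem_support_of_next {d : Dir} {v w : Grid N} (hvw : Grid.Next d v w) :
    ∃ i, ((v, Sum.inr d.port) : QWire N 7) ∈ (entangledGate i).support := by
  cases d
  · exact ⟨Sum.inl (Sum.inl ⟨(w, v), hvw.symm⟩), (mem_map_edgeWires _ _).2 (Or.inr rfl)⟩
  · exact ⟨Sum.inl (Sum.inl ⟨(v, w), hvw⟩), (mem_map_edgeWires _ _).2 (Or.inl rfl)⟩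
  · exact ⟨Sum.inl (Sum.inr ⟨(w, v), hvw.symm⟩), (mem_map_edgeWires _ _).2 (Or.inr rfl)⟩
  · exact ⟨Sum.inl (Sum.inr ⟨(v, w), hvw⟩), (mem_map_edgeWires _ _).2 (Or.inl rfl)⟩

theorem Grid.IsStar.exists_mem_support_of_mem_ports (hl : Grid.IsStar l) {q : Fin 3 → ZMod 2}
    {v : Grid N} {k : Fin 7} (hk : k ∈ (starSymbol l q v).ports) :
    ∃ i, ((v, Sum.inr k) : QWire N 7) ∈ (entangledGate i).support := by
  rcases port_or_ghzIndex k with ⟨d, rfl⟩ | ⟨i, rfl⟩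
  · obtain ⟨w, hvw, -⟩ := hl.exists_next_of_mem_ports hk
    exact exists_mem_support_of_next hvw
  · obtain ⟨u, σ, hu⟩ := hl.hubs
    rw [hl.ghzIndex_mem_ports_iff q hu] at hk
    exact ⟨Sum.inr u, (mem_map_tripleWires u _).2 ⟨i, by rw [hk]⟩⟩

theorem Grid.IsStar.constantOn_flips (hl : Grid.IsStar l) (q : Fin 3 → ZMod 2) :
    ConstantOn (entanglingLayer N).gates (fun _ => false)
      fun w => (starSymbol l q w.1).flips w.2 := by
  obtain ⟨u, σ, hu⟩ := hl.hubs
  rw [constantOn_entanglingLayer_iff]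
  refine ⟨⟨fun d v w hvw => ?_, fun p i i' => ?_⟩, fun w hw => ?_⟩
  · simp only [VertexSymbol.flips, Sum.elim_inr, decide_eq_decide]
    exact hl.port_mem_ports_iff_opp q hvw
  · have hmem (i : Fin 3) : ghzIndex i ∈ (starSymbol l q (p.1 i)).ports ↔ p = u := by
      rw [hl.ghzIndex_mem_ports_iff q hu]
      exact ⟨tripleIndex_eq_of_apply_eq, fun h => by rw [h]⟩
    simp only [VertexSymbol.flips, Sum.elim_inr, hmem]
  · obtain ⟨v, k | k⟩ := w
    · rfl
    · refine decide_eq_false fun hk => ?_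
      obtain ⟨i, hi⟩ := hl.exists_mem_support_of_mem_ports hk
      exact hw i hi

theorem prod_ghz_signs {q : Fin 3 → ZMod 2} (hq : q ∈ ghzQueries) (b : Bool) :
    ∏ j, bsgn (decide (q j = 1) && b) = 1 := by
  simp only [ghzQueries, Finset.mem_insert, Finset.mem_singleton] at hq
  rcases hq with rfl | rfl | rfl | rfl <;> cases b <;> simp [Fin.prod_univ_three]

theorem prod_ghz_phases {q : Fin 3 → ZMod 2} (hq : q ∈ ghzQueries) :
    ∏ j, (if q j = 1 then Complex.I else 1) = zsgn (ghzTarget q) := by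
  simp only [ghzQueries, Finset.mem_insert, Finset.mem_singleton] at hq
  rcases hq with rfl | rfl | rfl | rfl
  · rw [show ghzTarget ![0, 0, 0] = 0 by decide]; simp [Fin.prod_univ_three]
  · rw [show ghzTarget ![0, 1, 1] = 1 by decide]; simp [Fin.prod_univ_three]
  · rw [show ghzTarget ![1, 0, 1] = 1 by decide]; simp [Fin.prod_univ_three]
  · rw [show ghzTarget ![1, 1, 0] = 1 by decide]; simp [Fin.prod_univ_three]

theorem Grid.IsStar.prod_signs_eq_one (hl : Grid.IsStar l) {q : Fin 3 → ZMod 2}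
    (hq : q ∈ ghzQueries) {z₀ t : QWire N 7 → Bool}
    (ht : ConstantOn (entanglingLayer N).gates z₀ t) :
    ∏ v, (starSymbol l q v).signs (starQuery l q v) (fun k => t (v, k)) = 1 := by
  obtain ⟨⟨hedge, htriple⟩, -⟩ := (constantOn_entanglingLayer_iff _ _).1 ht
  obtain ⟨u, σ, hu⟩ := hl.hubs
  have hpath (j : Fin 3) :
      ((l j).map fun v => (pathSymbol (l j) j (q j) v).signs (q j) fun k => t (v, k)).prod =
        bsgn (decide (q j = 1) && t (u.1 0, Sum.inr (ghzIndex 0))) := by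
    rw [prod_signs (hl.isPath j) (hl.one_lt j) j (q j) t hedge, (hu j).2, (hu j).1,
      htriple u (σ j) 0]
  rw [hl.prod_starSymbol q (fun s q v => s.signs q fun k => t (v, k)) (fun _ _ => rfl)]
  simp only [hpath, prod_ghz_signs hq]

theorem Grid.IsStar.entanglingLayer_apply_init_xor_flips (hl : Grid.IsStar l)
    {q : Fin 3 → ZMod 2} (hq : q ∈ ghzQueries) (x : Grid N → Letter) (t : QWire N 7 → Bool) :
    (entanglingLayer N).apply (QCircuit.init 7 x)
        (fun w => xor (t w) ((starSymbol l q w.1).flips w.2)) =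
      (∏ v, (starSymbol l q v).signs (starQuery l q v) fun k => t (v, k)) *
        (entanglingLayer N).apply (QCircuit.init 7 x) t := by
  classical
  simp only [entanglingLayer_apply_init, constantOn_xor (hl.constantOn_flips q)]
  split_ifs with ht
  · rw [hl.prod_signs_eq_one hq ht, one_mul]
  · rw [mul_zero]

theorem Grid.IsStar.prod_outcomes_eq (hl : Grid.IsStar l) {q : Fin 3 → ZMod 2}
    (hq : q ∈ ghzQueries) (z : QWire N 7 → Bool) :
    ∏ v, (starSymbol l q v).outcome (starQuery l q v) (fun k => z (v, k)) =
      zsgn (∑ j, (Planting.answer (fun v k => z (v, Sum.inl k)) (l j) -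
        cor (Planting.rotation (fun v k => z (v, Sum.inl k)) (l j)) (pauliLabel (q j))) +
          ghzTarget q) := by
  rw [hl.prod_starSymbol q (fun s q v => s.outcome q fun k => z (v, k)) (fun _ _ => rfl)]
  simp only [prod_outcomes (hl.isPath _) (hl.one_lt _), Finset.prod_mul_distrib,
    prod_ghz_phases hq, zsgn_add, Fin.prod_univ_three, Fin.sum_univ_three]

/-- The state after the entangling layer is stabilized by the flips along the star, and the
measurements turn this symmetry into a parity constraint on the outcomes. -/
theorem Grid.IsStar.ghzRotatedWin (hl : Grid.IsStar l) {q : Fin 3 → ZMod 2}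
    (hq : q ∈ ghzQueries) {x : Grid N → Letter}
    (hx : ∀ j, ∀ v ∈ l j, x v = (pathSymbol (l j) j (q j) v).code) {z : QWire N 7 → Bool}
    (hz : (teleportCircuit N).finalState x z ≠ 0) :
    ghzRotatedWin q (fun j => Planting.answer (fun v k => z (v, Sum.inl k)) (l j))
      (fun j => Planting.rotation (fun v k => z (v, Sum.inl k)) (l j)) := by
  have hprod := prod_eq_one_of_vertexLayer_apply_ne_zero VertexGate.mat_isUnitary (x := x)
    (fun v z t ht => VertexSymbol.mat_flips (hl.starSymbol_admissible q v) z
      ((hl.starSymbol_eq_blank_or hx v).imp_right (funext ht).trans))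
    entanglingLayer_apply_init_inl (hl.entanglingLayer_apply_init_xor_flips hq x) hz
  rwa [hl.prod_outcomes_eq hq, zsgn_eq_one_iff, ← ZMod.neg_eq_self_mod_two (ghzTarget q),
    ← sub_eq_add_neg, sub_eq_zero] at hprod

end Star

namespace Planting

variable {κ N r L : ℕ}

theorem block_subset_square (P : Planting κ N r L) (i : Fin r) (t : Fin P.T) :
    Grid.block N (P.anchor i t) (2 * L + 1) ⊆ Grid.block N (P.corner i) (squareSide N r) := by
  intro v hv
  obtain ⟨⟨h1, h2⟩, h3, h4⟩ := P.box_in_square i t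
  obtain ⟨⟨h5, h6⟩, h7, h8⟩ := hv
  refine ⟨⟨?_, ?_⟩, ?_, ?_⟩ <;> omega

theorem path_subset_square (P : Planting κ N r L) (c : P.Instance) (i : Fin r) (j : Fin 3)
    {v : Grid N} (hv : v ∈ P.path c i j) :
    v ∈ Grid.block N (P.corner i) (squareSide N r) := by
  unfold path at hv
  rw [List.mem_append, List.mem_append] at hv
  rcases hv with (hv | hv) | hv
  · exact P.block_subset_square i _ (P.hub_in_box _ _ _ _ v hv)
  · obtain ⟨a, mid, w, h, ha, hw, hmid⟩ := P.arm_spec i (c i).1 (c i).2.2.1 j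
    rw [h, List.mem_cons, List.mem_append, List.mem_singleton] at hv
    rcases hv with rfl | hv | rfl
    · exact P.block_subset_square i _ ha
    · exact (hmid v hv).1
    · exact P.block_subset_square i _ hw
  · exact P.block_subset_square i _ (P.tail_in_box _ _ _ _ _ v hv)

theorem encode_eq (P : Planting κ N r L) (c : P.Instance) {i : Fin r} {j : Fin 3} {v : Grid N}
    (hv : v ∈ P.path c i j) :
    P.encode c v = (pathSymbol (P.path c i j) j (P.query c i j) v).code := by
  have h : ∃ p : Fin r × Fin 3, v ∈ P.path c p.1 p.2 := ⟨(i, j), hv⟩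
  have hp : h.choose = (i, j) := by
    have hspec := h.choose_spec
    have hi : h.choose.1 = i := by
      by_contra hne
      exact Set.disjoint_left.1 (P.squares_disjoint hne) (P.path_subset_square c _ _ hspec)
        (P.path_subset_square c _ _ hv)
    rw [hi] at hspec
    refine Prod.ext hi ?_
    by_contra hne
    exact P.paths_disjoint i _ _ _ _ _ _ hne hspec hv
  unfold encode
  rw [dif_pos h, hp]

theorem winProb_teleportCircuit (P : Planting κ N r L)
    (h : ∀ c i, Grid.IsStar fun j => P.path c i j) :
    P.game.winProb (teleportCircuit N).behavior = 1 :=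
  P.winProb_eq_one _ fun c _ hz i => (h c i).ghzRotatedWin (c i).2.2.2.2
    (fun _ _ hv => P.encode_eq c hv) hz

end Planting

/-! ### Rectilinear routes in the plane -/

/-- The numbers from `a` (exclusive) to `b` (inclusive), in the order of a walk. -/
def steps (a b : ℕ) : List ℕ :=
  if a ≤ b then List.range' (a + 1) (b - a) else (List.range' b (a - b)).reverse

theorem mem_steps {a b k : ℕ} : k ∈ steps a b ↔ a < k ∧ k ≤ b ∨ b ≤ k ∧ k < a := by
  unfold steps
  split_ifs with h
  · rw [List.mem_range'_1]; omega
  · rw [List.mem_reverse, List.mem_range'_1]; omega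

theorem nodup_steps (a b : ℕ) : (steps a b).Nodup := by
  unfold steps
  split_ifs
  · exact List.nodup_range'
  · exact List.nodup_reverse.2 List.nodup_range'

theorem length_steps (a b : ℕ) : (steps a b).length = (b - a) + (a - b) := by
  unfold steps
  split_ifs with h
  · rw [List.length_range']; omega
  · rw [List.length_reverse, List.length_range']; omega

theorem steps_self (a : ℕ) : steps a a = [] := by simp [steps]

theorem steps_of_lt {a b : ℕ} (h : a < b) : steps a b = (a + 1) :: steps (a + 1) b := by
  obtain ⟨m, rfl⟩ : ∃ m, b = a + 1 + m := ⟨b - (a + 1), by omega⟩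
  unfold steps
  rw [if_pos (by omega), if_pos (by omega), show a + 1 + m - a = m + 1 by omega,
    show a + 1 + m - (a + 1) = m by omega, List.range'_succ]

theorem steps_of_gt {a b : ℕ} (h : b < a) : steps a b = (a - 1) :: steps (a - 1) b := by
  obtain ⟨m, rfl⟩ : ∃ m, a = b + m + 1 := ⟨a - (b + 1), by omega⟩
  have h1 : steps (b + m + 1) b = (b + m) :: (List.range' b m).reverse := by
    unfold steps
    rw [if_neg (by omega), show b + m + 1 - b = m + 1 by omega, List.range'_1_concat,
      List.reverse_append]
    rfl
  rw [h1, Nat.add_sub_cancel]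
  congr 1
  rcases Nat.eq_zero_or_pos m with rfl | hm
  · simp [steps_self]
  · unfold steps
    rw [if_neg (by omega), show b + m - b = m by omega]

/-- Neighbors in the plane. -/
def PlaneAdj (v w : ℕ × ℕ) : Prop :=
  (v.2 = w.2 ∧ (v.1 + 1 = w.1 ∨ w.1 + 1 = v.1)) ∨ (v.1 = w.1 ∧ (v.2 + 1 = w.2 ∨ w.2 + 1 = v.2))

/-- The list `l` describes a walk from `p` to `p'`, not counting `p`. -/
inductive Walks : ℕ × ℕ → List (ℕ × ℕ) → ℕ × ℕ → Prop
  | nil (p : ℕ × ℕ) : Walks p [] p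
  | cons {p p₁ p' : ℕ × ℕ} {l : List (ℕ × ℕ)} :
      PlaneAdj p p₁ → Walks p₁ l p' → Walks p (p₁ :: l) p'

theorem Walks.append {p p' p'' : ℕ × ℕ} {l l' : List (ℕ × ℕ)} (h : Walks p l p')
    (h' : Walks p' l' p'') : Walks p (l ++ l') p'' := by
  induction h with
  | nil => exact h'
  | cons ha _ ih => exact Walks.cons ha (ih h')

theorem Walks.isChain {p p' : ℕ × ℕ} {l : List (ℕ × ℕ)} (h : Walks p l p') :
    (p :: l).IsChain PlaneAdj := by
  induction h with
  | nil => exact List.isChain_singleton _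
  | cons ha _ ih => exact List.isChain_cons_cons.2 ⟨ha, ih⟩

theorem Walks.getLast? {p p' : ℕ × ℕ} {l : List (ℕ × ℕ)} (h : Walks p l p') :
    (p :: l).getLast? = some p' := by
  induction h with
  | nil => rfl
  | cons _ _ ih => rwa [List.getLast?_cons_cons]

/-- A horizontal walk. -/
def hwalk (y a b : ℕ) : List (ℕ × ℕ) := (steps a b).map fun x => (x, y)

/-- A vertical walk. -/
def vwalk (x a b : ℕ) : List (ℕ × ℕ) := (steps a b).map fun y => (x, y)

theorem walks_hwalk (y a b : ℕ) : Walks (a, y) (hwalk y a b) (b, y) := by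
  unfold hwalk
  induction hd : (b - a) + (a - b) generalizing a with
  | zero =>
    obtain rfl : a = b := by omega
    rw [steps_self]
    exact Walks.nil _
  | succ d ih =>
    rcases Nat.lt_or_ge a b with h | h
    · rw [steps_of_lt h]
      exact Walks.cons (Or.inl ⟨rfl, Or.inl rfl⟩) (ih _ (by omega))
    · rw [steps_of_gt (by omega)]
      exact Walks.cons (Or.inl ⟨rfl, Or.inr (by dsimp only; omega)⟩) (ih _ (by omega))

theorem walks_vwalk (x a b : ℕ) : Walks (x, a) (vwalk x a b) (x, b) := by
  unfold vwalk
  induction hd : (b - a) + (a - b) generalizing a with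
  | zero =>
    obtain rfl : a = b := by omega
    rw [steps_self]
    exact Walks.nil _
  | succ d ih =>
    rcases Nat.lt_or_ge a b with h | h
    · rw [steps_of_lt h]
      exact Walks.cons (Or.inr ⟨rfl, Or.inl rfl⟩) (ih _ (by omega))
    · rw [steps_of_gt (by omega)]
      exact Walks.cons (Or.inr ⟨rfl, Or.inr (by dsimp only; omega)⟩) (ih _ (by omega))

theorem mem_hwalk {y a b : ℕ} {p : ℕ × ℕ} :
    p ∈ hwalk y a b ↔ p.2 = y ∧ (a < p.1 ∧ p.1 ≤ b ∨ b ≤ p.1 ∧ p.1 < a) := by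
  obtain ⟨x, y'⟩ := p
  simp only [hwalk, List.mem_map, mem_steps, Prod.mk.injEq]
  constructor
  · rintro ⟨k, hk, rfl, rfl⟩
    exact ⟨rfl, hk⟩
  · rintro ⟨rfl, hk⟩
    exact ⟨x, hk, rfl, rfl⟩

theorem mem_vwalk {x a b : ℕ} {p : ℕ × ℕ} :
    p ∈ vwalk x a b ↔ p.1 = x ∧ (a < p.2 ∧ p.2 ≤ b ∨ b ≤ p.2 ∧ p.2 < a) := by
  obtain ⟨x', y⟩ := p
  simp only [vwalk, List.mem_map, mem_steps, Prod.mk.injEq]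
  constructor
  · rintro ⟨k, hk, rfl, rfl⟩
    exact ⟨rfl, hk⟩
  · rintro ⟨rfl, hk⟩
    exact ⟨y, hk, rfl, rfl⟩

theorem nodup_hwalk (y a b : ℕ) : (hwalk y a b).Nodup :=
  (nodup_steps a b).map fun _ _ h => (Prod.ext_iff.1 h).1

theorem nodup_vwalk (x a b : ℕ) : (vwalk x a b).Nodup :=
  (nodup_steps a b).map fun _ _ h => (Prod.ext_iff.1 h).2

theorem length_hwalk (y a b : ℕ) : (hwalk y a b).length = (b - a) + (a - b) := by
  rw [hwalk, List.length_map, length_steps]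

theorem length_vwalk (x a b : ℕ) : (vwalk x a b).length = (b - a) + (a - b) := by
  rw [vwalk, List.length_map, length_steps]

/-! ### Stars between four boxes on an antidiagonal -/

namespace Layout

/-- The leftmost column of the `t`-th box of the square whose leftmost column is `x`. -/
def boxX (q x t : ℕ) : ℕ := x + t * (6 * q + 1)

/-- The lowest row of the `t`-th box of the square whose lowest row is `y`. -/
def boxY (q y t : ℕ) : ℕ := y + (3 - t) * (6 * q + 1)

/-- The row in which the path of the `s`-th star from the box `b` to the box `t` leaves `b`. -/
def exitRow (q y b s t : ℕ) : ℕ := boxY q y b + t * q + s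

/-- The median of the boxes other than `b`. -/
def median (b : ℕ) : ℕ := if b ≤ 1 then 2 else 1

/-- The position of the box `t` among the boxes other than `b`. -/
def rank (b t : ℕ) : ℕ := if t < median b then 0 else if t = median b then 1 else 2

/-- The lowest row of the three hub vertices. -/
def hubRow (q y b s : ℕ) : ℕ := exitRow q y b s (median b) - 1

/-- The column of the hub vertices. -/
def hubCol (q x b : ℕ) : ℕ := boxX q x b + 3 * q

/-- The last column before the boundary of the box `b`, on the way to the box `t`. -/
def innerCol (q x b t : ℕ) : ℕ := if b < t then boxX q x b + 6 * q - 1 else boxX q x b + 1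

/-- The column in which the box `b` is left on the way to the box `t`. -/
def exitCol (q x b t : ℕ) : ℕ := if b < t then boxX q x b + 6 * q else boxX q x b

/-- The last row before the box `t`, coming from the box `b`. -/
def outerRow (q y b t : ℕ) : ℕ := if b < t then boxY q y t + 6 * q + 1 else boxY q y t - 1

/-- The row in which the box `t` is entered, coming from the box `b`. -/
def entryRow (q y b t : ℕ) : ℕ := if b < t then boxY q y t + 6 * q else boxY q y t

/-- The column in which the `s`-th star enters the box `t`. -/
def entryCol (q x s t : ℕ) : ℕ := boxX q x t + s

/-- The part of a path in the central box, except for its last vertex. -/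
def hub (q x y b s t : ℕ) : List (ℕ × ℕ) :=
  (hubCol q x b, hubRow q y b s + rank b t) ::
    (vwalk (hubCol q x b) (hubRow q y b s + rank b t) (exitRow q y b s t) ++
      hwalk (exitRow q y b s t) (hubCol q x b) (innerCol q x b t))

/-- The part of a path between the boxes. -/
def bridge (q x y b s t : ℕ) : List (ℕ × ℕ) :=
  hwalk (exitRow q y b s t) (exitCol q x b t) (entryCol q x s t) ++
    vwalk (entryCol q x s t) (exitRow q y b s t) (outerRow q y b t)

/-- A path from box to box. -/
def arm (q x y b s t : ℕ) : List (ℕ × ℕ) :=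
  (exitCol q x b t, exitRow q y b s t) ::
    (bridge q x y b s t ++ [(entryCol q x s t, entryRow q y b t)])

/-- The part of a path in the last box, except for its first vertex. -/
def tail (q x y b s t o₁ o₂ : ℕ) : List (ℕ × ℕ) :=
  vwalk (entryCol q x s t) (entryRow q y b t) (boxY q y t + o₂) ++
    hwalk (boxY q y t + o₂) (entryCol q x s t) (boxX q x t + o₁)

/-- The path of the `s`-th star from the hub in the box `b` to the input location at position
`(o₁, o₂)` of the box `t`. -/
def path (q x y b s t o₁ o₂ : ℕ) : List (ℕ × ℕ) :=
  hub q x y b s t ++ arm q x y b s t ++ tail q x y b s t o₁ o₂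

/-- The points of the square with lowest corner `(x, y)`. -/
def InSquare (q x y : ℕ) (p : ℕ × ℕ) : Prop :=
  (x ≤ p.1 ∧ p.1 < x + 4 * (6 * q + 1)) ∧ (y ≤ p.2 ∧ p.2 < y + 4 * (6 * q + 1))

/-- The points of the `t`-th box of the square with lowest corner `(x, y)`. -/
def InBox (q x y t : ℕ) (p : ℕ × ℕ) : Prop :=
  (boxX q x t ≤ p.1 ∧ p.1 < boxX q x t + (6 * q + 1)) ∧
    (boxY q y t ≤ p.2 ∧ p.2 < boxY q y t + (6 * q + 1))

/-- The parameters for which the path of the `s`-th star from the box `b` to the box `t` is used. -/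
structure IsRoute (q b s t : ℕ) : Prop where
  source_lt : b < 4
  target_lt : t < 4
  ne : b ≠ t
  star_lt : s < q

theorem box_order (q x y : ℕ) {b t : ℕ} (hb : b < 4) (ht : t < 4) (hbt : b ≠ t) :
    (b < t ∧ boxX q x b + (6 * q + 1) ≤ boxX q x t ∧ boxY q y t + (6 * q + 1) ≤ boxY q y b) ∨
    (t < b ∧ boxX q x t + (6 * q + 1) ≤ boxX q x b ∧ boxY q y b + (6 * q + 1) ≤ boxY q y t) := by
  unfold boxX boxY
  interval_cases b <;> interval_cases t <;> omega

theorem box_bounds (q x y : ℕ) {t : ℕ} (ht : t < 4) :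
    x ≤ boxX q x t ∧ boxX q x t + (6 * q + 1) ≤ x + 4 * (6 * q + 1) ∧
      y ≤ boxY q y t ∧ boxY q y t + (6 * q + 1) ≤ y + 4 * (6 * q + 1) := by
  unfold boxX boxY
  interval_cases t <;> omega

theorem inSquare_of_inBox {q x y t : ℕ} (ht : t < 4) {p : ℕ × ℕ} (hp : InBox q x y t p) :
    InSquare q x y p := by
  have hbounds := box_bounds q x y ht
  unfold InBox at hp
  unfold InSquare
  omega

theorem inBox_unique {q x y t t' : ℕ} (ht : t < 4) (ht' : t' < 4) {p : ℕ × ℕ}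
    (hp : InBox q x y t p) (hp' : InBox q x y t' p) : t = t' := by
  by_contra hne
  have horder := box_order q x y ht ht' hne
  unfold InBox at hp hp'
  omega

theorem exitRow_bounds (q y b : ℕ) {s t : ℕ} (hs : s < q) (ht : t < 4) :
    boxY q y b ≤ exitRow q y b s t ∧ exitRow q y b s t + 2 * q + 1 ≤ boxY q y b + 6 * q := by
  unfold exitRow
  interval_cases t <;> omega

theorem exitRow_lt (q y b : ℕ) {s s' t t' : ℕ} (hs : s < q) (ht : t < 4) (ht' : t' < 4)
    (h : t < t') : exitRow q y b s t < exitRow q y b s' t' := by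
  unfold exitRow
  interval_cases t <;> interval_cases t' <;> omega

theorem exitRow_add_le (q y b s : ℕ) {t t' : ℕ} (ht : t < 4) (ht' : t' < 4)
    (h : t < t') : exitRow q y b s t + q ≤ exitRow q y b s t' := by
  unfold exitRow
  interval_cases t <;> interval_cases t' <;> omega

theorem exitRow_ne (q y b : ℕ) {s t t' : ℕ} (hs : s < q) (ht : t < 4) (ht' : t' < 4)
    (h : t ≠ t') : exitRow q y b s t ≠ exitRow q y b s t' := by
  rcases Nat.lt_or_gt_of_ne h with h | h
  · exact (exitRow_lt q y b hs ht ht' h).ne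
  · exact (exitRow_lt q y b hs ht' ht h).ne'

theorem one_le_exitRow_median (q y b s : ℕ) (hq : 1 ≤ q) :
    boxY q y b + 1 ≤ exitRow q y b s (median b) := by
  unfold exitRow median
  split_ifs <;> omega

theorem median_lt (b : ℕ) : median b < 4 := by
  unfold median
  split_ifs <;> omega

theorem rank_lt (b t : ℕ) : rank b t < 3 := by
  unfold rank
  split_ifs <;> omega

theorem rank_injOn {b t t' : ℕ} (hb : b < 4) (ht : t < 4) (ht' : t' < 4) (hbt : b ≠ t)
    (hbt' : b ≠ t') (h : rank b t = rank b t') : t = t' := by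
  unfold rank median at h
  split_ifs at h <;> omega

variable {q x y b s t : ℕ}

theorem mem_hub {p : ℕ × ℕ} : p ∈ hub q x y b s t ↔
    (p.1 = hubCol q x b ∧ (hubRow q y b s + rank b t ≤ p.2 ∧ p.2 ≤ exitRow q y b s t ∨
      exitRow q y b s t ≤ p.2 ∧ p.2 ≤ hubRow q y b s + rank b t)) ∨
    (p.2 = exitRow q y b s t ∧ (hubCol q x b < p.1 ∧ p.1 ≤ innerCol q x b t ∨
      innerCol q x b t ≤ p.1 ∧ p.1 < hubCol q x b)) := by
  unfold hub
  rw [List.mem_cons, List.mem_append, mem_vwalk, mem_hwalk, Prod.ext_iff]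
  omega

theorem mem_bridge {p : ℕ × ℕ} : p ∈ bridge q x y b s t ↔
    (p.2 = exitRow q y b s t ∧ (exitCol q x b t < p.1 ∧ p.1 ≤ entryCol q x s t ∨
      entryCol q x s t ≤ p.1 ∧ p.1 < exitCol q x b t)) ∨
    (p.1 = entryCol q x s t ∧ (exitRow q y b s t < p.2 ∧ p.2 ≤ outerRow q y b t ∨
      outerRow q y b t ≤ p.2 ∧ p.2 < exitRow q y b s t)) := by
  unfold bridge
  rw [List.mem_append, mem_vwalk, mem_hwalk]

theorem mem_arm {p : ℕ × ℕ} : p ∈ arm q x y b s t ↔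
    p = (exitCol q x b t, exitRow q y b s t) ∨ p ∈ bridge q x y b s t ∨
      p = (entryCol q x s t, entryRow q y b t) := by
  unfold arm
  rw [List.mem_cons, List.mem_append, List.mem_singleton]

theorem mem_tail {p : ℕ × ℕ} {o₁ o₂ : ℕ} : p ∈ tail q x y b s t o₁ o₂ ↔
    (p.1 = entryCol q x s t ∧ (entryRow q y b t < p.2 ∧ p.2 ≤ boxY q y t + o₂ ∨
      boxY q y t + o₂ ≤ p.2 ∧ p.2 < entryRow q y b t)) ∨
    (p.2 = boxY q y t + o₂ ∧ (entryCol q x s t < p.1 ∧ p.1 ≤ boxX q x t + o₁ ∨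
      boxX q x t + o₁ ≤ p.1 ∧ p.1 < entryCol q x s t)) := by
  unfold tail
  rw [List.mem_append, mem_vwalk, mem_hwalk]

theorem mem_path {p : ℕ × ℕ} {o₁ o₂ : ℕ} : p ∈ path q x y b s t o₁ o₂ ↔
    p ∈ hub q x y b s t ∨ p ∈ arm q x y b s t ∨ p ∈ tail q x y b s t o₁ o₂ := by
  unfold path
  rw [List.mem_append, List.mem_append, or_assoc]

theorem nodup_hub : (hub q x y b s t).Nodup := by
  refine List.nodup_cons.2 ⟨fun hp => ?_, (nodup_vwalk _ _ _).append (nodup_hwalk _ _ _)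
    fun p hp hp' => ?_⟩
  · rw [List.mem_append, mem_vwalk, mem_hwalk] at hp
    omega
  · rw [mem_vwalk] at hp
    rw [mem_hwalk] at hp'
    omega

theorem nodup_bridge : (bridge q x y b s t).Nodup := by
  refine (nodup_hwalk _ _ _).append (nodup_vwalk _ _ _) fun p hp hp' => ?_
  rw [mem_hwalk] at hp
  rw [mem_vwalk] at hp'
  omega

theorem nodup_tail {o₁ o₂ : ℕ} : (tail q x y b s t o₁ o₂).Nodup := by
  refine (nodup_vwalk _ _ _).append (nodup_hwalk _ _ _) fun p hp hp' => ?_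
  rw [mem_vwalk] at hp
  rw [mem_hwalk] at hp'
  omega

theorem hub_cases (y b s : ℕ) (ht : t < 4) (hq : 1 ≤ q) :
    (t < median b ∧ rank b t = 0 ∧ exitRow q y b s t + q ≤ hubRow q y b s + 1) ∨
    (t = median b ∧ rank b t = 1 ∧ exitRow q y b s t = hubRow q y b s + 1) ∨
    (median b < t ∧ rank b t = 2 ∧ hubRow q y b s + 1 + q ≤ exitRow q y b s t) := by
  have hrow : hubRow q y b s + 1 = exitRow q y b s (median b) := by
    have := one_le_exitRow_median q y b s hq
    unfold hubRow
    omega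
  rw [hrow]
  rcases lt_trichotomy t (median b) with h | h | h
  · exact Or.inl ⟨h, by rw [rank, if_pos h], exitRow_add_le q y b s ht (median_lt b) h⟩
  · exact Or.inr (Or.inl ⟨h, by rw [rank, if_neg (by omega), if_pos h], by rw [h]⟩)
  · exact Or.inr (Or.inr ⟨h, by rw [rank, if_neg (by omega), if_neg (by omega)],
      exitRow_add_le q y b s (median_lt b) ht h⟩)

theorem hubRow_bounds (y b : ℕ) (hs : s < q) :
    boxY q y b ≤ hubRow q y b s ∧ hubRow q y b s + 2 * q + 2 ≤ boxY q y b + 6 * q := by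
  have hmedian := one_le_exitRow_median q y b s (by omega)
  have hexit := exitRow_bounds q y b hs (median_lt b)
  unfold hubRow
  omega

namespace IsRoute

variable {o₁ o₂ : ℕ}

theorem cases (h : IsRoute q b s t) (x y : ℕ) :
    (b < t ∧ boxX q x b + (6 * q + 1) ≤ boxX q x t ∧ boxY q y t + (6 * q + 1) ≤ boxY q y b ∧
      innerCol q x b t = boxX q x b + 6 * q - 1 ∧ exitCol q x b t = boxX q x b + 6 * q ∧
      outerRow q y b t = boxY q y t + 6 * q + 1 ∧ entryRow q y b t = boxY q y t + 6 * q) ∨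
    (t < b ∧ boxX q x t + (6 * q + 1) ≤ boxX q x b ∧ boxY q y b + (6 * q + 1) ≤ boxY q y t ∧
      innerCol q x b t = boxX q x b + 1 ∧ exitCol q x b t = boxX q x b ∧
      outerRow q y b t = boxY q y t - 1 ∧ entryRow q y b t = boxY q y t) := by
  rcases box_order q x y h.source_lt h.target_lt h.ne with ⟨hbt, hX, hY⟩ | ⟨htb, hX, hY⟩
  · exact Or.inl ⟨hbt, hX, hY, if_pos hbt, if_pos hbt, if_pos hbt, if_pos hbt⟩
  · exact Or.inr ⟨htb, hX, hY, if_neg htb.not_gt, if_neg htb.not_gt, if_neg htb.not_gt,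
      if_neg htb.not_gt⟩

theorem exitRow_bounds (h : IsRoute q b s t) (y : ℕ) :
    boxY q y b ≤ exitRow q y b s t ∧ exitRow q y b s t + 2 * q + 1 ≤ boxY q y b + 6 * q :=
  Layout.exitRow_bounds q y b h.star_lt h.target_lt

theorem hub_cases (h : IsRoute q b s t) (y : ℕ) :
    (t < median b ∧ rank b t = 0 ∧ exitRow q y b s t + q ≤ hubRow q y b s + 1) ∨
    (t = median b ∧ rank b t = 1 ∧ exitRow q y b s t = hubRow q y b s + 1) ∨
    (median b < t ∧ rank b t = 2 ∧ hubRow q y b s + 1 + q ≤ exitRow q y b s t) :=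
  Layout.hub_cases y b s h.target_lt (Nat.one_le_of_lt h.star_lt)

theorem inBox_of_mem_hub (h : IsRoute q b s t) {p : ℕ × ℕ} (hp : p ∈ hub q x y b s t) :
    InBox q x y b p := by
  have hroute := h.cases x y
  have hexit := h.exitRow_bounds y
  have hrow := hubRow_bounds y b h.star_lt
  have hhub := h.hub_cases y
  rw [mem_hub] at hp
  unfold hubCol at hp
  unfold InBox
  omega

theorem inBox_of_mem_tail (h : IsRoute q b s t) (ho₁ : o₁ ≤ 6 * q) (ho₂ : o₂ ≤ 6 * q)
    {p : ℕ × ℕ} (hp : p ∈ tail q x y b s t o₁ o₂) : InBox q x y t p := by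
  have hroute := h.cases x y
  have hs := h.star_lt
  rw [mem_tail] at hp
  unfold entryCol at hp
  unfold InBox
  omega

theorem inBox_exit (h : IsRoute q b s t) (x y : ℕ) :
    InBox q x y b (exitCol q x b t, exitRow q y b s t) := by
  have hroute := h.cases x y
  have hexit := h.exitRow_bounds y
  unfold InBox
  dsimp only
  omega

theorem inBox_entry (h : IsRoute q b s t) (x y : ℕ) :
    InBox q x y t (entryCol q x s t, entryRow q y b t) := by
  have hroute := h.cases x y
  have hs := h.star_lt
  unfold InBox entryCol
  dsimp only
  omega

theorem not_inBox_of_mem_bridge (h : IsRoute q b s t) {p : ℕ × ℕ}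
    (hp : p ∈ bridge q x y b s t) {t' : ℕ} (ht' : t' < 4) : ¬ InBox q x y t' p := by
  have hroute := h.cases x y
  have hexit := h.exitRow_bounds y
  have hs := h.star_lt
  have hsource : t' = b ∨ _ := or_iff_not_imp_left.2 fun hne => box_order q x y ht' h.source_lt hne
  have htarget : t' = t ∨ _ := or_iff_not_imp_left.2 fun hne => box_order q x y ht' h.target_lt hne
  rw [mem_bridge] at hp
  unfold entryCol at hp
  unfold InBox
  rcases hsource with rfl | hsource
  · omega
  · rcases htarget with rfl | htarget
    · omega
    · omega

theorem inSquare_of_mem_bridge (h : IsRoute q b s t) {p : ℕ × ℕ}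
    (hp : p ∈ bridge q x y b s t) : InSquare q x y p := by
  have hroute := h.cases x y
  have hexit := h.exitRow_bounds y
  have hs := h.star_lt
  have hsource := box_bounds q x y h.source_lt
  have htarget := box_bounds q x y h.target_lt
  rw [mem_bridge] at hp
  unfold entryCol at hp
  unfold InSquare
  omega

theorem not_inBox_target (h : IsRoute q b s t) {p : ℕ × ℕ} (hp : InBox q x y b p) :
    ¬InBox q x y t p :=
  fun hp' => h.ne (inBox_unique h.source_lt h.target_lt hp hp')

theorem exit_eq_of_mem_arm_of_inBox (h : IsRoute q b s t) {p : ℕ × ℕ}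
    (hp : p ∈ arm q x y b s t) (hbox : InBox q x y b p) :
    p = (exitCol q x b t, exitRow q y b s t) := by
  rcases mem_arm.1 hp with hp | hp | rfl
  · exact hp
  · exact absurd hbox (h.not_inBox_of_mem_bridge hp h.source_lt)
  · exact (h.not_inBox_target hbox (h.inBox_entry x y)).elim

theorem entry_eq_of_mem_arm_of_inBox (h : IsRoute q b s t) {t' : ℕ} (ht' : t' < 4)
    (hbt' : b ≠ t') {p : ℕ × ℕ} (hp : p ∈ arm q x y b s t) (hbox : InBox q x y t' p) :
    t' = t ∧ p = (entryCol q x s t, entryRow q y b t) := by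
  rcases mem_arm.1 hp with rfl | hp | rfl
  · exact absurd (inBox_unique h.source_lt ht' (h.inBox_exit x y) hbox) hbt'
  · exact absurd hbox (h.not_inBox_of_mem_bridge hp ht')
  · exact ⟨inBox_unique ht' h.target_lt hbox (h.inBox_entry x y), rfl⟩

theorem inSquare_of_mem_path (h : IsRoute q b s t) (ho₁ : o₁ ≤ 6 * q) (ho₂ : o₂ ≤ 6 * q)
    {p : ℕ × ℕ} (hp : p ∈ path q x y b s t o₁ o₂) : InSquare q x y p := by
  rcases mem_path.1 hp with hp | hp | hp
  · exact inSquare_of_inBox h.source_lt (h.inBox_of_mem_hub hp)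
  · rcases mem_arm.1 hp with rfl | hp | rfl
    · exact inSquare_of_inBox h.source_lt (h.inBox_exit x y)
    · exact h.inSquare_of_mem_bridge hp
    · exact inSquare_of_inBox h.target_lt (h.inBox_entry x y)
  · exact inSquare_of_inBox h.target_lt (h.inBox_of_mem_tail ho₁ ho₂ hp)

theorem disjoint_hub {t' : ℕ} (h : IsRoute q b s t) (h' : IsRoute q b s t') (htt : t < t') :
    (hub q x y b s t).Disjoint (hub q x y b s t') := by
  intro p hp hp'
  have hexit := h.exitRow_bounds y
  have hhub := h.hub_cases y
  have hhub' := h'.hub_cases y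
  have hrows := exitRow_lt q y b (s' := s) h.star_lt h.target_lt h'.target_lt htt
  have hmedian : t ≤ median b ∧ median b ≤ t' := by
    have hb := h.source_lt
    have hne := h.ne
    have hne' := h'.ne
    have ht' := h'.target_lt
    unfold median
    split_ifs <;> omega
  rw [mem_hub] at hp hp'
  omega

theorem disjoint_arm_of_lt {s' t' : ℕ} (h : IsRoute q b s t) (h' : IsRoute q b s' t')
    (htt : t < t') : (arm q x y b s t).Disjoint (arm q x y b s' t') := by
  intro p hp hp'
  have hroute := h.cases x y
  have hroute' := h'.cases x y
  have hexit := h.exitRow_bounds y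
  have hexit' := h'.exitRow_bounds y
  have hs := h.star_lt
  have hs' := h'.star_lt
  have hrows := exitRow_lt q y b (s' := s') hs h.target_lt h'.target_lt htt
  have horder := box_order q x y h.target_lt h'.target_lt htt.ne
  rw [mem_arm, mem_bridge, Prod.ext_iff, Prod.ext_iff] at hp hp'
  unfold entryCol at hp hp'
  rcases hroute with hroute | hroute <;> rcases hroute' with hroute' | hroute' <;> omega

theorem disjoint_arm_of_star_lt {s' : ℕ} (h : IsRoute q b s t) (h' : IsRoute q b s' t)
    (hss : s < s') : (arm q x y b s t).Disjoint (arm q x y b s' t) := by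
  intro p hp hp'
  have hroute := h.cases x y
  have hexit := h.exitRow_bounds y
  have hexit' := h'.exitRow_bounds y
  have hs' := h'.star_lt
  have hrows : exitRow q y b s t + s' = exitRow q y b s' t + s := by unfold exitRow; omega
  rw [mem_arm, mem_bridge, Prod.ext_iff, Prod.ext_iff] at hp hp'
  unfold entryCol at hp hp'
  rcases hroute with hroute | hroute <;> omega

theorem disjoint_arm {s' t' : ℕ} (h : IsRoute q b s t) (h' : IsRoute q b s' t')
    (hne : s ≠ s' ∨ t ≠ t') : (arm q x y b s t).Disjoint (arm q x y b s' t') := by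
  rcases lt_trichotomy t t' with htt | rfl | htt
  · exact h.disjoint_arm_of_lt h' htt
  · rcases Nat.lt_or_gt_of_ne (hne.resolve_right (not_not.2 rfl)) with hss | hss
    · exact h.disjoint_arm_of_star_lt h' hss
    · exact (h'.disjoint_arm_of_star_lt h hss).symm
  · exact (h'.disjoint_arm_of_lt h htt).symm

theorem disjoint_hub_arm {t' : ℕ} (h : IsRoute q b s t) (h' : IsRoute q b s t') :
    (hub q x y b s t).Disjoint (arm q x y b s t') := by
  intro p hp hp'
  have hexit := h'.exit_eq_of_mem_arm_of_inBox hp' (h.inBox_of_mem_hub hp)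
  have hroute := h.cases x y
  have hroute' := h'.cases x y
  have hbounds := h.exitRow_bounds y
  rw [hexit, mem_hub] at hp
  unfold hubCol at hp
  dsimp only at hp
  rcases eq_or_ne t t' with rfl | htt
  · omega
  · have hrows := exitRow_ne q y b h.star_lt h.target_lt h'.target_lt htt
    omega

theorem disjoint_hub_tail {t' : ℕ} (h : IsRoute q b s t) (h' : IsRoute q b s t')
    (ho₁ : o₁ ≤ 6 * q) (ho₂ : o₂ ≤ 6 * q) :
    (hub q x y b s t).Disjoint (tail q x y b s t' o₁ o₂) := fun _ hp hp' =>
  h'.not_inBox_target (h.inBox_of_mem_hub hp) (h'.inBox_of_mem_tail ho₁ ho₂ hp')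

theorem disjoint_arm_tail {t' : ℕ} (h : IsRoute q b s t) (h' : IsRoute q b s t')
    (ho₁ : o₁ ≤ 6 * q) (ho₂ : o₂ ≤ 6 * q) :
    (arm q x y b s t).Disjoint (tail q x y b s t' o₁ o₂) := by
  intro p hp hp'
  obtain ⟨rfl, rfl⟩ := h.entry_eq_of_mem_arm_of_inBox h'.target_lt h'.ne hp
    (h'.inBox_of_mem_tail ho₁ ho₂ hp')
  rw [mem_tail] at hp'
  dsimp only at hp'
  omega

theorem disjoint_tail {t' o₁' o₂' : ℕ} (h : IsRoute q b s t) (h' : IsRoute q b s t')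
    (htt : t ≠ t') (ho₁ : o₁ ≤ 6 * q) (ho₂ : o₂ ≤ 6 * q) (ho₁' : o₁' ≤ 6 * q)
    (ho₂' : o₂' ≤ 6 * q) :
    (tail q x y b s t o₁ o₂).Disjoint (tail q x y b s t' o₁' o₂') := fun _ hp hp' =>
  htt (inBox_unique h.target_lt h'.target_lt (h.inBox_of_mem_tail ho₁ ho₂ hp)
    (h'.inBox_of_mem_tail ho₁' ho₂' hp'))

theorem disjoint_path {t' o₁' o₂' : ℕ} (h : IsRoute q b s t) (h' : IsRoute q b s t')
    (htt : t ≠ t') (ho₁ : o₁ ≤ 6 * q) (ho₂ : o₂ ≤ 6 * q) (ho₁' : o₁' ≤ 6 * q)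
    (ho₂' : o₂' ≤ 6 * q) :
    (path q x y b s t o₁ o₂).Disjoint (path q x y b s t' o₁' o₂') := by
  have hhub : (hub q x y b s t).Disjoint (hub q x y b s t') :=
    (Nat.lt_or_gt_of_ne htt).elim (h.disjoint_hub h') fun hlt => (h'.disjoint_hub h hlt).symm
  unfold path
  simp only [List.disjoint_append_left, List.disjoint_append_right]
  exact ⟨⟨⟨⟨hhub, (h'.disjoint_hub_arm h).symm⟩, (h'.disjoint_hub_tail h ho₁ ho₂).symm⟩,
    ⟨h.disjoint_hub_arm h', h.disjoint_arm h' (Or.inr htt)⟩,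
      (h'.disjoint_arm_tail h ho₁ ho₂).symm⟩,
    ⟨h.disjoint_hub_tail h' ho₁' ho₂', h.disjoint_arm_tail h' ho₁' ho₂'⟩,
    h.disjoint_tail h' htt ho₁ ho₂ ho₁' ho₂'⟩

theorem nodup_arm (h : IsRoute q b s t) : (arm q x y b s t).Nodup := by
  refine List.nodup_cons.2 ⟨fun hp => ?_, nodup_bridge.append (List.nodup_singleton _)
    fun p hp hp' => ?_⟩
  · rcases List.mem_append.1 hp with hp | hp
    · exact h.not_inBox_of_mem_bridge hp h.source_lt (h.inBox_exit x y)
    · exact h.not_inBox_target (h.inBox_exit x y) (List.mem_singleton.1 hp ▸ h.inBox_entry x y)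
  · rw [List.mem_singleton] at hp'
    exact h.not_inBox_of_mem_bridge hp h.target_lt (hp' ▸ h.inBox_entry x y)

theorem nodup_path (h : IsRoute q b s t) (ho₁ : o₁ ≤ 6 * q) (ho₂ : o₂ ≤ 6 * q) :
    (path q x y b s t o₁ o₂).Nodup := by
  unfold path
  rw [List.nodup_append', List.nodup_append', List.disjoint_append_left]
  exact ⟨⟨nodup_hub, h.nodup_arm, h.disjoint_hub_arm h⟩, nodup_tail,
    h.disjoint_hub_tail h ho₁ ho₂, h.disjoint_arm_tail h ho₁ ho₂⟩

theorem walks_path (h : IsRoute q b s t) (x y o₁ o₂ : ℕ) :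
    ∃ l, path q x y b s t o₁ o₂ = (hubCol q x b, hubRow q y b s + rank b t) :: l ∧
      Walks (hubCol q x b, hubRow q y b s + rank b t) l (boxX q x t + o₁, boxY q y t + o₂) := by
  have hroute := h.cases x y
  have hs := h.star_lt
  unfold path hub
  rw [List.cons_append, List.cons_append, List.append_assoc]
  refine ⟨_, rfl, ((walks_vwalk _ _ _).append (walks_hwalk _ _ _)).append ?_⟩
  unfold arm tail bridge
  rw [List.cons_append, List.append_assoc, List.append_assoc]
  refine Walks.cons (Or.inl ⟨rfl, ?_⟩) ((walks_hwalk _ _ _).append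
    ((walks_vwalk _ _ _).append (Walks.cons (Or.inr ⟨rfl, ?_⟩)
      ((walks_vwalk _ _ _).append (walks_hwalk _ _ _)))))
  · dsimp only; omega
  · dsimp only; omega

theorem isChain_path (h : IsRoute q b s t) (x y o₁ o₂ : ℕ) :
    (path q x y b s t o₁ o₂).IsChain PlaneAdj := by
  obtain ⟨l, hl, hwalk⟩ := h.walks_path x y o₁ o₂
  exact hl ▸ hwalk.isChain

theorem getLast?_path (h : IsRoute q b s t) (x y o₁ o₂ : ℕ) :
    (path q x y b s t o₁ o₂).getLast? = some (boxX q x t + o₁, boxY q y t + o₂) := by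
  obtain ⟨l, hl, hwalk⟩ := h.walks_path x y o₁ o₂
  exact hl ▸ hwalk.getLast?

theorem length_arm_le (h : IsRoute q b s t) (x y : ℕ) :
    (arm q x y b s t).length ≤ 2 * (4 * (6 * q + 1)) := by
  have hroute := h.cases x y
  have hexit := h.exitRow_bounds y
  have hs := h.star_lt
  have hsource := box_bounds q x y h.source_lt
  have htarget := box_bounds q x y h.target_lt
  unfold arm bridge
  rw [List.length_cons, List.length_append, List.length_append, length_hwalk, length_vwalk,
    List.length_singleton]
  unfold entryCol
  omega

theorem length_path_le (h : IsRoute q b s t) (x y : ℕ) (ho₁ : o₁ ≤ 6 * q) (ho₂ : o₂ ≤ 6 * q) :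
    (path q x y b s t o₁ o₂).length ≤ 7 * (4 * (6 * q + 1)) := by
  have harm := h.length_arm_le x y
  have hroute := h.cases x y
  have hexit := h.exitRow_bounds y
  have hs := h.star_lt
  have hrow := hubRow_bounds y b hs
  have hhub := h.hub_cases y
  unfold path
  rw [List.length_append, List.length_append]
  unfold hub tail
  rw [List.length_cons, List.length_append, List.length_append, length_hwalk, length_hwalk,
    length_vwalk, length_vwalk]
  unfold hubCol entryCol
  omega

theorem exists_hub_eq (h : IsRoute q b s t) (x y : ℕ) (hq : 2 ≤ q) :
    ∃ p l, hub q x y b s t = (hubCol q x b, hubRow q y b s + rank b t) :: p :: l ∧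
      ((rank b t = 0 ∧ p.1 = hubCol q x b ∧ p.2 + 1 = hubRow q y b s) ∨
        (rank b t = 1 ∧ p.2 = hubRow q y b s + 1 ∧
          (p.1 = hubCol q x b + 1 ∨ p.1 + 1 = hubCol q x b)) ∨
        (rank b t = 2 ∧ p.1 = hubCol q x b ∧ p.2 = hubRow q y b s + 3)) := by
  unfold hub
  rcases h.hub_cases y with ⟨-, hr, hrow⟩ | ⟨-, hr, hrow⟩ | ⟨-, hr, hrow⟩
  · rw [hr, vwalk, steps_of_gt (by omega)]
    exact ⟨_, _, rfl, Or.inl ⟨rfl, rfl, by dsimp only; omega⟩⟩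
  · rw [hr, hrow, vwalk, steps_self, hwalk]
    rcases h.cases x y with hroute | hroute
    · rw [steps_of_lt (by unfold hubCol; omega)]
      exact ⟨_, _, rfl, Or.inr (Or.inl ⟨rfl, rfl, Or.inl rfl⟩)⟩
    · rw [steps_of_gt (by unfold hubCol; omega)]
      exact ⟨_, _, rfl, Or.inr (Or.inl ⟨rfl, rfl, Or.inr (by unfold hubCol; dsimp only; omega)⟩)⟩
  · rw [hr, vwalk, steps_of_lt (by omega)]
    exact ⟨_, _, rfl, Or.inr (Or.inr ⟨rfl, rfl, rfl⟩)⟩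

end IsRoute

end Layout

/-! ### A planting with four boxes in each square -/

namespace Layout

/-- A point of the plane as a vertex of the grid (modulo its side length). -/
def toGrid {S : ℕ} (hS : 0 < S) (p : ℕ × ℕ) : Grid S :=
  (⟨p.1 % S, Nat.mod_lt _ hS⟩, ⟨p.2 % S, Nat.mod_lt _ hS⟩)

theorem toGrid_val {S : ℕ} (hS : 0 < S) {p : ℕ × ℕ} (h1 : p.1 < S) (h2 : p.2 < S) :
    (toGrid hS p).1.val = p.1 ∧ (toGrid hS p).2.val = p.2 :=
  ⟨Nat.mod_eq_of_lt h1, Nat.mod_eq_of_lt h2⟩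

theorem toGrid_inj {S : ℕ} (hS : 0 < S) {p p' : ℕ × ℕ} (hp : p.1 < S ∧ p.2 < S)
    (hp' : p'.1 < S ∧ p'.2 < S) (h : toGrid hS p = toGrid hS p') : p = p' := by
  have h1 := toGrid_val hS hp.1 hp.2
  have h2 := toGrid_val hS hp'.1 hp'.2
  rw [h] at h1
  exact Prod.ext (h1.1.symm.trans h2.1) (h1.2.symm.trans h2.2)

theorem toGrid_mem_block_iff {S : ℕ} (hS : 0 < S) {p : ℕ × ℕ} (hp : p.1 < S ∧ p.2 < S)
    (c : ℕ × ℕ) (s : ℕ) : toGrid hS p ∈ Grid.block S c s ↔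
      (c.1 ≤ p.1 ∧ p.1 < c.1 + s) ∧ (c.2 ≤ p.2 ∧ p.2 < c.2 + s) := by
  have hval := toGrid_val hS hp.1 hp.2
  rw [Grid.block, Set.mem_ofPred_eq, hval.1, hval.2]

theorem isPath_map_toGrid {S : ℕ} (hS : 0 < S) {l : List (ℕ × ℕ)} (hnd : l.Nodup)
    (hc : l.IsChain PlaneAdj) (hl : ∀ p ∈ l, p.1 < S ∧ p.2 < S) :
    Grid.IsPath (l.map (toGrid hS)) := by
  refine ⟨hnd.map_on fun p hp p' hp' h => toGrid_inj hS (hl p hp) (hl p' hp') h, ?_⟩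
  rw [List.isChain_map]
  refine List.IsChain.imp_of_mem_imp (fun p p' hp hp' h => ?_) hc
  have h1 := toGrid_val hS (hl p hp).1 (hl p hp).2
  have h2 := toGrid_val hS (hl p' hp').1 (hl p' hp').2
  unfold Grid.Adj
  rw [Fin.ext_iff, Fin.ext_iff, h1.1, h1.2, h2.1, h2.2]
  exact h

theorem disjoint_map_toGrid {S : ℕ} (hS : 0 < S) {l l' : List (ℕ × ℕ)} (h : l.Disjoint l')
    (hl : ∀ p ∈ l, p.1 < S ∧ p.2 < S) (hl' : ∀ p ∈ l', p.1 < S ∧ p.2 < S) :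
    (l.map (toGrid hS)).Disjoint (l'.map (toGrid hS)) := by
  intro v hv hv'
  obtain ⟨p, hp, rfl⟩ := List.mem_map.1 hv
  obtain ⟨p', hp', hpp⟩ := List.mem_map.1 hv'
  rw [toGrid_inj hS (hl' p' hp') (hl p hp) hpp] at hp'
  exact h hp hp'

theorem next_toGrid {S : ℕ} (hS : 0 < S) {p p' : ℕ × ℕ} (hp : p.1 < S ∧ p.2 < S)
    (hp' : p'.1 < S ∧ p'.2 < S) :
    (p.2 = p'.2 → p'.1 + 1 = p.1 → Grid.Next Dir.left (toGrid hS p) (toGrid hS p')) ∧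
    (p.2 = p'.2 → p.1 + 1 = p'.1 → Grid.Next Dir.right (toGrid hS p) (toGrid hS p')) ∧
    (p.1 = p'.1 → p'.2 + 1 = p.2 → Grid.Next Dir.down (toGrid hS p) (toGrid hS p')) ∧
    (p.1 = p'.1 → p.2 + 1 = p'.2 → Grid.Next Dir.up (toGrid hS p) (toGrid hS p')) := by
  have hval := toGrid_val hS hp.1 hp.2
  have hval' := toGrid_val hS hp'.1 hp'.2
  simp only [Grid.Next, Fin.ext_iff, hval.1, hval.2, hval'.1, hval'.2]
  omega

/-- The side length of a grid that holds `n ^ 2` squares of side `4 * (6 * q + 1)`. -/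
def side (n q : ℕ) : ℕ := n * (4 * (6 * q + 1))

theorem side_pos {n : ℕ} (hn : 1 ≤ n) (q : ℕ) : 0 < side n q :=
  Nat.mul_pos hn (by omega)

/-- The lowest corner of the `i`-th of `n ^ 2` squares. -/
def squareCorner (n q i : ℕ) : ℕ × ℕ :=
  (4 * (6 * q + 1) * (i / n), 4 * (6 * q + 1) * (i % n))

/-- The lowest corner of the `t`-th box of the `i`-th square. -/
def boxAnchor (n q i t : ℕ) : ℕ × ℕ :=
  (boxX q (squareCorner n q i).1 t, boxY q (squareCorner n q i).2 t)

theorem squareCorner_le {n : ℕ} (q : ℕ) {i : ℕ} (hi : i < n ^ 2) :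
    (squareCorner n q i).1 + 4 * (6 * q + 1) ≤ side n q ∧
      (squareCorner n q i).2 + 4 * (6 * q + 1) ≤ side n q := by
  have hn : 0 < n := Nat.pos_of_ne_zero fun h => by simp [h] at hi
  have hmul : ∀ k < n, 4 * (6 * q + 1) * k + 4 * (6 * q + 1) ≤ side n q := fun k hk => by
    rw [← Nat.mul_succ, side, mul_comm n]
    exact Nat.mul_le_mul_left _ hk
  exact ⟨hmul _ (Nat.div_lt_of_lt_mul (by rwa [← sq])), hmul _ (Nat.mod_lt i hn)⟩

theorem disjoint_block_squareCorner {n : ℕ} (q S : ℕ) {i i' : ℕ} (h : i ≠ i') :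
    Disjoint (Grid.block S (squareCorner n q i) (4 * (6 * q + 1)))
      (Grid.block S (squareCorner n q i') (4 * (6 * q + 1))) := by
  rw [Set.disjoint_left]
  rintro v ⟨⟨h1, h2⟩, h3, h4⟩ ⟨⟨h1', h2'⟩, h3', h4'⟩
  have hdiv : ∀ {a k : ℕ}, 4 * (6 * q + 1) * a ≤ k →
      k < 4 * (6 * q + 1) * a + 4 * (6 * q + 1) → k / (4 * (6 * q + 1)) = a := fun hle hlt =>
    Nat.div_eq_of_lt_le (by rwa [mul_comm]) (by rwa [mul_comm, Nat.mul_succ])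
  have hcol : i / n = i' / n := (hdiv h1 h2).symm.trans (hdiv h1' h2')
  have hrow : i % n = i' % n := (hdiv h3 h4).symm.trans (hdiv h3' h4')
  exact h (by rw [← Nat.div_add_mod i n, ← Nat.div_add_mod i' n, hcol, hrow])

theorem disjoint_block_boxAnchor {n : ℕ} (q S i : ℕ) {t t' : ℕ} (ht : t < 4) (ht' : t' < 4)
    (h : t ≠ t') : Disjoint (Grid.block S (boxAnchor n q i t) (2 * (3 * q) + 1))
      (Grid.block S (boxAnchor n q i t') (2 * (3 * q) + 1)) := by
  have horder := box_order q (squareCorner n q i).1 (squareCorner n q i).2 ht ht' h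
  rw [Set.disjoint_left]
  intro v hv hv'
  simp only [Grid.block, Set.mem_ofPred_eq, boxAnchor] at hv hv'
  omega

theorem squareSide_side {n : ℕ} (hn : 1 ≤ n) (q : ℕ) :
    squareSide (side n q) (n ^ 2) = 4 * (6 * q + 1) := by
  rw [squareSide, side, mul_pow, Nat.mul_div_cancel_left _ (by positivity), Nat.sqrt_eq']

theorem isRoute {q : ℕ} (b : Fin 4 ↪ Fin 4) (s : Fin (3 * q / 3)) (j : Fin 3) :
    IsRoute q (b 0) s (b j.succ) where
  source_lt := (b 0).2
  target_lt := (b j.succ).2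
  ne := Fin.val_ne_of_ne (b.injective.ne (Fin.succ_ne_zero j).symm)
  star_lt := by have := s.2; omega

theorem embedding_succ_val_ne (b : Fin 4 ↪ Fin 4) {j j' : Fin 3} (h : j ≠ j') :
    (b j.succ).val ≠ (b j'.succ).val :=
  Fin.val_ne_of_ne (b.injective.ne ((Fin.succ_injective _).ne h))

section StarPaths

variable {n q : ℕ} (hS : 0 < side n q) (i : Fin (n ^ 2)) (b : Fin 4 ↪ Fin 4)
  (s : Fin (3 * q / 3)) (j : Fin 3) (o : Fin (2 * (3 * q) + 1) × Fin (2 * (3 * q) + 1))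

/-- The `j`-th path of the `s`-th star for the boxes `b` of the `i`-th square, from box to box. -/
def gridArm : List (Grid (side n q)) :=
  (arm q (squareCorner n q i).1 (squareCorner n q i).2 (b 0) s (b j.succ)).map (toGrid hS)

/-- The extension of the path `gridArm` in the central box. -/
def gridHub : List (Grid (side n q)) :=
  (hub q (squareCorner n q i).1 (squareCorner n q i).2 (b 0) s (b j.succ)).map (toGrid hS)

/-- The extension of the path `gridArm` to the input location at position `o` of its last box. -/
def gridTail : List (Grid (side n q)) :=
  (tail q (squareCorner n q i).1 (squareCorner n q i).2 (b 0) s (b j.succ) o.1 o.2).map (toGrid hS)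

theorem gridHub_append_gridArm_append_gridTail :
    gridHub hS i b s j ++ gridArm hS i b s j ++ gridTail hS i b s j o =
      (path q (squareCorner n q i).1 (squareCorner n q i).2 (b 0) s (b j.succ) o.1 o.2).map
        (toGrid hS) := by
  unfold gridHub gridArm gridTail path
  rw [List.map_append, List.map_append]

variable {hS i b s j o}

theorem lt_side_of_inSquare {p : ℕ × ℕ}
    (hp : InSquare q (squareCorner n q i).1 (squareCorner n q i).2 p) :
    p.1 < side n q ∧ p.2 < side n q := by
  have hcorner := squareCorner_le q i.2
  unfold InSquare at hp
  omega

theorem toGrid_mem_block_squareCorner_iff {p : ℕ × ℕ} (hp : p.1 < side n q ∧ p.2 < side n q) :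
    toGrid hS p ∈ Grid.block (side n q) (squareCorner n q i) (4 * (6 * q + 1)) ↔
      InSquare q (squareCorner n q i).1 (squareCorner n q i).2 p :=
  toGrid_mem_block_iff hS hp _ _

theorem toGrid_mem_block_boxAnchor_iff {p : ℕ × ℕ} (hp : p.1 < side n q ∧ p.2 < side n q)
    {t : ℕ} :
    toGrid hS p ∈ Grid.block (side n q) (boxAnchor n q i t) (2 * (3 * q) + 1) ↔
      InBox q (squareCorner n q i).1 (squareCorner n q i).2 t p := by
  rw [toGrid_mem_block_iff hS hp, show 2 * (3 * q) + 1 = 6 * q + 1 by ring]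
  exact Iff.rfl

theorem toGrid_mem_block_boxAnchor {t : ℕ} (ht : t < 4) {p : ℕ × ℕ}
    (hp : InBox q (squareCorner n q i).1 (squareCorner n q i).2 t p) :
    toGrid hS p ∈ Grid.block (side n q) (boxAnchor n q i t) (2 * (3 * q) + 1) :=
  (toGrid_mem_block_boxAnchor_iff (lt_side_of_inSquare (inSquare_of_inBox ht hp))).2 hp

theorem position_le (k : Fin (2 * (3 * q) + 1)) : k.val ≤ 6 * q := by
  have := k.2
  omega

theorem lt_side_of_mem_path {p : ℕ × ℕ} (hp : p ∈ path q (squareCorner n q i).1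
    (squareCorner n q i).2 (b 0) s (b j.succ) o.1 o.2) : p.1 < side n q ∧ p.2 < side n q :=
  lt_side_of_inSquare ((isRoute b s j).inSquare_of_mem_path (position_le _) (position_le _) hp)

theorem lt_side_of_mem_arm {p : ℕ × ℕ} (hp : p ∈ arm q (squareCorner n q i).1
    (squareCorner n q i).2 (b 0) s (b j.succ)) : p.1 < side n q ∧ p.2 < side n q :=
  lt_side_of_mem_path (o := (0, 0)) (mem_path.2 (Or.inr (Or.inl hp)))

variable (hS i b s j o)

theorem gridArm_spec : ∃ v mid w, gridArm hS i b s j = v :: (mid ++ [w]) ∧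
    v ∈ Grid.block (side n q) (boxAnchor n q i (b 0)) (2 * (3 * q) + 1) ∧
    w ∈ Grid.block (side n q) (boxAnchor n q i (b j.succ)) (2 * (3 * q) + 1) ∧
    ∀ p ∈ mid, p ∈ Grid.block (side n q) (squareCorner n q i) (4 * (6 * q + 1)) ∧
      ∀ t, p ∉ Grid.block (side n q) (boxAnchor n q i (b t)) (2 * (3 * q) + 1) := by
  have hroute := isRoute b s j
  unfold gridArm arm
  rw [List.map_cons, List.map_append, List.map_singleton]
  refine ⟨_, _, _, rfl, toGrid_mem_block_boxAnchor hroute.source_lt (hroute.inBox_exit _ _),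
    toGrid_mem_block_boxAnchor hroute.target_lt (hroute.inBox_entry _ _), fun v hv => ?_⟩
  obtain ⟨p, hp, rfl⟩ := List.mem_map.1 hv
  have hsquare := hroute.inSquare_of_mem_bridge hp
  have hlt := lt_side_of_inSquare hsquare
  exact ⟨(toGrid_mem_block_squareCorner_iff hlt).2 hsquare, fun t h =>
    hroute.not_inBox_of_mem_bridge hp (b t).2 ((toGrid_mem_block_boxAnchor_iff hlt).1 h)⟩

theorem disjoint_gridArm {s s' : Fin (3 * q / 3)} (j j' : Fin 3) (h : s ≠ s') :
    (gridArm hS i b s j).Disjoint (gridArm hS i b s' j') :=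
  disjoint_map_toGrid hS ((isRoute b s j).disjoint_arm (isRoute b s' j')
    (Or.inl fun h' => h (Fin.ext h'))) (fun _ => lt_side_of_mem_arm) fun _ => lt_side_of_mem_arm

theorem sum_length_gridArm_le :
    ∑ j, (gridArm hS i b s j).length ≤ 6 * (4 * (6 * q + 1)) := by
  have hle := Finset.sum_le_card_nsmul Finset.univ (fun j => (gridArm hS i b s j).length)
    (2 * (4 * (6 * q + 1))) fun j _ => by
      rw [gridArm, List.length_map]
      exact (isRoute b s j).length_arm_le _ _
  rw [Finset.card_univ, Fintype.card_fin, smul_eq_mul] at hle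
  omega

theorem mem_block_of_mem_gridHub {v : Grid (side n q)} (hv : v ∈ gridHub hS i b s j) :
    v ∈ Grid.block (side n q) (boxAnchor n q i (b 0)) (2 * (3 * q) + 1) := by
  obtain ⟨p, hp, rfl⟩ := List.mem_map.1 hv
  exact toGrid_mem_block_boxAnchor (b 0).2 ((isRoute b s j).inBox_of_mem_hub hp)

theorem mem_block_of_mem_gridTail {v : Grid (side n q)} (hv : v ∈ gridTail hS i b s j o) :
    v ∈ Grid.block (side n q) (boxAnchor n q i (b j.succ)) (2 * (3 * q) + 1) := by
  obtain ⟨p, hp, rfl⟩ := List.mem_map.1 hv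
  exact toGrid_mem_block_boxAnchor (b j.succ).2
    ((isRoute b s j).inBox_of_mem_tail (position_le _) (position_le _) hp)

theorem isPath_gridPath :
    Grid.IsPath (gridHub hS i b s j ++ gridArm hS i b s j ++ gridTail hS i b s j o) := by
  rw [gridHub_append_gridArm_append_gridTail]
  exact isPath_map_toGrid hS ((isRoute b s j).nodup_path (position_le _) (position_le _))
    ((isRoute b s j).isChain_path _ _ _ _) fun _ => lt_side_of_mem_path

theorem getLast?_gridPath :
    ∃ v ∈ (gridHub hS i b s j ++ gridArm hS i b s j ++ gridTail hS i b s j o).getLast?,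
      v.1.val = (boxAnchor n q i (b j.succ)).1 + o.1.val ∧
        v.2.val = (boxAnchor n q i (b j.succ)).2 + o.2.val := by
  have hlast := (isRoute b s j).getLast?_path (squareCorner n q i).1 (squareCorner n q i).2 o.1 o.2
  have hlt := lt_side_of_mem_path (List.mem_of_getLast? hlast)
  rw [gridHub_append_gridArm_append_gridTail, List.getLast?_map]
  exact ⟨_, Option.mem_map_of_mem _ hlast, toGrid_val hS hlt.1 hlt.2⟩

theorem disjoint_gridPath {j j' : Fin 3} (h : j ≠ j')
    (o o' : Fin (2 * (3 * q) + 1) × Fin (2 * (3 * q) + 1)) :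
    (gridHub hS i b s j ++ gridArm hS i b s j ++ gridTail hS i b s j o).Disjoint
      (gridHub hS i b s j' ++ gridArm hS i b s j' ++ gridTail hS i b s j' o') := by
  rw [gridHub_append_gridArm_append_gridTail, gridHub_append_gridArm_append_gridTail]
  exact disjoint_map_toGrid hS ((isRoute b s j).disjoint_path (isRoute b s j')
    (embedding_succ_val_ne b h) (position_le _) (position_le _) (position_le _) (position_le _))
    (fun _ => lt_side_of_mem_path) fun _ => lt_side_of_mem_path

theorem length_gridPath_le :
    (gridHub hS i b s j ++ gridArm hS i b s j ++ gridTail hS i b s j o).length ≤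
      7 * (4 * (6 * q + 1)) := by
  rw [gridHub_append_gridArm_append_gridTail, List.length_map]
  exact (isRoute b s j).length_path_le _ _ (position_le _) (position_le _)

/-- The three vertices of the central box at which the paths of a star start. -/
def hubVertex (k : ℕ) : Grid (side n q) :=
  toGrid hS (hubCol q (squareCorner n q i).1 (b 0), hubRow q (squareCorner n q i).2 (b 0) s + k)

theorem hub_lt_side {k : ℕ} (hk : k ≤ 2) : hubCol q (squareCorner n q i).1 (b 0) < side n q ∧
    hubRow q (squareCorner n q i).2 (b 0) s + k < side n q := by
  have hcorner := squareCorner_le q i.2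
  have hbox := box_bounds q (squareCorner n q i).1 (squareCorner n q i).2 (b 0).2
  have hrow := hubRow_bounds (squareCorner n q i).2 (b 0) (isRoute b s 0).star_lt
  unfold hubCol
  omega

theorem next_hubVertex {k : ℕ} (hk : k ≤ 1) :
    Grid.Next Dir.up (hubVertex hS i b s k) (hubVertex hS i b s (k + 1)) :=
  (next_toGrid hS (hub_lt_side i b s (by omega)) (hub_lt_side i b s (by omega))).2.2.2 rfl rfl

/-- The order of the three paths of a star at the hub. -/
noncomputable def rankPerm (b : Fin 4 ↪ Fin 4) : Equiv.Perm (Fin 3) :=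
  Equiv.ofBijective (fun j => ⟨rank (b 0) (b j.succ), rank_lt _ _⟩)
    (Finite.injective_iff_bijective.1 fun j j' h => by
      by_contra hne
      exact embedding_succ_val_ne b hne (rank_injOn (b 0).2 (b j.succ).2 (b j'.succ).2
        (Fin.val_ne_of_ne (b.injective.ne (Fin.succ_ne_zero j).symm))
        (Fin.val_ne_of_ne (b.injective.ne (Fin.succ_ne_zero j').symm)) (Fin.ext_iff.1 h)))

theorem exists_gridHub_eq (hq : 2 ≤ q) : ∃ v l,
    gridHub hS i b s j = hubVertex hS i b s (rankPerm b j) :: v :: l ∧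
      ((hubVertex hS i b s (rankPerm b j)).dir v).ghzPort = ghzIndex (rankPerm b j) := by
  obtain ⟨p, l, hl, hp⟩ := (isRoute b s j).exists_hub_eq (squareCorner n q i).1
    (squareCorner n q i).2 hq
  have hpS : p.1 < side n q ∧ p.2 < side n q := lt_side_of_mem_path (o := (0, 0))
    (mem_path.2 (Or.inl (hl ▸ List.mem_cons_of_mem _ List.mem_cons_self)))
  refine ⟨toGrid hS p, l.map (toGrid hS), by rw [gridHub, hl]; rfl, ?_⟩
  have hrank : (rankPerm b j).val = rank (b 0) (b j.succ) := rfl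
  obtain ⟨hleft, hright, hdown, hup⟩ := next_toGrid hS
    (p := (hubCol q (squareCorner n q i).1 (b 0),
      hubRow q (squareCorner n q i).2 (b 0) s + (rankPerm b j).val))
    (hub_lt_side i b s (Nat.le_of_lt_succ (rankPerm b j).2)) hpS
  dsimp only at hleft hright hdown hup
  rcases hp with ⟨h, hcol, hrow⟩ | ⟨h, hrow, hcol | hcol⟩ | ⟨h, hcol, hrow⟩
  · rw [hubVertex, (hdown hcol.symm (by omega)).dir_eq, show rankPerm b j = 0 from Fin.ext h]
    rfl
  · rw [hubVertex, (hright (by omega) hcol.symm).dir_eq, show rankPerm b j = 1 from Fin.ext h]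
    rfl
  · rw [hubVertex, (hleft (by omega) hcol).dir_eq, show rankPerm b j = 1 from Fin.ext h]
    rfl
  · rw [hubVertex, (hup hcol.symm (by omega)).dir_eq, show rankPerm b j = 2 from Fin.ext h]
    rfl

end StarPaths

/-- The planting with `n ^ 2` squares, each of which holds four boxes of side `6 q + 1`. -/
def planting (n q : ℕ) (hn : 1 ≤ n) (hq : 2 ≤ q) (hnq : n ≤ q) :
    Planting 6 (side n q) (n ^ 2) (3 * q) where
  T := 4
  one_le_r := Nat.one_le_pow _ _ hn
  r_le := by
    rw [sq, side]
    exact Nat.mul_le_mul_left _ (by omega)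
  three_le_L := by omega
  six_L_le := by
    rw [squareSide_side hn]
    omega
  four_le_T := le_rfl
  corner i := squareCorner n q i
  corner_le i := by
    rw [squareSide_side hn]
    exact squareCorner_le q i.2
  squares_disjoint i i' h := by
    rw [squareSide_side hn]
    exact disjoint_block_squareCorner q _ fun h' => h (Fin.ext h')
  anchor i t := boxAnchor n q i t
  box_in_square i t := by
    have := box_bounds q (squareCorner n q i).1 (squareCorner n q i).2 t.2
    rw [squareSide_side hn]
    unfold boxAnchor
    dsimp only
    omega
  boxes_disjoint i t t' h := disjoint_block_boxAnchor q _ _ t.2 t'.2 fun h' => h (Fin.ext h')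
  dense := by
    rw [squareSide_side hn]
    ring_nf
    nlinarith
  arm := gridArm (side_pos hn q)
  hub := gridHub (side_pos hn q)
  tail := gridTail (side_pos hn q)
  arm_spec i b s j := by
    rw [squareSide_side hn]
    exact gridArm_spec _ i b s j
  stars_disjoint i b _ _ j j' h := disjoint_gridArm _ i b j j' h
  length_le i b s := by
    rw [squareSide_side hn]
    exact sum_length_gridArm_le _ i b s
  hub_in_box i b s j _ := mem_block_of_mem_gridHub _ i b s j
  tail_in_box i b s j o _ := mem_block_of_mem_gridTail _ i b s j o
  isPath := isPath_gridPath _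
  path_last := getLast?_gridPath _
  paths_disjoint i b s _ _ o o' h := disjoint_gridPath _ i b s h o o'

variable {n q : ℕ} (hn : 1 ≤ n) (hq : 2 ≤ q) (hnq : n ≤ q)

theorem length_pathAt_planting_le (i : Fin (n ^ 2)) (y : (planting n q hn hq hnq).Pos)
    (j : Fin 3) : ((planting n q hn hq hnq).pathAt i y j).length ≤ 7 * (4 * (6 * q + 1)) :=
  length_gridPath_le _ _ _ _ _ _

theorem exists_path_planting_eq (c : (planting n q hn hq hnq).Instance) (i : Fin (n ^ 2))
    (j : Fin 3) : ∃ v l, (planting n q hn hq hnq).path c i j =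
      hubVertex (side_pos hn q) i (c i).1 (c i).2.2.1 (rankPerm (c i).1 j) :: v :: l ∧
      ((hubVertex (side_pos hn q) i (c i).1 (c i).2.2.1 (rankPerm (c i).1 j)).dir v).ghzPort =
        ghzIndex (rankPerm (c i).1 j) := by
  obtain ⟨v, l, hl, hport⟩ := exists_gridHub_eq (side_pos hn q) i (c i).1 (c i).2.2.1 j hq
  refine ⟨v, l ++ gridArm (side_pos hn q) i (c i).1 (c i).2.2.1 j ++
    gridTail (side_pos hn q) i (c i).1 (c i).2.2.1 j ((c i).2.1 j), ?_, hport⟩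
  change gridHub (side_pos hn q) i (c i).1 (c i).2.2.1 j ++ _ ++ _ = _
  rw [hl]
  rfl

theorem isStar_planting (c : (planting n q hn hq hnq).Instance) (i : Fin (n ^ 2)) :
    Grid.IsStar ((planting n q hn hq hnq).path c i) := by
  have hpath := exists_path_planting_eq hn hq hnq c i
  refine ⟨fun j => (planting n q hn hq hnq).isPath i _ _ j _, fun j => ?_, fun j j' h =>
    (planting n q hn hq hnq).paths_disjoint i _ _ j j' _ _ h,
    ⟨fun k => hubVertex (side_pos hn q) i (c i).1 (c i).2.2.1 k,
      next_hubVertex _ _ _ _ zero_le_one, next_hubVertex _ _ _ _ le_rfl⟩,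
    rankPerm (c i).1, fun j => ?_⟩
  · obtain ⟨v, l, hl, -⟩ := hpath j
    rw [hl]
    exact Nat.le_add_left _ _
  · obtain ⟨v, l, hl, hport⟩ := hpath j
    simp only [hl, List.getElem_cons_zero, List.getElem_cons_succ]
    simpa only [true_and] using hport

end Layout

/-! ### The parameters -/

namespace Layout

/-- The number of squares in each direction. Its fourth power is of order `N`, so that the number
`squares N ^ 2` of copies is of order `√N`. -/
def squares (N : ℕ) : ℕ := Nat.sqrt (Nat.sqrt N) + 1

theorem one_le_squares (N : ℕ) : 1 ≤ squares N := Nat.le_add_left _ _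

theorem lt_squares_pow (N : ℕ) : N < squares N ^ 4 := by
  have hsqrt : Nat.sqrt N + 1 ≤ squares N * squares N := Nat.lt_succ_sqrt (Nat.sqrt N)
  calc N < (Nat.sqrt N + 1) * (Nat.sqrt N + 1) := Nat.lt_succ_sqrt N
    _ ≤ (squares N * squares N) * (squares N * squares N) := Nat.mul_le_mul hsqrt hsqrt
    _ = squares N ^ 4 := by ring

theorem squares_pow_le {N : ℕ} (hN : 1 ≤ N) : squares N ^ 4 ≤ 16 * N := by
  set k := Nat.sqrt (Nat.sqrt N)
  have hk_pos : 1 ≤ k := Nat.sqrt_pos.2 (Nat.sqrt_pos.2 hN)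
  have hk_sq : k * k ≤ Nat.sqrt N := Nat.sqrt_le _
  have hdouble : k + 1 ≤ 2 * k := by omega
  calc (k + 1) ^ 4 ≤ (2 * k) ^ 4 := Nat.pow_le_pow_left hdouble 4
    _ = 16 * ((k * k) * (k * k)) := by ring
    _ ≤ 16 * (Nat.sqrt N * Nat.sqrt N) := Nat.mul_le_mul_left _ (Nat.mul_le_mul hk_sq hk_sq)
    _ ≤ 16 * N := Nat.mul_le_mul_left _ (Nat.sqrt_le N)

theorem sqrt_le_squares_sq (N : ℕ) : √(N : ℝ) ≤ (squares N ^ 2 : ℕ) := by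
  have h : N ≤ (squares N ^ 2) ^ 2 := by
    rw [← pow_mul]
    exact (lt_squares_pow N).le
  rw [Real.sqrt_le_left (Nat.cast_nonneg _)]
  exact_mod_cast h

/-- A third of the parameter `L` of the boxes. It is cubic in `squares N` so that a box has many
more vertices than the light cones of all paths. -/
def boxes (N : ℕ) : ℕ := 2 * squares N ^ 3

theorem two_le_boxes (N : ℕ) : 2 ≤ boxes N := by
  have := Nat.one_le_pow 3 _ (one_le_squares N)
  unfold boxes
  omega

theorem squares_le_boxes (N : ℕ) : squares N ≤ boxes N := by
  have := Nat.le_self_pow (n := 3) (by omega) (squares N)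
  unfold boxes
  omega

theorem side_squares_boxes_le {N : ℕ} (hN : 1 ≤ N) : side (squares N) (boxes N) ≤ 832 * N := by
  have hpow := squares_pow_le hN
  have hself := Nat.le_self_pow (n := 4) (by omega) (squares N)
  calc side (squares N) (boxes N) = 48 * squares N ^ 4 + 4 * squares N := by
        unfold side boxes
        ring
    _ ≤ 832 * N := by omega

/-- The planting whose game is `G_N`. -/
def family (N : ℕ) : Planting 6 (side (squares N) (boxes N)) (squares N ^ 2) (3 * boxes N) :=
  planting (squares N) (boxes N) (one_le_squares N) (two_le_boxes N) (squares_le_boxes N)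

/-- The constant `c` such that the light cones of depth `c log N` and fan-in `K` have size at
most of order `N ^ (1 / 8)`. -/
noncomputable def depthConstant (K : ℕ) : ℝ := 1 / (8 * (Real.log (K + 1) + 1))

theorem log_natCast_add_one_nonneg (K : ℕ) : 0 ≤ Real.log (K + 1) :=
  Real.log_nonneg (le_add_of_nonneg_left (Nat.cast_nonneg K))

theorem depthConstant_pos (K : ℕ) : 0 < depthConstant K := by
  have := log_natCast_add_one_nonneg K
  unfold depthConstant
  positivity

theorem pow_eight_le_of_le_depthConstant_mul_log {K d N : ℕ} (hN : 1 ≤ N)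
    (hd : (d : ℝ) ≤ depthConstant K * Real.log N) : ((K + 1) ^ d) ^ 8 ≤ N := by
  have hK := log_natCast_add_one_nonneg K
  have hN_pos : (0 : ℝ) < N := by exact_mod_cast hN
  have hlog : 8 * (d * Real.log (K + 1)) ≤ Real.log N := by
    rw [depthConstant, one_div_mul_eq_div, le_div_iff₀ (by positivity)] at hd
    have : (0 : ℝ) ≤ d := Nat.cast_nonneg d
    linarith
  have hreal : (((K : ℝ) + 1) ^ d) ^ 8 ≤ N := by
    rw [← Real.log_le_log_iff (by positivity) hN_pos, Real.log_pow, Real.log_pow]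
    exact_mod_cast hlog
  exact_mod_cast hreal

theorem mul_fanIn_pow_le_squares {K d N : ℕ} (hN : 42 ^ 8 ≤ N)
    (hd : (d : ℝ) ≤ depthConstant K * Real.log N) : 42 * (K + 1) ^ d ≤ squares N := by
  have hcone := pow_eight_le_of_le_depthConstant_mul_log (by omega) hd
  refine le_of_lt (lt_of_pow_lt_pow_left₀ 8 (Nat.zero_le _) ?_)
  calc (42 * (K + 1) ^ d) ^ 8 = 42 ^ 8 * ((K + 1) ^ d) ^ 8 := mul_pow _ _ _
    _ ≤ N * N := Nat.mul_le_mul hN hcone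
    _ < squares N ^ 4 * squares N ^ 4 := Nat.mul_lt_mul'' (lt_squares_pow N) (lt_squares_pow N)
    _ = squares N ^ 8 := (pow_add _ 4 4).symm

theorem winProb_family_le_pow {K m N : ℕ} (hN : 42 ^ 8 ≤ N) (ρ : PMF (Fin m → Letter))
    (D : ClassicalCircuit Letter (Grid (side (squares N) (boxes N)) ⊕ Fin m)
      (Grid (side (squares N) (boxes N))) K)
    (hd : (D.depth : ℝ) ≤ depthConstant K * Real.log N) :
    (family N).game.winProb (classicalBehavior ρ D) ≤ (7 / 8) ^ (squares N ^ 2) := by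
  refine (family N).winProb_classicalBehavior_le ρ D (Λ := 7 * (4 * (6 * boxes N + 1)))
    (length_pathAt_planting_le _ _ _) ?_
  have hcone := mul_fanIn_pow_le_squares hN hd
  calc 18 * (squares N ^ 2 * (7 * (4 * (6 * boxes N + 1)) * (K + 1) ^ D.depth))
      = 12 * squares N ^ 2 * (42 * (K + 1) ^ D.depth) * (6 * boxes N + 1) := by ring
    _ ≤ 12 * squares N ^ 2 * squares N * (6 * boxes N + 1) := by gcongr
    _ = 6 * boxes N * (6 * boxes N + 1) := by
        unfold boxes
        ring
    _ ≤ (2 * (3 * boxes N) + 1) ^ 2 := by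
        rw [sq, ← mul_assoc]
        exact Nat.mul_le_mul_right _ (Nat.le_succ _)

theorem pow_squares_le_exp (N : ℕ) :
    (7 / 8 : ℝ) ^ (squares N ^ 2) ≤ Real.exp (-(Real.log (8 / 7) * √N)) := by
  have : 0 ≤ Real.log (8 / 7) := Real.log_nonneg (by norm_num)
  calc (7 / 8 : ℝ) ^ (squares N ^ 2)
      = Real.exp (-(Real.log (8 / 7) * (squares N ^ 2 : ℕ))) := by
        rw [← neg_mul, ← Real.log_inv, mul_comm, Real.exp_nat_mul, Real.exp_log (by norm_num)]
        norm_num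
    _ ≤ Real.exp (-(Real.log (8 / 7) * √N)) := by
        gcongr
        exact sqrt_le_squares_sq N

theorem winProb_family_le_exp {K m N : ℕ} (hN : 42 ^ 8 ≤ N) (ρ : PMF (Fin m → Letter))
    (D : ClassicalCircuit Letter (Grid (side (squares N) (boxes N)) ⊕ Fin m)
      (Grid (side (squares N) (boxes N))) K)
    (hd : (D.depth : ℝ) ≤ depthConstant K * Real.log N) :
    (family N).game.winProb (classicalBehavior ρ D) ≤ Real.exp (-(Real.log (8 / 7) * √N)) :=
  (winProb_family_le_pow hN ρ D hd).trans (pow_squares_le_exp N)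

end Layout

theorem exp_neg_mul_sqrt_le_exp_neg_mul_rpow {δ x η : ℝ} (hδ : 0 ≤ δ) (hx : 1 ≤ x)
    (hη : η ≤ 1 / 2) : Real.exp (-(δ * √x)) ≤ Real.exp (-(δ * x ^ η)) := by
  rw [Real.sqrt_eq_rpow]
  gcongr

theorem mainTheorem2_general :
    ∃ (C κ a K₀ R : ℕ) (side r L : ℕ → ℕ) (P : ∀ N : ℕ, Planting κ (side N) (r N) (L N)),
      (∀ N : ℕ, 1 ≤ N → side N ≤ C * N) ∧
      (∀ N : ℕ, ∃ Q : QCircuit (side N) a,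
        Q.depth ≤ 3 ∧ Q.FanIn K₀ ∧ Q.GeometricallyLocal R ∧
        (P N).game.winProb Q.behavior = 1) ∧
      ∃ δ : ℝ, 0 < δ ∧ ∃ N₀ : ℕ, ∀ K : ℕ, ∃ c : ℝ, 0 < c ∧
        ∀ N : ℕ, N₀ ≤ N → ∀ (m : ℕ) (ρ : PMF (Fin m → Letter))
          (D : ClassicalCircuit Letter (Grid (side N) ⊕ Fin m) (Grid (side N)) K),
          (D.depth : ℝ) ≤ c * Real.log N →
          (P N).game.winProb (classicalBehavior ρ D) ≤ Real.exp (-(δ * √N)) := by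
  refine ⟨832, 6, 7, 15, 2, _, _, _, Layout.family,
    fun N hN => Layout.side_squares_boxes_le hN, fun N => ?_, ?_⟩
  · exact ⟨teleportCircuit _, depth_teleportCircuit, fanIn_teleportCircuit,
      geometricallyLocal_teleportCircuit,
      (Layout.family N).winProb_teleportCircuit (Layout.isStar_planting _ _ _)⟩
  · exact ⟨Real.log (8 / 7), Real.log_pos (by norm_num), 42 ^ 8, fun K =>
      ⟨Layout.depthConstant K, Layout.depthConstant_pos K, fun N hN m ρ D hd =>
        Layout.winProb_family_le_exp hN ρ D hd⟩⟩

theorem mainTheorem2 :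
    ∃ (C κ a K₀ R : ℕ) (side r L : ℕ → ℕ) (P : ∀ N : ℕ, Planting κ (side N) (r N) (L N)),
      (∀ N : ℕ, 1 ≤ N → side N ≤ C * N) ∧
      (∀ N : ℕ, 1 ≤ N → ∃ Q : QCircuit (side N) a,
        Q.depth ≤ 3 ∧ Q.FanIn K₀ ∧ Q.GeometricallyLocal R ∧
        (P N).game.winProb Q.behavior = 1) ∧
      (∀ (K : ℕ) (η : ℝ), η < 1 / 7 → ∃ c : ℝ, 0 < c ∧ ∃ δ : ℝ, 0 < δ ∧ ∃ N₀ : ℕ,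
        ∀ N : ℕ, N₀ ≤ N → ∀ (m : ℕ) (ρ : PMF (Fin m → Letter))
          (D : ClassicalCircuit Letter (Grid (side N) ⊕ Fin m) (Grid (side N)) K),
          (D.depth : ℝ) ≤ c * Real.log N →
          (P N).game.winProb (classicalBehavior ρ D) ≤ Real.exp (-(δ * (N : ℝ) ^ η))) := by
  obtain ⟨C, κ, a, K₀, R, side, r, L, P, hside, hcomplete, δ, hδ, N₀, hsound⟩ :=
    mainTheorem2_general
  refine ⟨C, κ, a, K₀, R, side, r, L, P, hside, fun N _ => hcomplete N, fun K η hη => ?_⟩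
  obtain ⟨c, hc, hwin⟩ := hsound K
  refine ⟨c, hc, δ, hδ, max N₀ 1, fun N hN m ρ D hD => ?_⟩
  exact (hwin N (le_of_max_le_left hN) m ρ D hD).trans
    (exp_neg_mul_sqrt_le_exp_neg_mul_rpow hδ.le (by exact_mod_cast le_of_max_le_right hN)
      (by linarith))
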